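/- Let $A=(a_{ij})_{n\times n}$ be a matrix with entries in $\{0,1\}$ and let $\underline T=(T_1,\dots,T_n)$ be a tuple of bounded operators on a complex Hilbert space $\mathcal H$ that is contractive ($\sum_i T_iT_i^*\le I$), commuting ($T_iT_j=T_jT_i$) and satisfies $A$-relations ($T_iT_j=a_{ij}T_iT_j$ for all $i,j$). *Definitions.* For a word $\alpha=\alpha_1\cdots\alpha_m$ in $\{1,\dots,n\}$ write $\underline T^\alpha=T_{\alpha_1}\cdots T_{\alpha_m}$ (the identity for the empty word). A *minimal Cuntz–Krieger dilation* of $\underline T$ is a tuple $\underline R=(R_1,\dots,R_n)$ of partial isometries with orthogonal ranges on a Hilbert space $\mathcal L\supseteq\mathcal H$ such that $R_i^*h=T_i^*h$ for $h\in\mathcal H$, $R_iR_j=a_{ij}R_iR_j$, $R_i^*R_i=I-\sum_j(1-a_{ij})R_jR_j^*$, and $\overline{\mathrm{span}}\{\underline R^\alpha h:\alpha \text{ a word},\,h\in\mathcal H\}=\mathcal L$. The *maximal commuting subspace* $\mathcal L^c(\underline R)$ is the largest closed subspace of $\mathcal L$ that is invariant under all $R_i^*$ and on which all $(R_iR_j-R_jR_i)^*$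 vanish; the *maximal commuting piece* of $\underline R$ is the compression of $\underline R$ to $\mathcal L^c(\underline R)$. Let $\Gamma(\mathbb C^n)=\bigoplus_{m\ge0}(\mathbb C^n)^{\otimes m}$ be the full Fock space with orthonormal basis $e^\alpha=e_{\alpha_1}\otimes\cdots\otimes e_{\alpha_m}$ and left creation operators $L_ix=e_i\otimes x$, and let $P^s$ be the projection that symmetrizes each tensor power. The *commuting $A$-Fock space* $\Gamma_{sA}$ is the closed span of the vectors $P^se^\alpha$ over all words $\alpha$ with $a_{\alpha_i\alpha_j}=1$ for all positions $i\ne j$ (all words of length at most $1$ included). Let $W_i$ be the compression of $L_i$ to $\Gamma_{sA}$ and $C^*(\underline W)$ the unital $C^*$-algebra generated by $W_1,\dots,W_n$. For $0<r<1$ put $\Delta_r=(I-r^2\sum_iT_iT_i^*)^{1/2}$ and $K_rh=\sum_\alpha e^\alpha\otimes\Delta_r\,(r^{|\alpha|}\underline T^\alpha)^*h$, where $\alpha$ runs over all words with $a_{\alpha_k\alpha_{k+1}}=1$ for all $k$; its values lie in $\Gamma_{sA}\otimes\mathcal H$. Let $\phi:C^*(\underline W)\to B(\mathcal H)$ be the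 unital completely positive map $\phi(X)=\lim_{r\uparrow1}K_r^*(X\otimes I)K_r$ (strong operator limit). A *standard commuting $A$-dilation* of $\underline T$ is a tuple $\check{\underline W}=(\pi_0(W_1),\dots,\pi_0(W_n))$, where $\pi_0:C^*(\underline W)\to B(\mathcal H_0)$, $\mathcal H_0\supseteq\mathcal H$, is a minimal Stinespring dilation of $\phi$, i.e. a unital $*$-representation with $\phi(X)=P_{\mathcal H}\pi_0(X)|_{\mathcal H}$ for all $X$ and $\overline{\mathrm{span}}\{\pi_0(X)h:X\in C^*(\underline W),\,h\in\mathcal H\}=\mathcal H_0$. **Lemma.** Both a minimal Cuntz–Krieger dilation and a standard commuting $A$-dilation of $\underline T$ exist, and the maximal commuting piece of the minimal Cuntz–Krieger dilation is the standard commuting $A$-dilation. That is, for every minimal Cuntz–Krieger dilation $\underline R$ of $\underline T$ on $\mathcal L\supseteq\mathcal H$ and every standard commuting $A$-dilation $\check{\underline W}$ of $\underline T$ on $\mathcal H_0\supseteq\mathcal H$ one has $\mathcal H\subseteq\mathcal L^c(\underline R)$, and there is a unitary $U:\mathcal L^c(\underline R)\to\mathcal H_0$ that is the identity on $\mathcal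 H$ and carries the maximal commuting piece of $\underline R$ to $\check{\underline W}$. -/

import Mathlib

open scoped TensorProduct InnerProductSpace Topology

universe u v w

noncomputable section

namespace CKDilation

/-! ### Tuples of operators -/

section Tuples

variable {n : ℕ} {H : Type u} [NormedAddCommGroup H] [InnerProductSpace ℂ H]

/-- The product `T_{α₁} T_{α₂} ⋯ T_{αₘ}` along a word `α = α₁ α₂ ⋯ αₘ`; the empty word gives the
identity. -/
def wordProd (T : Fin n → H →L[ℂ] H) (α : List (Fin n)) : H →L[ℂ] H :=
  (α.map T).prod

/-- The `A`-relations `T_i T_j = a_{ij} T_i T_j`. -/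
def SatisfiesARelations (A : Matrix (Fin n) (Fin n) ℂ) (T : Fin n → H →L[ℂ] H) : Prop :=
  ∀ i j, T i * T j = A i j • (T i * T j)

variable [CompleteSpace H]

/-- A contractive tuple (row contraction): `∑ T_i T_i* ≤ I`. -/
def IsContractiveTuple (T : Fin n → H →L[ℂ] H) : Prop :=
  ∑ i, T i * star (T i) ≤ 1

/-- The unital `C*`-algebra generated by the operators of a tuple: the norm closure of the unital
`*`-algebra that they generate. -/
def generatedCStarAlgebra (T : Fin n → H →L[ℂ] H) : StarSubalgebra ℂ (H →L[ℂ] H) :=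
  (StarAlgebra.adjoin ℂ (Set.range T)).topologicalClosure

theorem mem_generatedCStarAlgebra (T : Fin n → H →L[ℂ] H) (i : Fin n) :
    T i ∈ generatedCStarAlgebra T :=
  StarSubalgebra.le_topologicalClosure _ (StarAlgebra.subset_adjoin ℂ _ ⟨i, rfl⟩)

end Tuples

/-! ### Minimal Cuntz-Krieger dilations -/

section Dilations

variable {n : ℕ} {H : Type u} [NormedAddCommGroup H] [InnerProductSpace ℂ H] [CompleteSpace H]
  {L : Type v} [NormedAddCommGroup L] [InnerProductSpace ℂ L] [CompleteSpace L]

/-- `R` on `L` is a dilation of `T` on `H`, where `H` is regarded as a closed subspace of `L` through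
the isometry `J`: one has `R_i* h = T_i* h` for all `h` in `H`. -/
def IsDilation (T : Fin n → H →L[ℂ] H) (R : Fin n → L →L[ℂ] L) (J : H →ₗᵢ[ℂ] L) : Prop :=
  ∀ i h, star (R i) (J h) = J (star (T i) h)

/-- Minimality of a dilation: the vectors `R^α h` (all words `α`, all `h` in `H`) span a dense
subspace. -/
def IsMinimalDilation (R : Fin n → L →L[ℂ] L) (J : H →ₗᵢ[ℂ] L) : Prop :=
  (Submodule.span ℂ {x : L | ∃ (α : List (Fin n)) (h : H), x = wordProd R α (J h)}).topologicalClosure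
    = ⊤

/-- `R` (with the embedding `J`) is a minimal Cuntz-Krieger dilation of `T`: a minimal dilation made of
partial isometries with orthogonal ranges which satisfy the `A`-relations and
`R_i* R_i = I - ∑_j (1 - a_{ij}) R_j R_j*`. -/
structure IsMinimalCuntzKriegerDilation (A : Matrix (Fin n) (Fin n) ℂ) (T : Fin n → H →L[ℂ] H)
    (R : Fin n → L →L[ℂ] L) (J : H →ₗᵢ[ℂ] L) : Prop where
  dilation : IsDilation T R J
  partialIsometry : ∀ i, R i * star (R i) * R i = R i
  orthogonalRanges : ∀ i j, i ≠ j → star (R i) * R j = 0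
  aRelations : SatisfiesARelations A R
  cuntzKrieger : ∀ i, star (R i) * R i = 1 - ∑ j, (1 - A i j) • (R j * star (R j))
  minimal : IsMinimalDilation R J

end Dilations

/-! ### Maximal pieces -/

section MaximalPiece

variable {n : ℕ} {L : Type u} [NormedAddCommGroup L] [InnerProductSpace ℂ L] [CompleteSpace L]

/-- The closed subspaces `M` of `L` that are invariant under all `R_i*` and on which all
`(p_ξ(R))*` vanish, for a family `p` of polynomials in `n` noncommuting variables. -/
def coinvariantClass {I : Type*} (p : I → FreeAlgebra ℂ (Fin n)) (R : Fin n → L →L[ℂ] L) :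
    Set (Submodule ℂ L) :=
  {M | IsClosed (M : Set L) ∧ (∀ i, ∀ x ∈ M, star (R i) x ∈ M) ∧
    ∀ ξ, ∀ x ∈ M, star (FreeAlgebra.lift ℂ R (p ξ)) x = 0}

/-- The largest member of `coinvariantClass p R`: the closed span of all its members. -/
def maximalSubspace {I : Type*} (p : I → FreeAlgebra ℂ (Fin n)) (R : Fin n → L →L[ℂ] L) :
    Submodule ℂ L :=
  (sSup (coinvariantClass p R)).topologicalClosure

theorem isGreatest_maximalSubspace {I : Type*} (p : I → FreeAlgebra ℂ (Fin n))
    (R : Fin n → L →L[ℂ] L) : IsGreatest (coinvariantClass p R) (maximalSubspace p R) := by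
  refine ⟨⟨Submodule.isClosed_topologicalClosure _, fun i => ?_, fun ξ => ?_⟩, fun M hM =>
    (le_sSup hM).trans (Submodule.le_topologicalClosure _)⟩
  · have h : maximalSubspace p R ≤ (maximalSubspace p R).comap (star (R i)).toLinearMap := by
      refine Submodule.topologicalClosure_minimal _ (sSup_le fun M hM x hx => ?_)
        ((Submodule.isClosed_topologicalClosure _).preimage (star (R i)).continuous)
      exact (le_sSup hM).trans (Submodule.le_topologicalClosure _) (hM.2.1 i x hx)
    exact h
  · have h : maximalSubspace p R ≤ (star (FreeAlgebra.lift ℂ R (p ξ))).ker := by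
      refine Submodule.topologicalClosure_minimal _ (sSup_le fun M hM x hx => ?_)
        (ContinuousLinearMap.isClosed_ker _)
      exact hM.2.2 ξ x hx
    exact h

/-- The polynomials `z_l z_m - z_m z_l`. -/
def commutatorPoly (lm : Fin n × Fin n) : FreeAlgebra ℂ (Fin n) :=
  FreeAlgebra.ι ℂ lm.1 * FreeAlgebra.ι ℂ lm.2 - FreeAlgebra.ι ℂ lm.2 * FreeAlgebra.ι ℂ lm.1

/-- The maximal commuting subspace `L^c(R)` of a tuple `R` on `L`. -/
def maximalCommutingSubspace (R : Fin n → L →L[ℂ] L) : Submodule ℂ L :=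
  maximalSubspace commutatorPoly R

instance (R : Fin n → L →L[ℂ] L) : CompleteSpace (maximalCommutingSubspace R) :=
  (Submodule.isClosed_topologicalClosure _).completeSpace_coe

/-- The compression `P_K X|_K` of an operator to a closed subspace. -/
def compression (K : Submodule ℂ L) [CompleteSpace K] (X : L →L[ℂ] L) : K →L[ℂ] K :=
  K.orthogonalProjectionOnto ∘L X ∘L K.subtypeL

/-- The maximal commuting piece of `R`. -/
def maximalCommutingPiece (R : Fin n → L →L[ℂ] L) (i : Fin n) :
    maximalCommutingSubspace R →L[ℂ] maximalCommutingSubspace R :=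
  compression (maximalCommutingSubspace R) (R i)

end MaximalPiece

/-! ### Full Fock space and commuting `A`-Fock space -/

section Fock

variable {n : ℕ}

/-- The full Fock space `ℂ ⊕ ℂⁿ ⊕ (ℂⁿ)^{⊗2} ⊕ ⋯`, through its standard orthonormal basis
`e^α = e_{α₁} ⊗ ⋯ ⊗ e_{αₘ}` indexed by the words `α`; the empty word gives the vacuum vector. -/
def FullFock (n : ℕ) : Type := lp (fun _ : List (Fin n) => ℂ) 2

instance (n : ℕ) : NormedAddCommGroup (FullFock n) :=
  inferInstanceAs (NormedAddCommGroup (lp (fun _ : List (Fin n) => ℂ) 2))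

instance (n : ℕ) : InnerProductSpace ℂ (FullFock n) :=
  inferInstanceAs (InnerProductSpace ℂ (lp (fun _ : List (Fin n) => ℂ) 2))

instance (n : ℕ) : CompleteSpace (FullFock n) :=
  inferInstanceAs (CompleteSpace (lp (fun _ : List (Fin n) => ℂ) 2))

/-- The basis vector `e^α`. -/
def fockBasis (α : List (Fin n)) : FullFock n :=
  (lp.single 2 α (1 : ℂ) : lp (fun _ : List (Fin n) => ℂ) 2)

theorem orthonormal_fockBasis : Orthonormal ℂ (fockBasis : List (Fin n) → FullFock n) := by
  classical
  rw [orthonormal_iff_ite]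
  intro α β
  change inner ℂ (lp.single 2 α (1 : ℂ) : lp (fun _ : List (Fin n) => ℂ) 2) (lp.single 2 β (1 : ℂ)) = _
  rw [lp.inner_single_left]
  by_cases h : α = β
  · subst h; simp
  · simp [lp.single_apply, h]

theorem orthonormal_fockBasis_cons (i : Fin n) :
    Orthonormal ℂ (fun α : List (Fin n) => (fockBasis (i :: α) : FullFock n)) :=
  orthonormal_fockBasis.comp _ List.cons_injective

/-- The left creation operator `L_i x = e_i ⊗ x`: the isometry that sends `e^α` to `e^{iα}`. -/
def leftCreation (i : Fin n) : FullFock n →L[ℂ] FullFock n :=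
  let L : lp (fun _ : List (Fin n) => ℂ) 2 →ₗᵢ[ℂ] FullFock n :=
    (orthonormal_fockBasis_cons i).orthogonalFamily.linearIsometry
  L.toContinuousLinearMap

theorem leftCreation_fockBasis (i : Fin n) (α : List (Fin n)) :
    leftCreation i (fockBasis α) = fockBasis (i :: α) := by
  classical
  refine ((orthonormal_fockBasis_cons i).orthogonalFamily.linearIsometry_apply_single _).trans ?_
  simp

/-- The symmetrized vector `P^s e^α = (1/m!) ∑_σ e_{α_{σ⁻¹(1)}} ⊗ ⋯ ⊗ e_{α_{σ⁻¹(m)}}`, where `m` is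
the length of `α`. -/
def symmVector (α : List (Fin n)) : FullFock n :=
  ((α.length.factorial : ℂ)⁻¹) •
    ∑ σ : Equiv.Perm (Fin α.length), fockBasis (List.ofFn fun k => α.get (σ⁻¹ k))

/-- The words `α` with `a_{α_i α_j} = 1` for all positions `i ≠ j` (all words of length at most one
are included). -/
def IsSymmetricAWord (A : Matrix (Fin n) (Fin n) ℂ) (α : List (Fin n)) : Prop :=
  ∀ i j : Fin α.length, i ≠ j → A (α.get i) (α.get j) = 1

/-- The words `α` with `a_{α_k α_{k+1}} = 1` for all `k`. -/
def IsAWord (A : Matrix (Fin n) (Fin n) ℂ) (α : List (Fin n)) : Prop :=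
  α.IsChain fun i j => A i j = 1

/-- The commuting `A`-Fock space. -/
def commFock (A : Matrix (Fin n) (Fin n) ℂ) : Submodule ℂ (FullFock n) :=
  (Submodule.span ℂ {x | ∃ α, IsSymmetricAWord A α ∧ x = symmVector α}).topologicalClosure

instance (A : Matrix (Fin n) (Fin n) ℂ) : CompleteSpace (commFock A) :=
  (Submodule.isClosed_topologicalClosure _).completeSpace_coe

/-- The creation operators `W_i` on the commuting `A`-Fock space: the compressions of the `L_i`. -/
def commCreation (A : Matrix (Fin n) (Fin n) ℂ) (i : Fin n) : commFock A →L[ℂ] commFock A :=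
  compression (commFock A) (leftCreation i)

/-- The unital `C*`-algebra `C*(W)` generated by the `W_i`. -/
def creationAlgebra (A : Matrix (Fin n) (Fin n) ℂ) :
    StarSubalgebra ℂ (commFock A →L[ℂ] commFock A) :=
  generatedCStarAlgebra (commCreation A)

theorem commCreation_mem (A : Matrix (Fin n) (Fin n) ℂ) (i : Fin n) :
    commCreation A i ∈ creationAlgebra A :=
  mem_generatedCStarAlgebra (commCreation A) i

end Fock

/-! ### The Poisson kernel -/

section Poisson

variable {n : ℕ} {H : Type u} [NormedAddCommGroup H] [InnerProductSpace ℂ H]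

/-- The Hilbert space tensor product. -/
abbrev HilbertTensor (G : Type v) (H : Type u) [NormedAddCommGroup G] [InnerProductSpace ℂ G]
    [NormedAddCommGroup H] [InnerProductSpace ℂ H] : Type (max v u) :=
  UniformSpace.Completion (G ⊗[ℂ] H)

/-- The operator `X ⊗ I`. -/
def ampliation {G : Type v} {G' : Type w} [NormedAddCommGroup G] [InnerProductSpace ℂ G]
    [NormedAddCommGroup G'] [InnerProductSpace ℂ G'] (H : Type u) [NormedAddCommGroup H]
    [InnerProductSpace ℂ H] (X : G →L[ℂ] G') : HilbertTensor G H →L[ℂ] HilbertTensor G' H :=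
  (X.rTensor H).completion

/-- The isometry `v ↦ e^α ⊗ v` from `H` to `Γ(ℂⁿ) ⊗ H`. -/
def basisTensor (α : List (Fin n)) : H →ₗᵢ[ℂ] HilbertTensor (FullFock n) H where
  toFun x := ((fockBasis α ⊗ₜ[ℂ] x : FullFock n ⊗[ℂ] H) : HilbertTensor (FullFock n) H)
  map_add' x y := by rw [TensorProduct.tmul_add, UniformSpace.Completion.coe_add]
  map_smul' c x := by
    rw [TensorProduct.tmul_smul, UniformSpace.Completion.coe_smul, RingHom.id_apply]
  norm_map' x := by
    have h : ‖(fockBasis α : FullFock n)‖ = 1 := orthonormal_fockBasis.1 α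
    simp [h]

theorem orthogonalFamily_basisTensor :
    OrthogonalFamily ℂ (fun _ : List (Fin n) => H)
      (fun α => (basisTensor α : H →ₗᵢ[ℂ] HilbertTensor (FullFock n) H)) := by
  intro α β hαβ x y
  have h : inner ℂ (fockBasis α : FullFock n) (fockBasis β) = 0 := orthonormal_fockBasis.2 hαβ
  simp [basisTensor, UniformSpace.Completion.inner_coe, h]

variable [CompleteSpace H]

/-- The defect operator `(I - ∑ T_i T_i*)^{1/2}`. -/
def defect (T : Fin n → H →L[ℂ] H) : H →L[ℂ] H :=
  CFC.sqrt (1 - ∑ i, T i * star (T i))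

theorem norm_defect_sq {T : Fin n → H →L[ℂ] H} (hT : IsContractiveTuple T) (h : H) :
    ‖defect T h‖ ^ 2 + ∑ i, ‖star (T i) h‖ ^ 2 = ‖h‖ ^ 2 := by
  have hpos : 0 ≤ 1 - ∑ i, T i * star (T i) := sub_nonneg.2 hT
  have hsa : star (defect T) = defect T := (CFC.sqrt_nonneg _).isSelfAdjoint
  have hsq : defect T * defect T = 1 - ∑ i, T i * star (T i) := CFC.sqrt_mul_sqrt_self _ hpos
  have key : ∀ X : H →L[ℂ] H, ((‖star X h‖ : ℂ)) ^ 2 = inner ℂ h ((X * star X) h) := by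
    intro X
    have h0 := inner_self_eq_norm_sq_to_K (𝕜 := ℂ) (star X h)
    rw [ContinuousLinearMap.star_eq_adjoint, ContinuousLinearMap.adjoint_inner_left] at h0
    exact h0.symm
  have h1 := key (defect T)
  rw [hsa, hsq] at h1
  have h2 : ((‖h‖ : ℂ)) ^ 2 = inner ℂ h h := (inner_self_eq_norm_sq_to_K (𝕜 := ℂ) h).symm
  have h3 : ((‖defect T h‖ ^ 2 + ∑ i, ‖star (T i) h‖ ^ 2 : ℝ) : ℂ) = ((‖h‖ ^ 2 : ℝ) : ℂ) := by
    push_cast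
    rw [h1, h2, Finset.sum_congr rfl fun i _ => key (T i), ← inner_sum, ← inner_add_right]
    simp
  exact_mod_cast h3

/-- The coefficient `Δ_T (T^α)* h` of the Poisson kernel at an `A`-word `α`. -/
def poissonCoeff (A : Matrix (Fin n) (Fin n) ℂ) (T : Fin n → H →L[ℂ] H) (α : List (Fin n)) :
    H →L[ℂ] H :=
  open Classical in if IsAWord A α then defect T * star (wordProd T α) else 0

theorem sum_norm_poisson_le {T : Fin n → H →L[ℂ] H} (hT : IsContractiveTuple T) (N : ℕ) :
    ∀ (h : H) (F : Finset (List (Fin n))), (∀ α ∈ F, α.length < N) →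
      ∑ α ∈ F, ‖defect T (star (wordProd T α) h)‖ ^ 2 ≤ ‖h‖ ^ 2 := by
  classical
  induction N with
  | zero =>
    intro h F hF
    have : F = ∅ := Finset.eq_empty_of_forall_notMem fun α hα => absurd (hF α hα) (by simp)
    simp [this]
  | succ N ih =>
    intro h F hF
    let G : Fin n → Finset (List (Fin n)) := fun i =>
      F.preimage (fun β => i :: β) (List.cons_injective.injOn)
    have hsub : F ⊆ insert [] ((Finset.univ.sigma G).image fun p => p.1 :: p.2) := by
      intro α hα
      cases α with
      | nil => simp
      | cons i β =>
        refine Finset.mem_insert_of_mem (Finset.mem_image.2 ⟨⟨i, β⟩, ?_, rfl⟩)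
        simpa [G] using hα
    calc ∑ α ∈ F, ‖defect T (star (wordProd T α) h)‖ ^ 2
        ≤ ∑ α ∈ insert [] ((Finset.univ.sigma G).image fun p => p.1 :: p.2),
            ‖defect T (star (wordProd T α) h)‖ ^ 2 :=
          Finset.sum_le_sum_of_subset_of_nonneg hsub fun _ _ _ => by positivity
      _ = ‖defect T h‖ ^ 2 + ∑ i, ∑ β ∈ G i,
            ‖defect T (star (wordProd T β) (star (T i) h))‖ ^ 2 := by
          rw [Finset.sum_insert (by simp), Finset.sum_image, Finset.sum_sigma]
          · simp [wordProd]
          · rintro ⟨i, β⟩ _ ⟨j, γ⟩ _ hij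
            simp only [List.cons.injEq] at hij
            obtain ⟨rfl, rfl⟩ := hij
            rfl
      _ ≤ ‖defect T h‖ ^ 2 + ∑ i, ‖star (T i) h‖ ^ 2 := by
          gcongr with i _
          refine ih _ _ fun β hβ => ?_
          have := hF (i :: β) (by simpa [G] using hβ)
          simpa using this
      _ = ‖h‖ ^ 2 := norm_defect_sq hT h

theorem sum_norm_poissonCoeff_le (A : Matrix (Fin n) (Fin n) ℂ) {T : Fin n → H →L[ℂ] H}
    (hT : IsContractiveTuple T) (h : H) (F : Finset (List (Fin n))) :
    ∑ α ∈ F, ‖poissonCoeff A T α h‖ ^ 2 ≤ ‖h‖ ^ 2 := by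
  classical
  refine le_trans (Finset.sum_le_sum fun α _ => ?_) (sum_norm_poisson_le hT (F.sup List.length + 1)
    h F fun α hα => Nat.lt_succ_of_le (Finset.le_sup (f := List.length) hα))
  unfold poissonCoeff
  split_ifs
  · rfl
  · simp

theorem memℓp_poissonCoeff (A : Matrix (Fin n) (Fin n) ℂ) {T : Fin n → H →L[ℂ] H}
    (hT : IsContractiveTuple T) (h : H) :
    Memℓp (fun α : List (Fin n) => poissonCoeff A T α h) 2 := by
  refine memℓp_gen' (C := ‖h‖ ^ 2) fun F => ?_
  simpa using sum_norm_poissonCoeff_le A hT h F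

/-- The coefficients of the Poisson kernel, as a contraction from `H` to `ℓ²(words; H)`. -/
def poissonCoeffs (A : Matrix (Fin n) (Fin n) ℂ) (T : Fin n → H →L[ℂ] H)
    (hT : IsContractiveTuple T) : H →L[ℂ] lp (fun _ : List (Fin n) => H) 2 :=
  LinearMap.mkContinuous
    { toFun := fun h => ⟨fun α => poissonCoeff A T α h, memℓp_poissonCoeff A hT h⟩
      map_add' := fun x y => by ext α; exact map_add _ _ _
      map_smul' := fun c x => by ext α; exact map_smul _ _ _ } 1 (fun h => by
        refine lp.norm_le_of_forall_sum_le (by norm_num) (by positivity) fun F => ?_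
        simpa using sum_norm_poissonCoeff_le A hT h F)

/-- The Poisson kernel `K_T h = ∑_α e^α ⊗ Δ_T (T^α)* h` of a contractive tuple, the sum being over the
`A`-words `α`, as an operator from `H` to `Γ(ℂⁿ) ⊗ H`. (It is only used for contractive tuples; the
value for other tuples is irrelevant.) -/
def poissonKernel (A : Matrix (Fin n) (Fin n) ℂ) (T : Fin n → H →L[ℂ] H) :
    H →L[ℂ] HilbertTensor (FullFock n) H :=
  open Classical in
  if hT : IsContractiveTuple T then
    (orthogonalFamily_basisTensor (n := n) (H := H)).linearIsometry.toContinuousLinearMap ∘L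
      poissonCoeffs A T hT
  else 0

theorem poissonKernel_apply (A : Matrix (Fin n) (Fin n) ℂ) {T : Fin n → H →L[ℂ] H}
    (hT : IsContractiveTuple T) (h : H) :
    poissonKernel A T h = ∑' α, basisTensor α (poissonCoeff A T α h) := by
  simp only [poissonKernel, dif_pos hT, ContinuousLinearMap.comp_apply]
  exact (orthogonalFamily_basisTensor (n := n) (H := H)).linearIsometry_apply _

/-- The Poisson kernel regarded as an operator into `Γ_{sA} ⊗ H`, where `Γ_{sA}` is the commuting
`A`-Fock space (for commuting tuples with `A`-relations its values lie there). -/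
def commPoissonKernel (A : Matrix (Fin n) (Fin n) ℂ) (T : Fin n → H →L[ℂ] H) :
    H →L[ℂ] HilbertTensor (commFock A) H :=
  ampliation H (commFock A).orthogonalProjectionOnto ∘L poissonKernel A T

/-- The map `X ↦ K_r* (X ⊗ I) K_r`, where `K_r` is the Poisson kernel of `rT`. -/
def poissonTransform (A : Matrix (Fin n) (Fin n) ℂ) (T : Fin n → H →L[ℂ] H) (r : ℝ)
    (X : commFock A →L[ℂ] commFock A) : H →L[ℂ] H :=
  let K := commPoissonKernel A fun i => (r : ℂ) • T i
  ContinuousLinearMap.adjoint K ∘L ampliation H X ∘L K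

/-- `φ` is the map `C*(W) → B(H)` given by the strong operator limit of `K_r* (X ⊗ I) K_r` as `r`
increases to `1`. -/
def IsPoissonMap (A : Matrix (Fin n) (Fin n) ℂ) (T : Fin n → H →L[ℂ] H)
    (φ : creationAlgebra A →ₗ[ℂ] (H →L[ℂ] H)) : Prop :=
  ∀ (X : creationAlgebra A) (h : H),
    Filter.Tendsto (fun r : ℝ => poissonTransform A T r X h) (𝓝[<] 1) (𝓝 (φ X h))

end Poisson

/-! ### The standard commuting `A`-dilation -/

section Standard

variable {n : ℕ} {H : Type u} [NormedAddCommGroup H] [InnerProductSpace ℂ H] [CompleteSpace H]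
  {M : Type v} [NormedAddCommGroup M] [InnerProductSpace ℂ M] [CompleteSpace M]

/-- The unital `*`-representation `π` on `M`, with the isometry `V`, is a minimal Stinespring dilation
of `φ`: one has `φ(X) = V* π(X) V`, and the vectors `π(X) V h` span a dense subspace. -/
structure IsMinimalStinespring {B : Type w} [Ring B] [StarRing B] [Algebra ℂ B]
    (φ : B →ₗ[ℂ] (H →L[ℂ] H)) (π : B →⋆ₐ[ℂ] (M →L[ℂ] M)) (V : H →ₗᵢ[ℂ] M) : Prop where
  dilation : ∀ X, φ X = ContinuousLinearMap.adjoint V.toContinuousLinearMap ∘L π X ∘L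
    V.toContinuousLinearMap
  minimal : (Submodule.span ℂ {x : M | ∃ X h, x = π X (V h)}).topologicalClosure = ⊤

/-- The tuple `Wd` on `M`, with `H` embedded by `V`, is a standard commuting `A`-dilation of `T`: it is
the image of the tuple `W` under a minimal Stinespring dilation of the Poisson map
`C*(W) → B(H)`. -/
def IsStandardCommutingADilation (A : Matrix (Fin n) (Fin n) ℂ) (T : Fin n → H →L[ℂ] H)
    (Wd : Fin n → M →L[ℂ] M) (V : H →ₗᵢ[ℂ] M) : Prop :=
  ∃ (φ : creationAlgebra A →ₗ[ℂ] (H →L[ℂ] H)) (π : creationAlgebra A →⋆ₐ[ℂ] (M →L[ℂ] M)),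
    IsPoissonMap A T φ ∧ IsMinimalStinespring φ π V ∧
      ∀ i, Wd i = π ⟨commCreation A i, commCreation_mem A i⟩

end Standard

end CKDilation

end

/-! Let `C` be the maximal commuting piece of a Cuntz–Krieger dilation `R`. Since `C_i*` is the
restriction of `R_i*`, `C` is again a commuting contractive tuple with `A`-relations, and `C_i*`
extends `T_i*`. The heart of the matter is that the Poisson map of `C` is multiplicative. Its
kernels `K_r` are isometric for `0 ≤ r < 1`, and `(W_i ⊗ I) K_r h - K_r C_i h → 0` for every `h`
(`IsCuntzKriegerTuple.asymptoticallyIntertwines`); the analogue for `W_i*` holds for any commuting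
`A`-tuple. Operators `X` for which `X` and `X*` are intertwined in this sense form a `C*`-algebra,
and each determines its partner, so the limits of the Poisson transforms form a `*`-representation
of `C*(W)` sending `W_i` to `C_i` (`exists_representation`). Its compression to `H` is the Poisson
map of `T`, minimality of `R` makes `H` generating, and uniqueness of minimal Stinespring dilations
yields the unitary.

The intertwining relation is checked on two kinds of vectors. If `R_k* e = 0` for all `k`, then `e^α
↦ R^α e` defines on the commuting `A`-Fock space a multiple of an isometry into the maximal
commuting subspace, `C_i` acts on its image as `W_i`, and the kernels converge there to `v ⊗ e`. A
vector `h` of the maximal commuting subspace orthogonal to all these images is spherical: `∑ R_j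
R_j*` fixes every `(R^α)* h`. For such `h` the kernels lose their mass on every finite set of words,
whereas `W_i* W_i ≤ W_i W_i* + Q_m + 1/m`, with `Q_m` the compression of the projection onto words
of length less than `m`. It then suffices that `‖C_i* h‖ ≤ ‖C_i h‖`.

That inequality comes from a normal operator: averages of the iterates of `Y ↦ ∑ R_j Y R_j*` at
`R_i` have a weak limit `X` commuting with all `R_j` and `R_j*`. Hence `X` is normal, and at
spherical commuting vectors `X` agrees with `C_i` and `X*` with `C_i*`.

For existence, `T` is dilated to isometries with orthogonal ranges, these are compressed to the
vectors killed by the adjoints of all products along non-`A`-words, and the result is restricted to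
the subspace generated by `H`. -/

noncomputable section

namespace CKDilation

/-! ### Adjoints and unitaries from Gram matrices -/

section Generic

variable {H : Type u} [NormedAddCommGroup H] [InnerProductSpace ℂ H] [CompleteSpace H]

theorem inner_star_left (X : H →L[ℂ] H) (x y : H) : inner ℂ (star X x) y = inner ℂ x (X y) := by
  rw [ContinuousLinearMap.star_eq_adjoint, ContinuousLinearMap.adjoint_inner_left]

theorem inner_star_right (X : H →L[ℂ] H) (x y : H) : inner ℂ x (star X y) = inner ℂ (X x) y := by
  rw [ContinuousLinearMap.star_eq_adjoint, ContinuousLinearMap.adjoint_inner_right]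

theorem denseRange_linearCombination {ι K : Type*} [NormedAddCommGroup K] [NormedSpace ℂ K]
    {k : ι → K} (hk : (Submodule.span ℂ (Set.range k)).topologicalClosure = ⊤) :
    DenseRange (Finsupp.linearCombination ℂ k) := by
  rw [DenseRange, ← LinearMap.coe_range, Finsupp.range_linearCombination]
  exact (Submodule.dense_iff_topologicalClosure_eq_top).2 hk

/-- Two families with the same Gram matrix and dense spans are related by a unitary. -/
theorem exists_unitary_of_inner_eq {ι : Type*} {E F : Type*} [NormedAddCommGroup E]
    [InnerProductSpace ℂ E] [CompleteSpace E] [NormedAddCommGroup F] [InnerProductSpace ℂ F]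
    [CompleteSpace F] (f : ι → E) (g : ι → F)
    (hf : (Submodule.span ℂ (Set.range f)).topologicalClosure = ⊤)
    (hg : (Submodule.span ℂ (Set.range g)).topologicalClosure = ⊤)
    (h : ∀ a b, inner ℂ (f a) (f b) = inner ℂ (g a) (g b)) :
    ∃ U : E ≃ₗᵢ[ℂ] F, ∀ a, U (f a) = g a := by
  -- Equal Gram matrices give equal norms of finite combinations, so the identity of `ι →₀ ℂ`
  -- induces an isometry between the two dense ranges.
  have key : ∀ x : ι →₀ ℂ, ‖Finsupp.linearCombination ℂ g x‖ = ‖Finsupp.linearCombination ℂ f x‖ := by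
    intro x
    have h1 : inner ℂ (Finsupp.linearCombination ℂ g x) (Finsupp.linearCombination ℂ g x) =
        inner ℂ (Finsupp.linearCombination ℂ f x) (Finsupp.linearCombination ℂ f x) := by
      simp only [Finsupp.linearCombination_apply, Finsupp.sum, sum_inner, inner_sum,
        inner_smul_left, inner_smul_right, h]
    rw [inner_self_eq_norm_sq_to_K, inner_self_eq_norm_sq_to_K] at h1
    have h2 : ‖Finsupp.linearCombination ℂ g x‖ ^ 2 = ‖Finsupp.linearCombination ℂ f x‖ ^ 2 := by
      exact_mod_cast h1
    exact (pow_left_inj₀ (norm_nonneg _) (norm_nonneg _) two_ne_zero).1 h2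
  refine ⟨(LinearEquiv.refl ℂ (ι →₀ ℂ)).extendOfIsometry (Finsupp.linearCombination ℂ f)
    (Finsupp.linearCombination ℂ g) (denseRange_linearCombination hf)
    (denseRange_linearCombination hg) key, fun a => ?_⟩
  have := (LinearEquiv.refl ℂ (ι →₀ ℂ)).extendOfIsometry_eq (Finsupp.linearCombination ℂ f)
    (Finsupp.linearCombination ℂ g) (denseRange_linearCombination hf)
    (denseRange_linearCombination hg) key
    (Finsupp.single a 1)
  simpa using this

end Generic

/-! ### Ampliations on Hilbert space tensor products -/

section Ampliation

variable {G : Type v} [NormedAddCommGroup G] [InnerProductSpace ℂ G]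
  {G' : Type w} [NormedAddCommGroup G'] [InnerProductSpace ℂ G']
  {G'' : Type*} [NormedAddCommGroup G''] [InnerProductSpace ℂ G'']
  {H : Type u} [NormedAddCommGroup H] [InnerProductSpace ℂ H]

/-- The simple tensor `x ⊗ h` in the Hilbert space tensor product. -/
def simpleTensor (x : G) (h : H) : HilbertTensor G H := ((x ⊗ₜ[ℂ] h : G ⊗[ℂ] H) : HilbertTensor G H)

theorem inner_simpleTensor (x y : G) (h k : H) :
    inner ℂ (simpleTensor x h) (simpleTensor y k) = inner ℂ x y * inner ℂ h k := by
  simp [simpleTensor, UniformSpace.Completion.inner_coe]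

theorem norm_simpleTensor (x : G) (h : H) : ‖simpleTensor x h‖ = ‖x‖ * ‖h‖ := by
  simp [simpleTensor]

theorem ampliation_simpleTensor (X : G →L[ℂ] G') (x : G) (h : H) :
    ampliation H X (simpleTensor x h) = simpleTensor (X x) h := by
  simp [ampliation, simpleTensor]

theorem dense_span_simpleTensor :
    Dense (Submodule.span ℂ {ξ : HilbertTensor G H | ∃ x h, ξ = simpleTensor x h} :
      Set (HilbertTensor G H)) := by
  refine UniformSpace.Completion.denseRange_coe.mono ?_
  rintro _ ⟨t, rfl⟩
  induction t using TensorProduct.induction_on with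
  | zero => exact Submodule.zero_mem _
  | tmul x h => exact Submodule.subset_span ⟨x, h, rfl⟩
  | add s t hs ht =>
    rw [UniformSpace.Completion.coe_add]
    exact Submodule.add_mem _ hs ht

theorem ext_inner_simpleTensor {ξ η : HilbertTensor G H}
    (h : ∀ x k, inner ℂ (simpleTensor x k) ξ = inner ℂ (simpleTensor x k) η) : ξ = η := by
  refine dense_span_simpleTensor.eq_of_inner_right (𝕜 := ℂ) fun ζ hζ => ?_
  induction hζ using Submodule.span_induction with
  | mem ζ hζ => obtain ⟨x, k, rfl⟩ := hζ; exact h x k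
  | zero => simp
  | add a b _ _ ha hb => rw [inner_add_left, inner_add_left, ha, hb]
  | smul c a _ ha => rw [inner_smul_left, inner_smul_left, ha]

theorem clm_ext_simpleTensor {K : Type*} [NormedAddCommGroup K] [NormedSpace ℂ K]
    {X Y : HilbertTensor G H →L[ℂ] K}
    (h : ∀ x k, X (simpleTensor x k) = Y (simpleTensor x k)) : X = Y := by
  refine ContinuousLinearMap.ext_on dense_span_simpleTensor ?_
  rintro _ ⟨x, k, rfl⟩
  exact h x k

theorem simpleTensor_add_left (x y : G) (h : H) :
    simpleTensor (x + y) h = simpleTensor x h + simpleTensor y h := by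
  simp [simpleTensor, TensorProduct.add_tmul, UniformSpace.Completion.coe_add]

theorem simpleTensor_smul_left (c : ℂ) (x : G) (h : H) :
    simpleTensor (c • x) h = c • simpleTensor x h := by
  simp [simpleTensor, ← TensorProduct.smul_tmul', UniformSpace.Completion.coe_smul]

theorem ampliation_comp (X : G' →L[ℂ] G'') (Y : G →L[ℂ] G') :
    ampliation H (X ∘L Y) = ampliation H X ∘L ampliation H Y :=
  clm_ext_simpleTensor fun x k => by simp [ampliation_simpleTensor]

theorem ampliation_comp_apply (X : G' →L[ℂ] G'') (Y : G →L[ℂ] G') (ξ : HilbertTensor G H) :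
    ampliation H (X ∘L Y) ξ = ampliation H X (ampliation H Y ξ) := by
  rw [ampliation_comp]; rfl

theorem ampliation_mul_apply (X Y : G →L[ℂ] G) (ξ : HilbertTensor G H) :
    ampliation H (X * Y) ξ = ampliation H X (ampliation H Y ξ) :=
  ampliation_comp_apply X Y ξ

theorem ampliation_add (X Y : G →L[ℂ] G') :
    ampliation H (X + Y) = ampliation H X + ampliation H Y :=
  clm_ext_simpleTensor fun x k => by simp [ampliation_simpleTensor, simpleTensor_add_left]

theorem ampliation_smul (c : ℂ) (X : G →L[ℂ] G') :
    ampliation H (c • X) = c • ampliation H X :=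
  clm_ext_simpleTensor fun x k => by simp [ampliation_simpleTensor, simpleTensor_smul_left]

theorem ampliation_sub (X Y : G →L[ℂ] G') :
    ampliation H (X - Y) = ampliation H X - ampliation H Y := by
  rw [sub_eq_add_neg, ← neg_one_smul ℂ Y, ampliation_add, ampliation_smul, neg_one_smul,
    ← sub_eq_add_neg]

theorem ampliation_one : ampliation H (1 : G →L[ℂ] G) = 1 :=
  clm_ext_simpleTensor fun x k => by simp [ampliation_simpleTensor]

theorem norm_ampliation_le (X : G →L[ℂ] G') : ‖ampliation H X‖ ≤ ‖X‖ := by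
  refine ContinuousLinearMap.opNorm_le_bound _ (norm_nonneg _) fun ξ => ?_
  induction ξ using UniformSpace.Completion.induction_on with
  | hp => exact isClosed_le (by fun_prop) (by fun_prop)
  | ih t =>
    rw [ampliation, ContinuousLinearMap.completion_apply_coe, UniformSpace.Completion.norm_coe,
      UniformSpace.Completion.norm_coe]
    exact ((X.rTensor H).le_opNorm t).trans
      (mul_le_mul_of_nonneg_right (ContinuousLinearMap.norm_rTensor_le H X) (norm_nonneg _))

/-- Allowing different source and target spaces covers the inclusion of the commuting `A`-Fock space
and its projection, which are adjoint to each other. -/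
theorem inner_ampliation_left [CompleteSpace G] [CompleteSpace G'] (X : G →L[ℂ] G')
    (ξ : HilbertTensor G H) (η : HilbertTensor G' H) :
    inner ℂ (ampliation H X ξ) η = inner ℂ ξ (ampliation H (ContinuousLinearMap.adjoint X) η) := by
  have : ampliation H (ContinuousLinearMap.adjoint X) =
      ContinuousLinearMap.adjoint (ampliation H X) := by
    refine clm_ext_simpleTensor fun x k => ext_inner_simpleTensor fun y l => ?_
    rw [ContinuousLinearMap.adjoint_inner_right, ampliation_simpleTensor, ampliation_simpleTensor,
      inner_simpleTensor, inner_simpleTensor, ContinuousLinearMap.adjoint_inner_right]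
  rw [this, ContinuousLinearMap.adjoint_inner_right]

end Ampliation

/-! ### Combinatorics of words -/

section Words

variable {n : ℕ} {A : Matrix (Fin n) (Fin n) ℂ}

theorem isSymmetricAWord_iff_pairwise {α : List (Fin n)} :
    IsSymmetricAWord A α ↔ α.Pairwise fun i j => A i j = 1 ∧ A j i = 1 := by
  rw [List.pairwise_iff_get]
  refine ⟨fun h i j hij => ⟨h i j hij.ne, h j i hij.ne'⟩, fun h i j hij => ?_⟩
  rcases lt_or_gt_of_ne hij with h' | h'
  · exact (h i j h').1
  · exact (h j i h').2

theorem IsSymmetricAWord.perm {α β : List (Fin n)} (h : IsSymmetricAWord A α) (hp : α.Perm β) :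
    IsSymmetricAWord A β := by
  rw [isSymmetricAWord_iff_pairwise] at h ⊢
  exact (hp.pairwise_iff fun {x y} (hxy : A x y = 1 ∧ A y x = 1) => hxy.symm).1 h

theorem IsSymmetricAWord.of_cons {i : Fin n} {α : List (Fin n)} (h : IsSymmetricAWord A (i :: α)) :
    IsSymmetricAWord A α := by
  rw [isSymmetricAWord_iff_pairwise] at h ⊢
  exact h.of_cons

theorem IsSymmetricAWord.isAWord {α : List (Fin n)} (h : IsSymmetricAWord A α) : IsAWord A α := by
  rw [isSymmetricAWord_iff_pairwise] at h
  exact (h.imp fun h => h.1).isChain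

/-- Each value is taken equally often by `f` and `g`, so corresponding fibres are in bijection, and
the bijections glue to a permutation. -/
theorem exists_perm_of_ofFn_perm {X : Type*} {m : ℕ} {f g : Fin m → X}
    (h : (List.ofFn f).Perm (List.ofFn g)) : ∃ σ : Equiv.Perm (Fin m), f = g ∘ σ := by
  classical
  rw [← Multiset.coe_eq_coe, ← Fin.univ_val_map, ← Fin.univ_val_map] at h
  have hc : ∀ x, Nonempty ({k // f k = x} ≃ {k // g k = x}) := by
    intro x
    have h1 := congrArg (Multiset.count x) h
    rw [Multiset.count_map, Multiset.count_map] at h1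
    refine ⟨Fintype.equivOfCardEq ?_⟩
    rw [Fintype.card_subtype, Fintype.card_subtype]
    simpa [Finset.card_def, eq_comm] using h1
  let e := fun x => (hc x).some
  exact ⟨Equiv.ofFiberEquiv e, funext fun k => (Equiv.ofFiberEquiv_map e k).symm⟩

theorem symmVector_ofFn {m : ℕ} (f : Fin m → Fin n) :
    symmVector (List.ofFn f) =
      ((m.factorial : ℂ)⁻¹) • ∑ σ : Equiv.Perm (Fin m), fockBasis (List.ofFn (f ∘ σ)) := by
  -- Quantifying over length and function together lets `List.equivSigmaTuple` turn the pair into a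
  -- list, avoiding casts between `Fin (List.ofFn f).length` and `Fin m`.
  suffices h : ∀ p : Σ m, (Fin m → Fin n), symmVector (List.ofFn p.2) =
      ((p.1.factorial : ℂ)⁻¹) •
        ∑ σ : Equiv.Perm (Fin p.1), fockBasis (List.ofFn (p.2 ∘ σ)) from h ⟨m, f⟩
  intro p
  obtain ⟨α, rfl⟩ := List.equivSigmaTuple.surjective p
  simp only [List.equivSigmaTuple, Equiv.coe_fn_mk, List.ofFn_get]
  rw [symmVector, ← Equiv.sum_comp (Equiv.inv _)]
  simp only [Equiv.inv_apply, inv_inv]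
  rfl

end Words

/-! ### Coordinates on the full Fock space and the commuting `A`-Fock space -/

section FockCoordinates

variable {n : ℕ} {A : Matrix (Fin n) (Fin n) ℂ}

/-- The standard basis of the full Fock space. -/
def fockHilbertBasis (n : ℕ) : HilbertBasis (List (Fin n)) ℂ (FullFock n) :=
  HilbertBasis.ofRepr (LinearIsometryEquiv.refl ℂ (lp (fun _ : List (Fin n) => ℂ) 2))

theorem fockHilbertBasis_apply (α : List (Fin n)) : fockHilbertBasis n α = fockBasis α := by
  classical
  have h := (fockHilbertBasis n).repr_symm_single α
  rw [← h]
  change (lp.single 2 α (1 : ℂ) : lp (fun _ : List (Fin n) => ℂ) 2) = fockBasis α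
  rw [fockBasis]

/-- The coefficient of a vector of the full Fock space at `e^α`. -/
def coord (α : List (Fin n)) : FullFock n →L[ℂ] ℂ := innerSL ℂ (fockBasis α)

theorem coord_apply (α : List (Fin n)) (v : FullFock n) : coord α v = inner ℂ (fockBasis α) v := rfl

theorem coord_fockBasis (α β : List (Fin n)) :
    coord α (fockBasis β) = if α = β then 1 else 0 :=
  orthonormal_iff_ite.1 orthonormal_fockBasis α β

theorem hasSum_inner_coord (v w : FullFock n) :
    HasSum (fun α => star (coord α v) * coord α w) (inner ℂ v w) := by
  have := (fockHilbertBasis n).hasSum_inner_mul_inner v w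
  refine this.congr_fun fun α => ?_
  simp [coord_apply, fockHilbertBasis_apply]

theorem hasSum_coord (v : FullFock n) : HasSum (fun α => coord α v • fockBasis α) v := by
  have h := (fockHilbertBasis n).hasSum_repr v
  simp only [HilbertBasis.repr_apply_apply, fockHilbertBasis_apply] at h
  exact h

theorem ext_coord {v w : FullFock n} (h : ∀ α, coord α v = coord α w) : v = w :=
  (hasSum_coord v).unique ((hasSum_coord w).congr_fun fun α => by rw [h])

theorem hasSum_norm_coord_sq (v : FullFock n) : HasSum (fun α => ‖coord α v‖ ^ 2) (‖v‖ ^ 2) := by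
  have h := Complex.hasSum_re (hasSum_inner_coord v v)
  rw [← inner_self_eq_norm_sq (𝕜 := ℂ)]
  refine h.congr_fun fun α => ?_
  have := Complex.conj_mul' (coord α v)
  rw [starRingEnd_apply] at this
  rw [this]
  norm_cast

theorem coord_adjoint_leftCreation (i : Fin n) (α : List (Fin n)) (v : FullFock n) :
    coord α (ContinuousLinearMap.adjoint (leftCreation i) v) = coord (i :: α) v := by
  rw [coord_apply, ContinuousLinearMap.adjoint_inner_right, leftCreation_fockBasis, coord_apply]

theorem adjoint_leftCreation_nil (i : Fin n) :
    ContinuousLinearMap.adjoint (leftCreation i) (fockBasis []) = 0 :=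
  ext_coord fun α => by simp [coord_adjoint_leftCreation, coord_fockBasis]

theorem adjoint_leftCreation_cons (i j : Fin n) (α : List (Fin n)) :
    ContinuousLinearMap.adjoint (leftCreation i) (fockBasis (j :: α)) =
      if i = j then fockBasis α else 0 :=
  ext_coord fun β => by
    rw [coord_adjoint_leftCreation, coord_fockBasis]
    by_cases h : i = j <;> simp [h, coord_fockBasis]

theorem coord_nil_leftCreation (i : Fin n) (v : FullFock n) : coord [] (leftCreation i v) = 0 := by
  rw [coord_apply, ← ContinuousLinearMap.adjoint_inner_left, adjoint_leftCreation_nil,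
    inner_zero_left]

theorem coord_cons_leftCreation (i j : Fin n) (α : List (Fin n)) (v : FullFock n) :
    coord (j :: α) (leftCreation i v) = if i = j then coord α v else 0 := by
  rw [coord_apply, ← ContinuousLinearMap.adjoint_inner_left, adjoint_leftCreation_cons]
  split_ifs <;> simp [coord_apply]

theorem inner_symmVector_ofFn {m : ℕ} (f : Fin m → Fin n) (v : FullFock n) :
    inner ℂ (symmVector (List.ofFn f)) v =
      ((m.factorial : ℂ)⁻¹) * ∑ σ : Equiv.Perm (Fin m), coord (List.ofFn (f ∘ σ)) v := by
  rw [symmVector_ofFn, inner_smul_left, sum_inner]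
  simp [coord_apply]

/-- The vectors with permutation invariant coefficients supported on symmetric `A`-words. -/
def symmetricSubspace (A : Matrix (Fin n) (Fin n) ℂ) : Submodule ℂ (FullFock n) where
  carrier := {v | (∀ α β, α.Perm β → coord α v = coord β v) ∧
    ∀ α, ¬ IsSymmetricAWord A α → coord α v = 0}
  add_mem' := fun {v w} hv hw => ⟨fun α β h => by rw [map_add, map_add, hv.1 α β h, hw.1 α β h],
    fun α h => by rw [map_add, hv.2 α h, hw.2 α h, add_zero]⟩
  zero_mem' := ⟨fun α β h => by simp, fun α h => by simp⟩
  smul_mem' := fun c v hv => ⟨fun α β h => by rw [map_smul, map_smul, hv.1 α β h],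
    fun α h => by rw [map_smul, hv.2 α h, smul_zero]⟩

theorem isClosed_symmetricSubspace : IsClosed (symmetricSubspace A : Set (FullFock n)) := by
  have : (symmetricSubspace A : Set (FullFock n)) =
      {v | ∀ α β, α.Perm β → coord α v = coord β v} ∩
        {v | ∀ α, ¬ IsSymmetricAWord A α → coord α v = 0} := rfl
  rw [this]
  refine IsClosed.inter ?_ ?_
  · simp only [Set.ofPred_forall]
    exact isClosed_iInter fun α => isClosed_iInter fun β => isClosed_iInter fun _ =>
      isClosed_eq (coord α).continuous (coord β).continuous
  · simp only [Set.ofPred_forall]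
    exact isClosed_iInter fun α => isClosed_iInter fun _ =>
      isClosed_eq (coord α).continuous continuous_const

theorem coord_ofFn_symmVector {m : ℕ} (f g : Fin m → Fin n) :
    coord (List.ofFn g) (symmVector (List.ofFn f)) =
      ((m.factorial : ℂ)⁻¹) * ∑ σ : Equiv.Perm (Fin m), if g = f ∘ σ then 1 else 0 := by
  rw [symmVector_ofFn, map_smul, map_sum, smul_eq_mul]
  simp [coord_fockBasis, List.ofFn_inj]

theorem coord_symmVector_of_not_perm {α β : List (Fin n)} (h : ¬ α.Perm β) :
    coord α (symmVector β) = 0 := by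
  obtain ⟨m, f, rfl⟩ : ∃ m, ∃ f : Fin m → Fin n, β = List.ofFn f := ⟨_, β.get, by simp⟩
  rw [symmVector_ofFn, map_smul, map_sum, Finset.sum_eq_zero, smul_zero]
  intro σ _
  rw [coord_fockBasis, if_neg]
  rintro rfl
  exact h (σ.ofFn_comp_perm f)

theorem coord_symmVector_perm {α β γ : List (Fin n)} (h : α.Perm β) :
    coord α (symmVector γ) = coord β (symmVector γ) := by
  by_cases hγ : α.Perm γ
  · obtain ⟨m, f, rfl⟩ : ∃ m, ∃ f : Fin m → Fin n, γ = List.ofFn f := ⟨_, γ.get, by simp⟩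
    obtain ⟨a, rfl⟩ : ∃ a : Fin m → Fin n, α = List.ofFn a := by
      have hl := hγ.length_eq
      rw [List.length_ofFn] at hl
      subst hl
      exact ⟨α.get, by simp⟩
    obtain ⟨b, rfl⟩ : ∃ b : Fin m → Fin n, β = List.ofFn b := by
      have hl := h.symm.length_eq
      rw [List.length_ofFn] at hl
      subst hl
      exact ⟨β.get, by simp⟩
    obtain ⟨τ, rfl⟩ := exists_perm_of_ofFn_perm h
    rw [coord_ofFn_symmVector, coord_ofFn_symmVector, ← Equiv.sum_comp (Equiv.mulRight τ)]
    congr 1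
    refine Finset.sum_congr rfl fun σ _ => ?_
    have : (b ∘ τ = f ∘ (Equiv.mulRight τ σ : Equiv.Perm (Fin m))) ↔ b = f ∘ σ := by
      constructor
      · intro h
        funext x
        have := congrFun h (τ⁻¹ x)
        simpa using this
      · rintro rfl
        rfl
    simp only [this]
  · rw [coord_symmVector_of_not_perm hγ, coord_symmVector_of_not_perm fun h' => hγ (h.trans h')]

theorem commFock_le_symmetricSubspace : commFock A ≤ symmetricSubspace A := by
  refine Submodule.topologicalClosure_minimal _ (Submodule.span_le.2 ?_)
    isClosed_symmetricSubspace
  rintro _ ⟨α, hα, rfl⟩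
  refine ⟨fun β γ h => coord_symmVector_perm h, fun β hβ => coord_symmVector_of_not_perm ?_⟩
  exact fun h => hβ (hα.perm h.symm)

theorem symmVector_mem_commFock {α : List (Fin n)} (h : IsSymmetricAWord A α) :
    symmVector α ∈ commFock A :=
  Submodule.le_topologicalClosure _ (Submodule.subset_span ⟨α, h, rfl⟩)

/-- Take `w` orthogonal to the generators and `v` symmetric. In each degree their pairing may be
averaged over permutations at the expense of `w` alone. This replaces the coefficients of `w` by its
pairings with symmetrized vectors, which vanish at symmetric `A`-words; at all other words `v`
vanishes. -/
theorem symmetricSubspace_le_commFock : symmetricSubspace A ≤ commFock A := by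
  intro v hv
  rw [← Submodule.orthogonal_orthogonal (commFock A), Submodule.mem_orthogonal]
  intro w hw
  have h0 : ∀ α, IsSymmetricAWord A α → inner ℂ (symmVector α) w = 0 := fun α hα =>
    (Submodule.mem_orthogonal _ _).1 hw _ (symmVector_mem_commFock hα)
  have h1 := hasSum_inner_coord w v
  rw [← List.equivSigmaTuple.symm.hasSum_iff] at h1
  have h2 : ∀ m, ∑ f : Fin m → Fin n,
      star (coord (List.ofFn f) w) * coord (List.ofFn f) v = 0 := by
    intro m
    have h3 : ∀ σ : Equiv.Perm (Fin m), ∑ f : Fin m → Fin n,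
        star (coord (List.ofFn f) w) * coord (List.ofFn f) v = ∑ f : Fin m → Fin n,
        star (coord (List.ofFn (f ∘ σ)) w) * coord (List.ofFn f) v := by
      intro σ
      rw [← Equiv.sum_comp (Equiv.arrowCongr σ.symm (Equiv.refl (Fin n)))]
      refine Finset.sum_congr rfl fun f _ => ?_
      have : (Equiv.arrowCongr σ.symm (Equiv.refl (Fin n))) f = f ∘ σ := rfl
      rw [this, hv.1 _ _ (σ.ofFn_comp_perm f)]
    have h4 : (m.factorial : ℂ) * ∑ f : Fin m → Fin n,
        star (coord (List.ofFn f) w) * coord (List.ofFn f) v = 0 := by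
      calc _ = ∑ σ : Equiv.Perm (Fin m), ∑ f : Fin m → Fin n,
          star (coord (List.ofFn f) w) * coord (List.ofFn f) v := by
            simp [Fintype.card_perm]
        _ = ∑ f : Fin m → Fin n, (∑ σ : Equiv.Perm (Fin m),
            star (coord (List.ofFn (f ∘ σ)) w)) * coord (List.ofFn f) v := by
            rw [Finset.sum_congr rfl fun σ _ => h3 σ, Finset.sum_comm]
            simp only [Finset.sum_mul]
        _ = 0 := by
            refine Finset.sum_eq_zero fun f _ => ?_
            by_cases hf : IsSymmetricAWord A (List.ofFn f)
            · have h5 := h0 _ hf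
              rw [inner_symmVector_ofFn] at h5
              have h6 := (mul_eq_zero.1 h5).resolve_left
                (inv_ne_zero (Nat.cast_ne_zero.2 m.factorial_ne_zero))
              rw [← star_sum, h6, star_zero, zero_mul]
            · rw [hv.2 _ hf, mul_zero]
    exact (mul_eq_zero.1 h4).resolve_left (Nat.cast_ne_zero.2 m.factorial_ne_zero)
  have h3 := h1.sigma fun m => hasSum_fintype _
  simp only [Function.comp_apply, List.equivSigmaTuple, Equiv.coe_fn_symm_mk, h2] at h3
  exact h3.unique hasSum_zero

/-- This coordinate description replaces the span of symmetrized vectors in all membership arguments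
below. -/
theorem mem_commFock_iff {v : FullFock n} : v ∈ commFock A ↔
    (∀ α β, α.Perm β → coord α v = coord β v) ∧ ∀ α, ¬ IsSymmetricAWord A α → coord α v = 0 :=
  ⟨fun h => commFock_le_symmetricSubspace h, fun h => symmetricSubspace_le_commFock h⟩

end FockCoordinates

/-! ### Compressions to closed subspaces -/

section Compression

variable {L : Type u} [NormedAddCommGroup L] [InnerProductSpace ℂ L] [CompleteSpace L]

theorem inner_projection_right (K : Submodule ℂ L) [CompleteSpace K] (k : K) (x : L) :
    inner ℂ k (K.orthogonalProjectionOnto x) = inner ℂ (k : L) x := by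
  rw [← Submodule.adjoint_subtypeL, ContinuousLinearMap.adjoint_inner_right]
  rfl

theorem inner_projection_left (K : Submodule ℂ L) [CompleteSpace K] (k : K) (x : L) :
    inner ℂ (K.orthogonalProjectionOnto x) k = inner ℂ x (k : L) := by
  rw [← Submodule.adjoint_subtypeL, ContinuousLinearMap.adjoint_inner_left]
  rfl

theorem inner_compression_right (K : Submodule ℂ L) [CompleteSpace K] (X : L →L[ℂ] L) (k l : K) :
    inner ℂ k (compression K X l) = inner ℂ (k : L) (X l) :=
  inner_projection_right K k (X l)

/-- On a coinvariant subspace no projection is needed for adjoints; all computations with compressed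
tuples therefore go through adjoints. -/
theorem coe_star_compression {K : Submodule ℂ L} [CompleteSpace K] {X : L →L[ℂ] L}
    (h : ∀ x ∈ K, star X x ∈ K) (k : K) : (star (compression K X) k : L) = star X k := by
  suffices star (compression K X) k = ⟨star X k, h k k.2⟩ by rw [this]
  refine ext_inner_left ℂ fun l => ?_
  rw [inner_star_right, ← inner_conj_symm, inner_compression_right, inner_conj_symm,
    Submodule.coe_inner, ← inner_star_right]

end Compression

/-! ### Creation operators on the commuting `A`-Fock space -/

section CreationOperators

variable {n : ℕ} {A : Matrix (Fin n) (Fin n) ℂ}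

theorem adjoint_leftCreation_mem (i : Fin n) {v : FullFock n} (hv : v ∈ commFock A) :
    star (leftCreation i) v ∈ commFock A := by
  rw [mem_commFock_iff] at hv ⊢
  simp only [ContinuousLinearMap.star_eq_adjoint, coord_adjoint_leftCreation]
  exact ⟨fun α β h => hv.1 _ _ (h.cons i), fun α h => hv.2 _ fun h' => h h'.of_cons⟩

theorem coord_star_commCreation (i : Fin n) (α : List (Fin n)) (v : commFock A) :
    coord α (star (commCreation A i) v : commFock A) = coord (i :: α) (v : FullFock n) := by
  rw [commCreation, coe_star_compression fun x hx => adjoint_leftCreation_mem i hx,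
    ContinuousLinearMap.star_eq_adjoint, coord_adjoint_leftCreation]

theorem sum_perm_apply_zero {m : ℕ} (F : Fin (m + 1) → ℂ) :
    ∑ σ : Equiv.Perm (Fin (m + 1)), F (σ 0) = m.factorial * ∑ k, F k := by
  rw [← Equiv.sum_comp Equiv.Perm.decomposeFin.symm, Fintype.sum_prod_type, Finset.mul_sum]
  refine Finset.sum_congr rfl fun k _ => ?_
  simp only [Equiv.Perm.decomposeFin_symm_apply_zero, Finset.sum_const, Finset.card_univ,
    Fintype.card_perm, Fintype.card_fin, nsmul_eq_mul]

theorem count_ofFn {m : ℕ} (f : Fin m → Fin n) (i : Fin n) :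
    ((List.ofFn f).count i : ℂ) = ∑ k, if i = f k then 1 else 0 := by
  induction m with
  | zero => simp
  | succ m ih =>
    rw [List.ofFn_succ, List.count_cons, Fin.sum_univ_succ, Nat.cast_add, ih, add_comm]
    rcases eq_or_ne i (f 0) with h | h
    · simp [h]
    · simp [h, h.symm]

/-- Pairing with the symmetrized vector of `γ` averages `L_i v` over the rearrangements of `γ`. Only
those beginning with `i` contribute; they make up the proportion `count / length`, and each gives
the coefficient of `v` at `γ` with one `i` removed. -/
theorem coord_commCreation (i : Fin n) (γ : List (Fin n)) (v : commFock A)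
    (hγ : IsSymmetricAWord A γ) :
    coord γ (commCreation A i v : commFock A) =
      (γ.count i / γ.length : ℂ) * coord (γ.erase i) (v : FullFock n) := by
  have hv := mem_commFock_iff.1 v.2
  have hu := mem_commFock_iff.1 (commCreation A i v).2
  cases γ with
  -- At the empty word the factor is `0 / 0 = 0`, matching the missing vacuum component of `L_i v`.
  | nil =>
    have h1 : symmVector (n := n) [] = fockBasis [] := by
      have := symmVector_ofFn (n := n) (m := 0) Fin.elim0
      simpa using this
    have h2 := inner_compression_right (commFock A) (leftCreation i)
      ⟨_, symmVector_mem_commFock hγ⟩ v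
    have h3 : coord (n := n) [] (commCreation A i v : commFock A) =
        coord (n := n) [] (leftCreation i (v : FullFock n)) := by
      simp only [Submodule.coe_inner, h1] at h2
      exact h2
    rw [h3, coord_nil_leftCreation]
    simp
  | cons j γ =>
    obtain ⟨m, f, hf⟩ : ∃ m, ∃ f : Fin (m + 1) → Fin n, j :: γ = List.ofFn f :=
      ⟨γ.length, (j :: γ).get, (List.ofFn_get _).symm⟩
    rw [hf] at hγ ⊢
    have h2 := inner_compression_right (commFock A) (leftCreation i)
      ⟨_, symmVector_mem_commFock hγ⟩ v
    rw [Submodule.coe_inner, inner_symmVector_ofFn, inner_symmVector_ofFn] at h2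
    have h3 : ∀ σ : Equiv.Perm (Fin (m + 1)), coord (List.ofFn (f ∘ σ)) (leftCreation i v) =
        (if i = f (σ 0) then 1 else 0) * coord ((List.ofFn f).erase i) (v : FullFock n) := by
      intro σ
      have hp := σ.ofFn_comp_perm f
      rw [List.ofFn_succ] at hp ⊢
      rw [coord_cons_leftCreation]
      by_cases h : i = f (σ 0)
      · rw [if_pos h, Function.comp_apply, if_pos h, one_mul]
        refine hv.1 _ _ ?_
        have := hp.erase i
        rwa [Function.comp_apply, ← h, List.erase_cons_head] at this
      · rw [Function.comp_apply, if_neg h, if_neg h, zero_mul]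
    have h4 : ∀ σ : Equiv.Perm (Fin (m + 1)), coord (List.ofFn (f ∘ σ))
        (commCreation A i v : commFock A) = coord (List.ofFn f) (commCreation A i v : commFock A) :=
      fun σ => hu.1 _ _ (σ.ofFn_comp_perm f)
    have h5 := sum_perm_apply_zero fun k => if i = f k then 1 else 0
    rw [← count_ofFn] at h5
    rw [Finset.sum_congr rfl fun σ _ => h3 σ, ← Finset.sum_mul, h5] at h2
    change (_ * ∑ σ : Equiv.Perm (Fin (m + 1)), coord (List.ofFn (f ∘ σ))
      (commCreation A i v : commFock A)) = _ at h2
    rw [Finset.sum_congr rfl fun σ _ => h4 σ] at h2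
    simp only [Finset.sum_const, Finset.card_univ, Fintype.card_perm, Fintype.card_fin,
      nsmul_eq_mul] at h2
    have hm : ((m + 1).factorial : ℂ) ≠ 0 := Nat.cast_ne_zero.2 (Nat.factorial_ne_zero _)
    rw [inv_mul_cancel_left₀ hm] at h2
    rw [h2, List.length_ofFn, Nat.factorial_succ]
    have hm' : (m.factorial : ℂ) ≠ 0 := Nat.cast_ne_zero.2 (Nat.factorial_ne_zero _)
    have hm1 : ((m : ℂ) + 1) ≠ 0 := by exact_mod_cast Nat.succ_ne_zero m
    push_cast
    field_simp

/-- In coordinates `W_i* W_i` is diagonal: the coefficient of `W_i v` at `i :: β` is a multiple of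
that of `v` at `β`, and it vanishes if `i :: β` is not a symmetric `A`-word. -/
theorem hasSum_norm_commCreation_sq (i : Fin n) (v : commFock A) :
    HasSum (fun β => (open Classical in if IsSymmetricAWord A (i :: β) then
      ((β.count i + 1) / (β.length + 1) : ℝ) else 0) * ‖coord β (v : FullFock n)‖ ^ 2)
      (‖commCreation A i v‖ ^ 2) := by
  have h1 : inner ℂ (v : FullFock n) (star (commCreation A i) (commCreation A i v) : commFock A) =
      ((‖commCreation A i v‖ ^ 2 : ℝ) : ℂ) := by
    rw [← Submodule.coe_inner, inner_star_right, inner_self_eq_norm_sq_to_K]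
    norm_cast
  have h2 := Complex.hasSum_re (hasSum_inner_coord (v : FullFock n)
    (star (commCreation A i) (commCreation A i v) : commFock A))
  rw [h1, Complex.ofReal_re] at h2
  refine h2.congr_fun fun β => ?_
  rw [coord_star_commCreation]
  have h3 := Complex.conj_mul' (coord β (v : FullFock n))
  rw [starRingEnd_apply] at h3
  split_ifs with h
  · rw [coord_commCreation i _ v h, List.erase_cons_head, List.count_cons_self, List.length_cons,
      mul_left_comm, h3, ← Complex.ofReal_re (_ * _)]
    push_cast
    rfl
  · rw [(mem_commFock_iff.1 (commCreation A i v).2).2 _ h]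
    simp

theorem hasSum_norm_star_commCreation_sq (i : Fin n) (v : commFock A) :
    HasSum (fun β => (β.count i / β.length : ℝ) * ‖coord β (v : FullFock n)‖ ^ 2)
      (‖star (commCreation A i) v‖ ^ 2) := by
  have hv := mem_commFock_iff.1 v.2
  have h1 : inner ℂ (v : FullFock n) (commCreation A i (star (commCreation A i) v) : commFock A) =
      ((‖star (commCreation A i) v‖ ^ 2 : ℝ) : ℂ) := by
    rw [← Submodule.coe_inner, ← inner_star_left, inner_self_eq_norm_sq_to_K]
    norm_cast
  have h2 := Complex.hasSum_re (hasSum_inner_coord (v : FullFock n)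
    (commCreation A i (star (commCreation A i) v) : commFock A))
  rw [h1, Complex.ofReal_re] at h2
  refine h2.congr_fun fun β => ?_
  have h3 := Complex.conj_mul' (coord β (v : FullFock n))
  rw [starRingEnd_apply] at h3
  by_cases h : IsSymmetricAWord A β
  · rw [coord_commCreation i _ _ h, coord_star_commCreation]
    by_cases hi : i ∈ β
    · rw [hv.1 _ _ (List.perm_cons_erase hi).symm, mul_left_comm, h3, ← Complex.ofReal_re (_ * _)]
      push_cast
      rfl
    · simp [List.count_eq_zero_of_not_mem hi]
  · rw [hv.2 β h]
    simp

/-- The orthogonal projection onto the span of the `e^β`, `β ∈ F`. -/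
def basisProjection (F : Finset (List (Fin n))) : FullFock n →L[ℂ] FullFock n :=
  ∑ β ∈ F, (coord β).smulRight (fockBasis β)

theorem inner_basisProjection (F : Finset (List (Fin n))) (v : FullFock n) :
    inner ℂ v (basisProjection F v) = ((∑ β ∈ F, ‖coord β v‖ ^ 2 : ℝ) : ℂ) := by
  simp only [basisProjection, sum_apply, inner_sum, Complex.ofReal_sum]
  refine Finset.sum_congr rfl fun β _ => ?_
  have h3 := Complex.conj_mul' (coord β v)
  rw [ContinuousLinearMap.smulRight_apply, inner_smul_right, ← inner_conj_symm, mul_comm]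
  rw [← coord_apply, h3]
  norm_cast

/-- The words of length less than `m`. -/
def shortWords (n m : ℕ) : Finset (List (Fin n)) := (List.finite_length_lt (Fin n) m).toFinset

theorem mem_shortWords {m : ℕ} {β : List (Fin n)} : β ∈ shortWords n m ↔ β.length < m := by
  simp [shortWords]

/-- At a word of length `l` with `c` letters `i`, `W_i* W_i` has weight `(c + 1) / (l + 1)` or `0`,
and `W_i W_i*` has weight `c / l`. For `l ≥ m` the excess is at most `1 / l ≤ 1 / m`; for shorter
words the first weight is at most `1`, which the finite sum absorbs. -/
theorem norm_commCreation_sq_le (i : Fin n) {m : ℕ} (hm : 0 < m) (v : commFock A) :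
    ‖commCreation A i v‖ ^ 2 ≤ ‖star (commCreation A i) v‖ ^ 2 +
      ∑ β ∈ shortWords n m, ‖coord β (v : FullFock n)‖ ^ 2 + (m : ℝ)⁻¹ * ‖v‖ ^ 2 := by
  classical
  have hs : HasSum (fun β => if β ∈ shortWords n m then ‖coord β (v : FullFock n)‖ ^ 2 else 0)
      (∑ β ∈ shortWords n m, ‖coord β (v : FullFock n)‖ ^ 2) := by
    rw [Finset.sum_congr rfl fun β hβ => (if_pos hβ).symm]
    exact hasSum_sum_of_ne_finset_zero fun β hβ => if_neg hβ
  have h := ((hasSum_norm_star_commCreation_sq i v).add hs).add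
    ((hasSum_norm_coord_sq (v : FullFock n)).mul_left (m : ℝ)⁻¹)
  refine hasSum_le (fun β => ?_) (hasSum_norm_commCreation_sq i v) h
  set x := ‖coord β (v : FullFock n)‖ ^ 2
  have hx : 0 ≤ x := by positivity
  have hc : (β.count i : ℝ) ≤ β.length := by exact_mod_cast List.count_le_length
  have hm' : (0 : ℝ) < (m : ℝ)⁻¹ := by positivity
  have h0 : (0 : ℝ) ≤ β.count i / β.length := by positivity
  have h1 : ((β.count i + 1) / (β.length + 1) : ℝ) ≤ 1 := by
    rw [div_le_one (by positivity)]
    linarith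
  by_cases hβ : β ∈ shortWords n m
  · rw [if_pos hβ]
    split_ifs <;> nlinarith [mul_nonneg h0 hx, mul_nonneg hm'.le hx]
  · rw [if_neg hβ]
    rw [mem_shortWords, not_lt] at hβ
    have hl : (m : ℝ) ≤ β.length := by exact_mod_cast hβ
    have hm0 : (0 : ℝ) < m := by exact_mod_cast hm
    have h2 : ((β.count i + 1) / (β.length + 1) : ℝ) ≤ β.count i / β.length + (m : ℝ)⁻¹ := by
      have hl0 : (0 : ℝ) < β.length := hm0.trans_le hl
      have h3 : (β.length : ℝ)⁻¹ ≤ (m : ℝ)⁻¹ := inv_anti₀ hm0 hl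
      refine le_trans ?_ (add_le_add_right h3 _)
      rw [div_add' _ _ _ hl0.ne', inv_mul_cancel₀ hl0.ne']
      exact div_le_div_of_nonneg_left (by positivity) hl0 (by linarith)
    split_ifs
    · nlinarith
    · nlinarith [mul_nonneg h0 hx, mul_nonneg hm'.le hx]

end CreationOperators

/-! ### Commuting tuples with `A`-relations -/

section Tuples

variable {n : ℕ} {A : Matrix (Fin n) (Fin n) ℂ} {H : Type u} [NormedAddCommGroup H]
  [InnerProductSpace ℂ H]

theorem wordProd_nil (T : Fin n → H →L[ℂ] H) : wordProd T [] = 1 := by simp [wordProd]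

theorem wordProd_cons (T : Fin n → H →L[ℂ] H) (i : Fin n) (α : List (Fin n)) :
    wordProd T (i :: α) = T i * wordProd T α := by simp [wordProd]

theorem wordProd_perm {T : Fin n → H →L[ℂ] H} (hc : ∀ i j, T i * T j = T j * T i)
    {α β : List (Fin n)} (h : α.Perm β) : wordProd T α = wordProd T β := by
  refine (h.map T).prod_eq' ?_
  rw [List.pairwise_map]
  exact List.pairwise_of_forall fun i j => hc i j

theorem SatisfiesARelations.mul_eq_zero {T : Fin n → H →L[ℂ] H} (h : SatisfiesARelations A T)
    {i j : Fin n} (hij : A i j ≠ 1) : T i * T j = 0 := by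
  have h1 : (1 - A i j) • (T i * T j) = 0 := by
    rw [sub_smul, one_smul, ← h i j, sub_self]
  exact (smul_eq_zero.1 h1).resolve_left (sub_ne_zero.2 hij.symm)

theorem SatisfiesARelations.wordProd_eq_zero {T : Fin n → H →L[ℂ] H}
    (h : SatisfiesARelations A T) {α : List (Fin n)} (hα : ¬ IsAWord A α) : wordProd T α = 0 := by
  induction α with
  | nil => exact absurd List.isChain_nil hα
  | cons i α ih =>
    by_cases h' : IsAWord A α
    · cases α with
      | nil => exact absurd (List.isChain_singleton i) hα
      | cons j α =>
        have hij : A i j ≠ 1 := fun hij => hα (List.isChain_cons_cons.2 ⟨hij, h'⟩)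
        rw [wordProd_cons, wordProd_cons, ← mul_assoc, h.mul_eq_zero hij, zero_mul]
    · rw [wordProd_cons, ih h', mul_zero]

theorem exists_perm_of_not_pairwise {X : Type*} {r : X → X → Prop} {l : List X}
    (h : ¬ l.Pairwise r) : ∃ a b l', l.Perm (a :: b :: l') ∧ ¬ r a b := by
  classical
  induction l with
  | nil => exact absurd List.Pairwise.nil h
  | cons c l ih =>
    rw [List.pairwise_cons, not_and_or] at h
    rcases h with h | h
    · push Not at h
      obtain ⟨b, hb, hcb⟩ := h
      exact ⟨c, b, l.erase b, (List.perm_cons_erase hb).cons c, hcb⟩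
    · obtain ⟨a, b, l', hp, hab⟩ := ih h
      refine ⟨a, b, c :: l', (hp.cons c).trans ?_, hab⟩
      exact (List.Perm.swap a c _).trans ((List.Perm.swap b c _).cons a)

/-- Commutativity allows a forbidden pair of letters, wherever it occurs, to be moved to the front,
where the `A`-relations kill the product. -/
theorem wordProd_eq_zero_of_not_symmetric {T : Fin n → H →L[ℂ] H} (h : SatisfiesARelations A T)
    (hc : ∀ i j, T i * T j = T j * T i) {α : List (Fin n)} (hα : ¬ IsSymmetricAWord A α) :
    wordProd T α = 0 := by
  rw [isSymmetricAWord_iff_pairwise] at hα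
  obtain ⟨i, j, β, hp, hij⟩ := exists_perm_of_not_pairwise hα
  rw [wordProd_perm hc hp, wordProd_cons, wordProd_cons, ← mul_assoc]
  rcases not_and_or.1 hij with hij | hij
  · rw [h.mul_eq_zero hij, zero_mul]
  · rw [hc, h.mul_eq_zero hij, zero_mul]

/-- The tuple `rT`. -/
def scale (r : ℝ) (T : Fin n → H →L[ℂ] H) (i : Fin n) : H →L[ℂ] H := (r : ℂ) • T i

theorem wordProd_scale (r : ℝ) (T : Fin n → H →L[ℂ] H) (α : List (Fin n)) :
    wordProd (scale r T) α = (r : ℂ) ^ α.length • wordProd T α := by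
  induction α with
  | nil => simp [wordProd_nil]
  | cons i α ih =>
    rw [wordProd_cons, wordProd_cons, ih, scale, List.length_cons, pow_succ',
      smul_mul_smul_comm]

variable [CompleteSpace H]

theorem star_wordProd_cons_apply (T : Fin n → H →L[ℂ] H) (i : Fin n) (α : List (Fin n)) (h : H) :
    star (wordProd T (i :: α)) h = star (wordProd T α) (star (T i) h) := by
  rw [wordProd_cons, star_mul]; rfl

theorem IsDilation.star_wordProd {N : Type v} [NormedAddCommGroup N] [InnerProductSpace ℂ N]
    [CompleteSpace N] {T : Fin n → H →L[ℂ] H} {C : Fin n → N →L[ℂ] N} {J : H →ₗᵢ[ℂ] N}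
    (hJ : IsDilation T C J) (α : List (Fin n)) (h : H) :
    star (wordProd C α) (J h) = J (star (wordProd T α) h) := by
  induction α generalizing h with
  | nil => simp [wordProd_nil]
  | cons i α ih => rw [star_wordProd_cons_apply, star_wordProd_cons_apply, hJ, ih]

theorem sum_norm_star_sq_le {T : Fin n → H →L[ℂ] H} (hT : IsContractiveTuple T) (h : H) :
    ∑ i, ‖star (T i) h‖ ^ 2 ≤ ‖h‖ ^ 2 := by
  rw [← norm_defect_sq hT h]
  exact le_add_of_nonneg_left (by positivity)

theorem inner_sum_mul_star (T : Fin n → H →L[ℂ] H) (x y : H) :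
    inner ℂ x ((∑ i, T i * star (T i)) y) = ∑ i, inner ℂ (star (T i) x) (star (T i) y) := by
  rw [sum_apply, inner_sum]
  exact Finset.sum_congr rfl fun i _ => (inner_star_left (T i) x _).symm

theorem isContractiveTuple_of_sum_le {T : Fin n → H →L[ℂ] H}
    (h : ∀ x, ∑ i, ‖star (T i) x‖ ^ 2 ≤ ‖x‖ ^ 2) : IsContractiveTuple T := by
  rw [IsContractiveTuple, ContinuousLinearMap.le_def, ContinuousLinearMap.isPositive_iff_complex]
  intro x
  have h1 : inner ℂ ((1 - ∑ i, T i * star (T i)) x) x =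
      ((‖x‖ ^ 2 - ∑ i, ‖star (T i) x‖ ^ 2 : ℝ) : ℂ) := by
    rw [← inner_conj_symm, sub_apply, inner_sub_right, inner_sum_mul_star]
    simp only [inner_self_eq_norm_sq_to_K, one_apply_eq_self]
    simp
  rw [h1]
  refine ⟨by rw [RCLike.re_to_complex, Complex.ofReal_re], ?_⟩
  rw [RCLike.re_to_complex, Complex.ofReal_re]
  exact sub_nonneg.2 (h x)

/-- Inner products of defect vectors are expressible without the square root, which is what makes
them comparable between a tuple and its dilations. -/
theorem inner_defect (T : Fin n → H →L[ℂ] H) (hT : IsContractiveTuple T) (x y : H) :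
    inner ℂ (defect T x) (defect T y) =
      inner ℂ x y - ∑ i, inner ℂ (star (T i) x) (star (T i) y) := by
  have hpos : 0 ≤ 1 - ∑ i, T i * star (T i) := sub_nonneg.2 hT
  have hsa : star (defect T) = defect T := (CFC.sqrt_nonneg _).isSelfAdjoint
  have hsq : defect T * defect T = 1 - ∑ i, T i * star (T i) := CFC.sqrt_mul_sqrt_self _ hpos
  rw [← inner_star_right, hsa, ← mul_apply_eq_comp, hsq, sub_apply,
    inner_sub_right, inner_sum_mul_star, one_apply_eq_self]

/-- A commuting contractive tuple satisfying `A`-relations. -/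
structure IsCommutingATuple (A : Matrix (Fin n) (Fin n) ℂ) (T : Fin n → H →L[ℂ] H) : Prop where
  contractive : IsContractiveTuple T
  comm : ∀ i j, T i * T j = T j * T i
  rel : SatisfiesARelations A T

theorem star_scale (r : ℝ) (T : Fin n → H →L[ℂ] H) (i : Fin n) (h : H) :
    star (scale r T i) h = (r : ℂ) • star (T i) h := by
  simp [scale, star_smul]

theorem sum_norm_star_scale_sq_le {T : Fin n → H →L[ℂ] H} (hT : IsContractiveTuple T) (r : ℝ)
    (h : H) : ∑ i, ‖star (scale r T i) h‖ ^ 2 ≤ r ^ 2 * ‖h‖ ^ 2 := by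
  simp only [star_scale, norm_smul, mul_pow, ← Finset.mul_sum]
  simpa using mul_le_mul_of_nonneg_left (sum_norm_star_sq_le hT h) (sq_nonneg r)

theorem IsCommutingATuple.scale {T : Fin n → H →L[ℂ] H} (hT : IsCommutingATuple A T) {r : ℝ}
    (h0 : 0 ≤ r) (h1 : r ≤ 1) : IsCommutingATuple A (scale r T) where
  contractive := isContractiveTuple_of_sum_le fun x =>
    (sum_norm_star_scale_sq_le hT.contractive r x).trans
      (mul_le_of_le_one_left (by positivity) (pow_le_one₀ h0 h1))
  comm i j := by simp [CKDilation.scale, hT.comm i j]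
  rel i j := by
    simp only [CKDilation.scale, smul_mul_assoc, mul_smul_comm]
    conv_lhs => rw [hT.rel i j]
    simp only [smul_comm (A i j)]

end Tuples

/-! ### Slices of tensors -/

section TensorSlices

variable {G : Type v} [NormedAddCommGroup G] [InnerProductSpace ℂ G]
  {H : Type u} [NormedAddCommGroup H] [InnerProductSpace ℂ H]

/-- The operator `x ↦ x ⊗ k`. -/
def tensorRight (k : H) : G →L[ℂ] HilbertTensor G H :=
  LinearMap.mkContinuous
    { toFun := fun x => simpleTensor x k
      map_add' := fun x y => simpleTensor_add_left x y k
      map_smul' := fun c x => simpleTensor_smul_left c x k } ‖k‖ fun x => by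
        rw [LinearMap.coe_mk, AddHom.coe_mk, norm_simpleTensor, mul_comm]

theorem tensorRight_apply (k : H) (x : G) : tensorRight k x = simpleTensor x k := rfl

/-- The slice of a tensor by a vector of the second factor. -/
def slice [CompleteSpace G] (k : H) : HilbertTensor G H →L[ℂ] G :=
  ContinuousLinearMap.adjoint (tensorRight k)

theorem inner_slice [CompleteSpace G] (k : H) (x : G) (ξ : HilbertTensor G H) :
    inner ℂ x (slice k ξ) = inner ℂ (simpleTensor x k) ξ := by
  rw [slice, ContinuousLinearMap.adjoint_inner_right, tensorRight_apply]

end TensorSlices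

/-! ### The Poisson kernel: isometry, range and intertwining of adjoints -/

section PoissonKernel

variable {n : ℕ} {A : Matrix (Fin n) (Fin n) ℂ} {H : Type u} [NormedAddCommGroup H]
  [InnerProductSpace ℂ H] [CompleteSpace H] {T : Fin n → H →L[ℂ] H}

/-- The restriction to `A`-words is immaterial, since the remaining products `T^α` vanish. -/
theorem poissonCoeff_eq (hrel : SatisfiesARelations A T) (α : List (Fin n)) (h : H) :
    poissonCoeff A T α h = defect T (star (wordProd T α) h) := by
  unfold poissonCoeff
  split_ifs with hα
  · rfl
  · simp [hrel.wordProd_eq_zero hα]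

theorem hasSum_poissonKernel (hT : IsContractiveTuple T) (h : H) :
    HasSum (fun α => simpleTensor (fockBasis α) (poissonCoeff A T α h)) (poissonKernel A T h) := by
  simp only [poissonKernel, dif_pos hT, ContinuousLinearMap.comp_apply]
  exact (orthogonalFamily_basisTensor (n := n) (H := H)).hasSum_linearIsometry
    (poissonCoeffs A T hT h)

theorem inner_fockBasis_poissonKernel (hT : IsContractiveTuple T) (α : List (Fin n)) (k h : H) :
    inner ℂ (simpleTensor (fockBasis α) k) (poissonKernel A T h) =
      inner ℂ k (poissonCoeff A T α h) := by
  have h1 := (hasSum_poissonKernel (A := A) hT h).mapL (innerSL ℂ (simpleTensor (fockBasis α) k))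
  refine h1.unique ?_
  have h2 : ∀ β, innerSL ℂ (simpleTensor (fockBasis α) k)
      (simpleTensor (fockBasis β) (poissonCoeff A T β h)) =
      if β = α then inner ℂ k (poissonCoeff A T α h) else 0 := by
    intro β
    rw [innerSL_apply_apply, inner_simpleTensor, orthonormal_iff_ite.1 orthonormal_fockBasis]
    by_cases hβ : β = α
    · simp [hβ]
    · simp [hβ, Ne.symm hβ]
  simp only [h2]
  exact hasSum_ite_eq α _

theorem hasSum_norm_poissonKernel_sq (hT : IsContractiveTuple T) (h : H) :
    HasSum (fun α => ‖poissonCoeff A T α h‖ ^ 2) (‖poissonKernel A T h‖ ^ 2) := by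
  have h1 := (hasSum_poissonKernel (A := A) hT h).mapL (innerSL ℂ (poissonKernel A T h))
  have h2 := Complex.hasSum_re h1
  rw [innerSL_apply_apply, ← RCLike.re_to_complex, inner_self_eq_norm_sq] at h2
  refine h2.congr_fun fun α => ?_
  rw [innerSL_apply_apply, ← inner_conj_symm, inner_fockBasis_poissonKernel hT, inner_conj_symm,
    ← RCLike.re_to_complex, inner_self_eq_norm_sq]

theorem sum_shortWords_succ {M : Type*} [AddCommMonoid M] (m : ℕ) (f : List (Fin n) → M) :
    ∑ α ∈ shortWords n (m + 1), f α = f [] + ∑ i, ∑ α ∈ shortWords n m, f (i :: α) := by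
  classical
  have h : shortWords n (m + 1) =
      insert [] ((Finset.univ ×ˢ shortWords n m).image fun p => p.1 :: p.2) := by
    ext α
    cases α with
    | nil => simp [mem_shortWords]
    | cons i α => simp [mem_shortWords]
  rw [h, Finset.sum_insert (by simp), Finset.sum_image, Finset.sum_product]
  rintro ⟨i, β⟩ _ ⟨j, γ⟩ _ hij
  simpa using hij

/-- Iterating `‖Δ h‖² + ∑ ‖T_i* h‖² = ‖h‖²` leaves after `m` rounds a remainder over words of length
`m`, of size at most `c ^ m * ‖h‖²`. -/
theorem le_sum_shortWords_defect (hT : IsContractiveTuple T) {c : ℝ}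
    (hc : ∀ x, ∑ i, ‖star (T i) x‖ ^ 2 ≤ c * ‖x‖ ^ 2) (hc0 : 0 ≤ c) (m : ℕ) (h : H) :
    (1 - c ^ m) * ‖h‖ ^ 2 ≤
      ∑ α ∈ shortWords n m, ‖defect T (star (wordProd T α) h)‖ ^ 2 := by
  induction m generalizing h with
  | zero => simp [shortWords]
  | succ m ih =>
    rw [sum_shortWords_succ]
    simp only [star_wordProd_cons_apply, wordProd_nil, star_one, one_apply_eq_self]
    have h1 : (1 - c ^ m) * ∑ i, ‖star (T i) h‖ ^ 2 ≤ ∑ i, ∑ α ∈ shortWords n m,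
        ‖defect T (star (wordProd T α) (star (T i) h))‖ ^ 2 := by
      rw [Finset.mul_sum]
      exact Finset.sum_le_sum fun i _ => ih _
    have h2 := norm_defect_sq hT h
    have h3 := mul_le_mul_of_nonneg_left (hc h) (pow_nonneg hc0 m)
    rw [pow_succ]
    nlinarith

/-- For a strict row contraction the remainder `c ^ m` disappears in the limit; for `rT` one takes
`c = r²`. -/
theorem norm_poissonKernel (hT : IsContractiveTuple T) (hrel : SatisfiesARelations A T) {c : ℝ}
    (hc : ∀ x, ∑ i, ‖star (T i) x‖ ^ 2 ≤ c * ‖x‖ ^ 2) (hc0 : 0 ≤ c) (hc1 : c < 1) (h : H) :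
    ‖poissonKernel A T h‖ = ‖h‖ := by
  have h1 := hasSum_norm_poissonKernel_sq (A := A) hT h
  have h2 : ‖poissonKernel A T h‖ ^ 2 ≤ ‖h‖ ^ 2 :=
    hasSum_le_of_sum_le h1 fun F => sum_norm_poissonCoeff_le A hT h F
  have h3 : ∀ m : ℕ, (1 - c ^ m) * ‖h‖ ^ 2 ≤ ‖poissonKernel A T h‖ ^ 2 := by
    intro m
    refine (le_sum_shortWords_defect hT hc hc0 m h).trans ?_
    simp only [← poissonCoeff_eq hrel]
    exact sum_le_hasSum _ (fun _ _ => by positivity) h1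
  have h4 : Filter.Tendsto (fun m : ℕ => (1 - c ^ m) * ‖h‖ ^ 2) Filter.atTop
      (𝓝 ((1 - 0) * ‖h‖ ^ 2)) :=
    ((tendsto_pow_atTop_nhds_zero_of_lt_one hc0 hc1).const_sub 1).mul_const _
  have h5 := le_of_tendsto' h4 h3
  rw [sub_zero, one_mul] at h5
  exact (pow_left_inj₀ (norm_nonneg _) (norm_nonneg _) two_ne_zero).1 (h2.antisymm h5)

theorem coord_slice_poissonKernel (hT : IsContractiveTuple T) (α : List (Fin n)) (k h : H) :
    coord α (slice k (poissonKernel A T h)) = inner ℂ k (poissonCoeff A T α h) := by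
  rw [coord_apply, inner_slice, inner_fockBasis_poissonKernel hT]

/-- The coefficients of a slice inherit permutation invariance and vanishing off symmetric `A`-words
from the products `T^α`. Working with slices reduces tensor-valued membership to the scalar
criterion. -/
theorem slice_poissonKernel_mem (hT : IsCommutingATuple A T) (k h : H) :
    slice k (poissonKernel A T h) ∈ commFock A := by
  rw [mem_commFock_iff]
  simp only [coord_slice_poissonKernel hT.contractive, poissonCoeff_eq hT.rel]
  refine ⟨fun α β hp => by rw [wordProd_perm hT.comm hp], fun α hα => ?_⟩
  rw [wordProd_eq_zero_of_not_symmetric hT.rel hT.comm hα]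
  simp

theorem inner_commPoissonKernel (v : commFock A) (k h : H) :
    inner ℂ (simpleTensor v k) (commPoissonKernel A T h) =
      inner ℂ (v : FullFock n) (slice k (poissonKernel A T h)) := by
  rw [commPoissonKernel, ContinuousLinearMap.comp_apply, ← inner_conj_symm, inner_ampliation_left,
    inner_conj_symm, Submodule.adjoint_orthogonalProjectionOnto, ampliation_simpleTensor,
    inner_slice]
  rfl

theorem ampliation_subtype_commPoissonKernel (hT : IsCommutingATuple A T) (h : H) :
    ampliation H (commFock A).subtypeL (commPoissonKernel A T h) = poissonKernel A T h := by
  refine ext_inner_simpleTensor fun v k => ?_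
  rw [← inner_conj_symm, inner_ampliation_left, inner_conj_symm, Submodule.adjoint_subtypeL,
    ampliation_simpleTensor, inner_commPoissonKernel, ← inner_slice]
  exact Submodule.inner_orthogonalProjectionOnto_eq_of_mem_right
    ⟨_, slice_poissonKernel_mem hT k h⟩ v

theorem norm_commPoissonKernel (hT : IsCommutingATuple A T) (h : H) :
    ‖commPoissonKernel A T h‖ = ‖poissonKernel A T h‖ := by
  have h1 : inner ℂ (commPoissonKernel A T h) (commPoissonKernel A T h) =
      inner ℂ (poissonKernel A T h) (poissonKernel A T h) := by
    conv_lhs => rw [commPoissonKernel, ContinuousLinearMap.comp_apply, inner_ampliation_left,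
      Submodule.adjoint_orthogonalProjectionOnto]
    have := ampliation_subtype_commPoissonKernel hT h
    rw [commPoissonKernel, ContinuousLinearMap.comp_apply] at this
    rw [this]
  rw [inner_self_eq_norm_sq_to_K, inner_self_eq_norm_sq_to_K] at h1
  have h2 : ‖commPoissonKernel A T h‖ ^ 2 = ‖poissonKernel A T h‖ ^ 2 := by exact_mod_cast h1
  exact (pow_left_inj₀ (norm_nonneg _) (norm_nonneg _) two_ne_zero).1 h2

/-- Slices of the kernel lie in the commuting `A`-Fock space, so `W_i*` may be replaced by `L_i*`,
which strips the first letter; and `(T^{iα})* = (T^α)* T_i*`. -/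
theorem ampliation_star_commCreation (hT : IsCommutingATuple A T) (i : Fin n) (h : H) :
    ampliation H (star (commCreation A i)) (commPoissonKernel A T h) =
      commPoissonKernel A T (star (T i) h) := by
  refine ext_inner_simpleTensor fun v k => ?_
  rw [← inner_conj_symm, inner_ampliation_left, inner_conj_symm,
    ← ContinuousLinearMap.star_eq_adjoint, star_star, ampliation_simpleTensor,
    inner_commPoissonKernel, inner_commPoissonKernel]
  have h1 : inner ℂ (commCreation A i v : FullFock n) (slice k (poissonKernel A T h)) =
      inner ℂ (leftCreation i (v : FullFock n)) (slice k (poissonKernel A T h)) :=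
    inner_projection_left _ ⟨_, slice_poissonKernel_mem hT k h⟩ _
  rw [h1, ← inner_star_right]
  congr 1
  refine ext_coord fun α => ?_
  rw [ContinuousLinearMap.star_eq_adjoint, coord_adjoint_leftCreation,
    coord_slice_poissonKernel hT.contractive, coord_slice_poissonKernel hT.contractive,
    poissonCoeff_eq hT.rel, poissonCoeff_eq hT.rel, star_wordProd_cons_apply]

theorem inner_poissonTransform (r : ℝ) (X : commFock A →L[ℂ] commFock A) (a b : H) :
    inner ℂ a (poissonTransform A T r X b) =
      inner ℂ (commPoissonKernel A (scale r T) a)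
        (ampliation H X (commPoissonKernel A (scale r T) b)) := by
  simp only [poissonTransform, ContinuousLinearMap.comp_apply,
    ContinuousLinearMap.adjoint_inner_right]
  rfl

end PoissonKernel

/-! ### Poisson transforms of a tuple and of its dilation -/

section PoissonDilation

variable {n : ℕ} {A : Matrix (Fin n) (Fin n) ℂ} {H : Type u} [NormedAddCommGroup H]
  [InnerProductSpace ℂ H] [CompleteSpace H] {T : Fin n → H →L[ℂ] H}
  {N : Type v} [NormedAddCommGroup N] [InnerProductSpace ℂ N] [CompleteSpace N]
  {C : Fin n → N →L[ℂ] N} {J : H →ₗᵢ[ℂ] N}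

/-- The defect operator of `C` need not restrict to that of `T`. Its Gram matrix, however, involves
only adjoints of `C`, and on the range of `J` these are the adjoints of `T`. -/
theorem IsDilation.inner_poissonCoeff (hJ : IsDilation T C J) (hT : IsContractiveTuple T)
    (hC : IsContractiveTuple C) (α β : List (Fin n)) (a b : H) :
    inner ℂ (poissonCoeff A C α (J a)) (poissonCoeff A C β (J b)) =
      inner ℂ (poissonCoeff A T α a) (poissonCoeff A T β b) := by
  unfold poissonCoeff
  by_cases hα : IsAWord A α
  · by_cases hβ : IsAWord A β
    · rw [if_pos hα, if_pos hα, if_pos hβ, if_pos hβ]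
      simp only [mul_apply_eq_comp, inner_defect _ hT, inner_defect _ hC, hJ.star_wordProd, hJ _ _,
        J.inner_map_map]
    · simp [if_neg hβ]
  · simp [if_neg hα]

theorem IsDilation.inner_poissonKernel (hJ : IsDilation T C J) (hT : IsContractiveTuple T)
    (hC : IsContractiveTuple C) (Y : FullFock n →L[ℂ] FullFock n) (a b : H) :
    inner ℂ (poissonKernel A C (J a)) (ampliation N Y (poissonKernel A C (J b))) =
      inner ℂ (poissonKernel A T a) (ampliation H Y (poissonKernel A T b)) := by
  have h1 := (hasSum_poissonKernel (A := A) hC (J b)).mapL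
    (innerSL ℂ (poissonKernel A C (J a)) ∘L ampliation N Y)
  have h2 := (hasSum_poissonKernel (A := A) hT b).mapL
    (innerSL ℂ (poissonKernel A T a) ∘L ampliation H Y)
  refine h1.unique (h2.congr_fun fun α => ?_)
  simp only [ContinuousLinearMap.comp_apply, innerSL_apply_apply, ampliation_simpleTensor]
  rw [← inner_conj_symm, ← inner_conj_symm (poissonKernel A T a)]
  congr 1
  have h3 := (hasSum_poissonKernel (A := A) hC (J a)).mapL
    (innerSL ℂ (simpleTensor (Y (fockBasis α)) (poissonCoeff A C α (J b))))
  have h4 := (hasSum_poissonKernel (A := A) hT a).mapL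
    (innerSL ℂ (simpleTensor (Y (fockBasis α)) (poissonCoeff A T α b)))
  refine h3.unique (h4.congr_fun fun β => ?_)
  simp only [innerSL_apply_apply, inner_simpleTensor, hJ.inner_poissonCoeff hT hC]

theorem IsDilation.scale (hJ : IsDilation T C J) (r : ℝ) : IsDilation (scale r T) (scale r C) J :=
  fun i h => by rw [star_scale, star_scale, hJ, map_smul]

/-- This is how the Poisson map of `T` is obtained by compressing that of the maximal commuting
piece. -/
theorem IsDilation.inner_poissonTransform (hJ : IsDilation T C J) (hT : IsCommutingATuple A T)
    (hC : IsCommutingATuple A C) {r : ℝ} (h0 : 0 ≤ r) (h1 : r ≤ 1)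
    (X : commFock A →L[ℂ] commFock A) (a b : H) :
    inner ℂ (J a) (poissonTransform A C r X (J b)) = inner ℂ a (poissonTransform A T r X b) := by
  rw [CKDilation.inner_poissonTransform, CKDilation.inner_poissonTransform]
  have key := (hJ.scale r).inner_poissonKernel (A := A) (hT.scale h0 h1).contractive
    (hC.scale h0 h1).contractive
    ((commFock A).subtypeL ∘L X ∘L (commFock A).orthogonalProjectionOnto) a b
  simp only [ampliation_comp_apply] at key
  rw [commPoissonKernel, commPoissonKernel]
  simp only [ContinuousLinearMap.comp_apply]
  rw [inner_ampliation_left, inner_ampliation_left, Submodule.adjoint_orthogonalProjectionOnto]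
  exact key

end PoissonDilation

/-! ### Calculus of asymptotic intertwining -/

section AsymptoticIntertwining

variable {G : Type v} [NormedAddCommGroup G] [InnerProductSpace ℂ G]
  {N : Type u} [NormedAddCommGroup N] [InnerProductSpace ℂ N]
  {K : ℝ → N →L[ℂ] HilbertTensor G N}

/-- The kernels are isometric only in this range of `r`, and the filter sees no others. -/
theorem eventually_mem_Ico : ∀ᶠ r : ℝ in 𝓝[<] 1, 0 ≤ r ∧ r < 1 := by
  have h1 : ∀ᶠ r : ℝ in 𝓝[<] 1, r < 1 := eventually_mem_nhdsWithin
  have h2 : ∀ᶠ r : ℝ in 𝓝[<] 1, 0 ≤ r :=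
    (Filter.Eventually.filter_mono nhdsWithin_le_nhds (lt_mem_nhds one_pos)).mono fun _ h => le_of_lt h
  exact h2.and h1

/-- The operators `K_r` intertwine `X ⊗ I` and `Y` at `h` in the limit `r → 1`. -/
def AsymptoticallyIntertwines (K : ℝ → N →L[ℂ] HilbertTensor G N) (X : G →L[ℂ] G) (Y : N →L[ℂ] N)
    (h : N) : Prop :=
  Filter.Tendsto (fun r : ℝ => ampliation N X (K r h) - K r (Y h)) (𝓝[<] 1) (𝓝 0)

namespace AsymptoticallyIntertwines

variable {X X' : G →L[ℂ] G} {Y Y' : N →L[ℂ] N} {h h' : N}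

theorem one : AsymptoticallyIntertwines K 1 1 h := by
  simp [AsymptoticallyIntertwines, ampliation_one]

theorem add (hX : AsymptoticallyIntertwines K X Y h)
    (hX' : AsymptoticallyIntertwines K X' Y' h) :
    AsymptoticallyIntertwines K (X + X') (Y + Y') h := by
  have := Filter.Tendsto.add hX hX'
  rw [add_zero] at this
  refine this.congr fun r => ?_
  simp only [ampliation_add, add_apply, map_add]
  abel

theorem smul (c : ℂ) (hX : AsymptoticallyIntertwines K X Y h) :
    AsymptoticallyIntertwines K (c • X) (c • Y) h := by
  have := Filter.Tendsto.const_smul hX c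
  rw [smul_zero] at this
  refine this.congr fun r => ?_
  simp only [ampliation_smul, smul_apply, map_smul, smul_sub]

theorem sub (hX : AsymptoticallyIntertwines K X Y h)
    (hX' : AsymptoticallyIntertwines K X' Y' h) :
    AsymptoticallyIntertwines K (X - X') (Y - Y') h := by
  have := Filter.Tendsto.sub hX hX'
  rw [sub_zero] at this
  refine this.congr fun r => ?_
  simp only [ampliation_sub, sub_apply, map_sub]
  abel

/-- `(X ⊗ I)(X' ⊗ I) K_r ≈ (X ⊗ I) K_r Y' ≈ K_r Y Y'`. The second step uses the relation for `X` at
`Y' h`, hence the stronger hypothesis on `X`. -/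
theorem mul (hX : ∀ k, AsymptoticallyIntertwines K X Y k)
    (hX' : AsymptoticallyIntertwines K X' Y' h) :
    AsymptoticallyIntertwines K (X * X') (Y * Y') h := by
  have h1 := ((ampliation N X).continuous.tendsto 0).comp hX'
  have h2 := h1.add (hX (Y' h))
  rw [map_zero, add_zero] at h2
  refine h2.congr fun r => ?_
  simp only [Function.comp_apply, map_sub, ampliation_mul_apply, mul_apply_eq_comp]
  abel

theorem vec_add (h1 : AsymptoticallyIntertwines K X Y h)
    (h2 : AsymptoticallyIntertwines K X Y h') :
    AsymptoticallyIntertwines K X Y (h + h') := by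
  have := Filter.Tendsto.add h1 h2
  rw [add_zero] at this
  refine this.congr fun r => ?_
  simp only [map_add]
  abel

theorem vec_smul (c : ℂ) (h1 : AsymptoticallyIntertwines K X Y h) :
    AsymptoticallyIntertwines K X Y (c • h) := by
  have := Filter.Tendsto.const_smul h1 c
  rw [smul_zero] at this
  refine this.congr fun r => ?_
  simp only [map_smul, smul_sub]

/-- Isometric kernels transport norms, so the bound for `X ⊗ I` passes to `Y`. Hence `X` determines
`Y`, and norm limits of intertwined pairs exist. -/
theorem norm_le (hK : ∀ r, 0 ≤ r → r < 1 → ∀ h, ‖K r h‖ = ‖h‖) (hX : AsymptoticallyIntertwines K X Y h) :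
    ‖Y h‖ ≤ ‖X‖ * ‖h‖ := by
  have h1 := hX.norm.add_const (‖X‖ * ‖h‖)
  rw [norm_zero, zero_add] at h1
  refine ge_of_tendsto h1 (eventually_mem_Ico.mono fun r hr => ?_)
  rw [← hK r hr.1 hr.2 (Y h),
    ← hK r hr.1 hr.2 h]
  set a := ampliation N X (K r h)
  have h2 : ‖a‖ ≤ ‖X‖ * ‖K r h‖ :=
    ((ampliation N X).le_opNorm _).trans
      (mul_le_mul_of_nonneg_right (norm_ampliation_le X) (norm_nonneg _))
  have h3 := norm_sub_norm_le (K r (Y h)) a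
  rw [norm_sub_rev] at h3
  linarith

theorem opNorm_le (hK : ∀ r, 0 ≤ r → r < 1 → ∀ h, ‖K r h‖ = ‖h‖) (hX : ∀ k, AsymptoticallyIntertwines K X Y k) :
    ‖Y‖ ≤ ‖X‖ :=
  Y.opNorm_le_bound (norm_nonneg X) fun k => (hX k).norm_le hK

theorem unique (hK : ∀ r, 0 ≤ r → r < 1 → ∀ h, ‖K r h‖ = ‖h‖) (hX : ∀ k, AsymptoticallyIntertwines K X Y k)
    (hX' : ∀ k, AsymptoticallyIntertwines K X Y' k) : Y = Y' := by
  have := opNorm_le hK fun k => (hX k).sub (hX' k)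
  rw [sub_self, norm_zero] at this
  exact sub_eq_zero.1 (norm_le_zero_iff.1 this)

/-- The asymptotic intertwining relation passes to uniform limits. -/
theorem of_approx (hK : ∀ r, 0 ≤ r → r < 1 → ∀ h, ‖K r h‖ = ‖h‖)
    (happ : ∀ ε > 0, ∃ X' Y' k, AsymptoticallyIntertwines K X' Y' k ∧ ‖X - X'‖ ≤ ε ∧
      ‖Y - Y'‖ ≤ ε ∧ ‖h - k‖ ≤ ε) : AsymptoticallyIntertwines K X Y h := by
  refine Metric.tendsto_nhds.2 fun ε hε => ?_
  -- The constant multiplying `δ` is the sum of the constants in `b1` to `b4`; `δ ≤ 1` serves to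
  -- bound `‖k‖` by `‖h‖ + 1`.
  obtain ⟨δ, hδ, hδ1, hδ2⟩ : ∃ δ > 0, δ ≤ 1 ∧ δ * (2 * ‖h‖ + ‖X‖ + ‖Y‖ + 2) < ε / 2 := by
    set M := 2 * ‖h‖ + ‖X‖ + ‖Y‖ + 2
    have hM : 0 < M := by positivity
    refine ⟨min 1 (ε / 4 / M), by positivity, min_le_left _ _, ?_⟩
    calc min 1 (ε / 4 / M) * M ≤ ε / 4 / M * M := by gcongr; exact min_le_right _ _
      _ = ε / 4 := div_mul_cancel₀ _ hM.ne'
      _ < ε / 2 := by linarith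
  obtain ⟨X', Y', k, hk, hX', hY', hk'⟩ := happ δ hδ
  filter_upwards [Metric.tendsto_nhds.1 hk (ε / 2) (by linarith), eventually_mem_Ico] with r h1 hr
  rw [dist_zero_right] at h1 ⊢
  have hK : ∀ x, ‖K r x‖ = ‖x‖ := hK r hr.1 hr.2
  have e : ampliation N X (K r h) - K r (Y h) = (ampliation N X' (K r k) - K r (Y' k)) +
      (ampliation N (X - X') (K r k) + ampliation N X (K r (h - k)) - K r ((Y - Y') k) - K r (Y (h - k))) := by
    simp only [ampliation_sub, sub_apply, map_sub]
    abel
  have hamp : ∀ (Z : G →L[ℂ] G) x, ‖ampliation N Z (K r x)‖ ≤ ‖Z‖ * ‖x‖ := by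
    intro Z x
    rw [← hK x]
    exact ((ampliation N Z).le_opNorm _).trans
      (mul_le_mul_of_nonneg_right (norm_ampliation_le Z) (norm_nonneg _))
  have hkh : ‖k‖ ≤ ‖h‖ + 1 := by
    have := norm_sub_norm_le k h
    rw [norm_sub_rev] at this
    linarith
  have b1 : ‖ampliation N (X - X') (K r k)‖ ≤ δ * (‖h‖ + 1) := (hamp _ _).trans (by gcongr)
  have b2 : ‖ampliation N X (K r (h - k))‖ ≤ ‖X‖ * δ := (hamp _ _).trans (by gcongr)
  have b3 : ‖K r ((Y - Y') k)‖ ≤ δ * (‖h‖ + 1) := by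
    rw [hK]; exact ((Y - Y').le_opNorm k).trans (by gcongr)
  have b4 : ‖K r (Y (h - k))‖ ≤ ‖Y‖ * δ := by
    rw [hK]; exact (Y.le_opNorm _).trans (by gcongr)
  rw [e]
  calc _ ≤ ‖ampliation N X' (K r k) - K r (Y' k)‖ + (‖ampliation N (X - X') (K r k)‖ +
        ‖ampliation N X (K r (h - k))‖ + ‖K r ((Y - Y') k)‖ + ‖K r (Y (h - k))‖) := by
        refine (norm_add_le _ _).trans (add_le_add_right ((norm_sub_le _ _).trans
          (add_le_add_left ((norm_sub_le _ _).trans (add_le_add_left (norm_add_le _ _) _)) _)) _)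
    _ < ε := by nlinarith

end AsymptoticallyIntertwines

end AsymptoticIntertwining

/-! ### Asymptotic intertwining by Poisson kernels -/

section PoissonIntertwining

variable {n : ℕ} {A : Matrix (Fin n) (Fin n) ℂ} {N : Type u} [NormedAddCommGroup N]
  [InnerProductSpace ℂ N] [CompleteSpace N] {C : Fin n → N →L[ℂ] N}

theorem norm_commPoissonKernel_scale (hC : IsCommutingATuple A C) {r : ℝ} (h0 : 0 ≤ r)
    (h1 : r < 1) (h : N) : ‖commPoissonKernel A (scale r C) h‖ = ‖h‖ := by
  have hS := hC.scale h0 h1.le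
  rw [norm_commPoissonKernel hS]
  exact norm_poissonKernel hS.contractive hS.rel (sum_norm_star_scale_sq_le hC.contractive r)
    (sq_nonneg r) (by nlinarith) h

theorem inner_commPoissonKernel_scale (hC : IsCommutingATuple A C) {r : ℝ} (h0 : 0 ≤ r)
    (h1 : r < 1) (a b : N) : inner ℂ (commPoissonKernel A (scale r C) a)
      (commPoissonKernel A (scale r C) b) = inner ℂ a b :=
  LinearIsometry.inner_map_map (⟨(commPoissonKernel A (scale r C)).toLinearMap,
    norm_commPoissonKernel_scale hC h0 h1⟩ : N →ₗᵢ[ℂ] HilbertTensor (commFock A) N) a b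

/-- The Poisson kernels `K_r` of a tuple. -/
def poissonFamily (A : Matrix (Fin n) (Fin n) ℂ) (C : Fin n → N →L[ℂ] N) (r : ℝ) :
    N →L[ℂ] HilbertTensor (commFock A) N :=
  commPoissonKernel A (scale r C)

theorem norm_poissonFamily (hC : IsCommutingATuple A C) (r : ℝ) (h0 : 0 ≤ r) (h1 : r < 1) (h : N) :
    ‖poissonFamily A C r h‖ = ‖h‖ :=
  norm_commPoissonKernel_scale hC h0 h1 h

/-- The kernel of `rC` intertwines `W_i*` exactly with `r C_i*`, so the error has norm `(1 - r)
‖C_i* h‖`. -/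
theorem asymptoticallyIntertwines_star_commCreation (hC : IsCommutingATuple A C) (i : Fin n) (h : N) :
    AsymptoticallyIntertwines (poissonFamily A C) (star (commCreation A i)) (star (C i)) h := by
  rw [AsymptoticallyIntertwines, tendsto_zero_iff_norm_tendsto_zero]
  have h1 : Filter.Tendsto (fun r : ℝ => (1 - r) * ‖star (C i) h‖) (𝓝[<] 1) (𝓝 0) := by
    have : Filter.Tendsto (fun r : ℝ => (1 - r) * ‖star (C i) h‖) (𝓝 1)
        (𝓝 ((1 - 1) * ‖star (C i) h‖)) := by
      exact (Continuous.tendsto (by fun_prop) 1)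
    rw [sub_self, zero_mul] at this
    exact this.mono_left nhdsWithin_le_nhds
  refine h1.congr' (eventually_mem_Ico.mono fun r hr => ?_)
  beta_reduce
  simp only [poissonFamily]
  rw [ampliation_star_commCreation (hC.scale hr.1 hr.2.le), star_scale, map_smul,
    ← norm_commPoissonKernel_scale hC hr.1 hr.2 (star (C i) h)]
  set z := commPoissonKernel A (scale r C) (star (C i) h)
  have : (r : ℂ) • z - z = ((r - 1 : ℝ) : ℂ) • z := by push_cast; rw [sub_smul, one_smul]
  rw [this, norm_smul, Complex.norm_real, Real.norm_eq_abs, abs_of_nonpos (by linarith [hr.2]),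
    neg_sub]

/-- As `K_r* K_r = I`, the difference from the limit is `K_r* ((X ⊗ I) K_r h - K_r Y h)`. -/
theorem AsymptoticallyIntertwines.tendsto_poissonTransform
    {X : commFock A →L[ℂ] commFock A} {Y : N →L[ℂ] N} {h : N} (hC : IsCommutingATuple A C)
    (hX : AsymptoticallyIntertwines (poissonFamily A C) X Y h) :
    Filter.Tendsto (fun r => poissonTransform A C r X h) (𝓝[<] 1) (𝓝 (Y h)) := by
  rw [tendsto_iff_norm_sub_tendsto_zero]
  have h0 := hX.norm
  rw [norm_zero] at h0
  refine squeeze_zero' (Filter.Eventually.of_forall fun _ => norm_nonneg _)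
    (eventually_mem_Ico.mono fun r hr => ?_) h0
  set z := poissonTransform A C r X h - Y h with hz
  set K := commPoissonKernel A (scale r C)
  have h1 : inner ℂ z z = inner ℂ (K z) (ampliation N X (K h) - K (Y h)) := by
    conv_lhs => enter [3]; rw [hz]
    rw [inner_sub_right, inner_sub_right, inner_poissonTransform,
      inner_commPoissonKernel_scale hC hr.1 hr.2]
  have h2 : ‖z‖ * ‖z‖ ≤ ‖z‖ * ‖ampliation N X (K h) - K (Y h)‖ := by
    rw [← inner_self_eq_norm_mul_norm (𝕜 := ℂ), h1, ← norm_commPoissonKernel_scale hC hr.1 hr.2 z]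
    exact re_inner_le_norm _ _
  rcases (norm_nonneg z).eq_or_lt' with h3 | h3
  · rw [h3]; positivity
  · exact le_of_mul_le_mul_left h2 h3

end PoissonIntertwining

/-! ### From asymptotic intertwining to a representation -/

section Representation

variable {G : Type v} [NormedAddCommGroup G] [InnerProductSpace ℂ G] [CompleteSpace G]
  {N : Type u} [NormedAddCommGroup N] [InnerProductSpace ℂ N] [CompleteSpace N]
  {K : ℝ → N →L[ℂ] HilbertTensor G N}

/-- The operators `X` such that `X ⊗ I` and `X* ⊗ I` are asymptotically intertwined with some `Y` and
`Y*`. -/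
def intertwinedAlgebra (K : ℝ → N →L[ℂ] HilbertTensor G N) : StarSubalgebra ℂ (G →L[ℂ] G) where
  carrier := {X | ∃ Y : N →L[ℂ] N, (∀ h, AsymptoticallyIntertwines K X Y h) ∧
    ∀ h, AsymptoticallyIntertwines K (star X) (star Y) h}
  mul_mem' := by
    rintro X X' ⟨Y, h1, h2⟩ ⟨Y', h1', h2'⟩
    refine ⟨Y * Y', fun h => .mul h1 (h1' h), fun h => ?_⟩
    rw [star_mul, star_mul]
    exact .mul h2' (h2 h)
  add_mem' := by
    rintro X X' ⟨Y, h1, h2⟩ ⟨Y', h1', h2'⟩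
    refine ⟨Y + Y', fun h => (h1 h).add (h1' h), fun h => ?_⟩
    rw [star_add, star_add]
    exact (h2 h).add (h2' h)
  algebraMap_mem' c := by
    refine ⟨c • 1, fun h => ?_, fun h => ?_⟩
    · rw [Algebra.algebraMap_eq_smul_one]
      exact .smul c .one
    · rw [Algebra.algebraMap_eq_smul_one, star_smul, star_smul, star_one, star_one]
      exact .smul (star c) .one
  star_mem' := by
    rintro X ⟨Y, h1, h2⟩
    exact ⟨star Y, h2, by simpa only [star_star] using h1⟩

theorem isClosed_intertwinedAlgebra (hK : ∀ r, 0 ≤ r → r < 1 → ∀ h, ‖K r h‖ = ‖h‖) :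
    IsClosed (intertwinedAlgebra K : Set (G →L[ℂ] G)) := by
  refine isClosed_of_closure_subset fun X hX => ?_
  obtain ⟨x, hx, hlim⟩ := mem_closure_iff_seq_limit.1 hX
  choose y h1 h2 using hx
  have hcauchy : CauchySeq y := by
    refine Metric.cauchySeq_iff.2 fun ε hε => ?_
    obtain ⟨M, hM⟩ := Metric.cauchySeq_iff.1 hlim.cauchySeq ε hε
    refine ⟨M, fun m hm l hl => lt_of_le_of_lt ?_ (hM m hm l hl)⟩
    rw [dist_eq_norm, dist_eq_norm]
    exact AsymptoticallyIntertwines.opNorm_le hK fun h => (h1 m h).sub (h1 l h)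
  obtain ⟨Y, hY⟩ := cauchySeq_tendsto_of_complete hcauchy
  have hev : ∀ ε > 0, ∃ m, ‖X - x m‖ ≤ ε ∧ ‖Y - y m‖ ≤ ε := by
    intro ε hε
    obtain ⟨m, hm1, hm2⟩ := ((Metric.tendsto_nhds.1 hlim ε hε).and
      (Metric.tendsto_nhds.1 hY ε hε)).exists
    rw [dist_comm, dist_eq_norm] at hm1 hm2
    exact ⟨m, hm1.le, hm2.le⟩
  refine ⟨Y, fun h => .of_approx hK fun ε hε => ?_, fun h => .of_approx hK fun ε hε => ?_⟩
  · obtain ⟨m, hm1, hm2⟩ := hev ε hε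
    exact ⟨x m, y m, h, h1 m h, hm1, hm2, by simpa using hε.le⟩
  · obtain ⟨m, hm1, hm2⟩ := hev ε hε
    refine ⟨star (x m), star (y m), h, h2 m h, ?_, ?_, by simpa using hε.le⟩
    · rwa [← star_sub, norm_star]
    · rwa [← star_sub, norm_star]

/-- A tuple `C` which is asymptotically intertwined with `S` by isometries comes from a representation
of the `C*`-algebra generated by `S`. -/
theorem exists_representation {n : ℕ} {S : Fin n → G →L[ℂ] G} {C : Fin n → N →L[ℂ] N}
    (hK : ∀ r, 0 ≤ r → r < 1 → ∀ h, ‖K r h‖ = ‖h‖)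
    (hS : ∀ i h, AsymptoticallyIntertwines K (S i) (C i) h)
    (hS' : ∀ i h, AsymptoticallyIntertwines K (star (S i)) (star (C i)) h) :
    ∃ π : generatedCStarAlgebra S →⋆ₐ[ℂ] (N →L[ℂ] N),
      (∀ (X : generatedCStarAlgebra S) h, AsymptoticallyIntertwines K (X : G →L[ℂ] G) (π X) h) ∧
        ∀ i, π ⟨S i, mem_generatedCStarAlgebra S i⟩ = C i := by
  have hle : generatedCStarAlgebra S ≤ intertwinedAlgebra K := by
    refine StarSubalgebra.topologicalClosure_minimal (StarAlgebra.adjoin_le ?_)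
      (isClosed_intertwinedAlgebra hK)
    rintro _ ⟨i, rfl⟩
    exact ⟨C i, hS i, hS' i⟩
  choose f hf hf' using fun X : generatedCStarAlgebra S => hle X.2
  -- Partners are unique, so each algebraic law for `f` follows by exhibiting the right-hand side as
  -- a partner.
  have huniq : ∀ X : generatedCStarAlgebra S, ∀ Y,
      (∀ h, AsymptoticallyIntertwines K (X : G →L[ℂ] G) Y h) → f X = Y :=
    fun X Y hY => AsymptoticallyIntertwines.unique hK (hf X) hY
  refine ⟨{ toFun := f, map_one' := ?_, map_mul' := ?_, map_zero' := ?_, map_add' := ?_,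
            commutes' := ?_, map_star' := ?_ }, hf, fun i => huniq _ _ (hS i)⟩
  · exact huniq _ _ fun h => .one
  · exact fun X X' => huniq _ _ fun h => .mul (hf X) (hf X' h)
  · refine huniq _ _ fun h => ?_
    simpa using AsymptoticallyIntertwines.smul (0 : ℂ) (hf 0 h)
  · exact fun X X' => huniq _ _ fun h => .add (hf X h) (hf X' h)
  · refine fun c => huniq _ _ fun h => ?_
    rw [Algebra.algebraMap_eq_smul_one, Algebra.algebraMap_eq_smul_one]
    exact AsymptoticallyIntertwines.smul c .one
  · exact fun X => huniq _ _ (hf' X)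

end Representation

/-! ### Creation operators applied to Poisson kernels -/

section Estimates

variable {n : ℕ} {A : Matrix (Fin n) (Fin n) ℂ} {N : Type u} [NormedAddCommGroup N]
  [InnerProductSpace ℂ N] [CompleteSpace N] {C : Fin n → N →L[ℂ] N}

/-- With `X = S* S` the inner product equals `‖(S ⊗ I) ξ‖²`. -/
theorem re_inner_ampliation_nonneg {N : Type u} [NormedAddCommGroup N] [InnerProductSpace ℂ N]
    {G : Type*} [NormedAddCommGroup G] [InnerProductSpace ℂ G]
    [CompleteSpace G] {X : G →L[ℂ] G} (hX : 0 ≤ X) (ξ : HilbertTensor G N) :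
    0 ≤ (inner ℂ ξ (ampliation N X ξ)).re := by
  have h1 : X = star (CFC.sqrt X) * CFC.sqrt X := by
    rw [(CFC.sqrt_nonneg X).isSelfAdjoint.star_eq, CFC.sqrt_mul_sqrt_self X hX]
  rw [h1, ampliation_mul_apply, ContinuousLinearMap.star_eq_adjoint, ← inner_ampliation_left,
    ← RCLike.re_to_complex, inner_self_eq_norm_sq]
  positivity

theorem inner_ampliation_basisProjection (hC : IsContractiveTuple C) (F : Finset (List (Fin n)))
    (h : N) :
    inner ℂ (poissonKernel A C h) (ampliation N (basisProjection F) (poissonKernel A C h)) =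
      ((∑ β ∈ F, ‖poissonCoeff A C β h‖ ^ 2 : ℝ) : ℂ) := by
  have h1 := (hasSum_poissonKernel (A := A) hC h).mapL
    (innerSL ℂ (poissonKernel A C h) ∘L ampliation N (basisProjection F))
  have h2 : ∀ α, (innerSL ℂ (poissonKernel A C h) ∘L ampliation N (basisProjection F))
      (simpleTensor (fockBasis α) (poissonCoeff A C α h)) =
      if α ∈ F then ((‖poissonCoeff A C α h‖ ^ 2 : ℝ) : ℂ) else 0 := by
    intro α
    have h3 : basisProjection F (fockBasis α) = if α ∈ F then fockBasis α else 0 := by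
      simp only [basisProjection, sum_apply, ContinuousLinearMap.smulRight_apply, coord_fockBasis]
      simp
    rw [ContinuousLinearMap.comp_apply, innerSL_apply_apply, ampliation_simpleTensor, h3]
    split_ifs with hα
    · rw [← inner_conj_symm, inner_fockBasis_poissonKernel hC, inner_conj_symm,
        inner_self_eq_norm_sq_to_K]
      norm_cast
    · rw [← tensorRight_apply, map_zero, inner_zero_right]
  rw [funext h2] at h1
  rw [Complex.ofReal_sum]
  refine h1.unique ?_
  rw [Finset.sum_congr rfl fun β hβ => (if_pos hβ).symm]
  exact hasSum_sum_of_ne_finset_zero fun β hβ => if_neg hβ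

theorem norm_sq_eq_re_inner {E : Type*} [NormedAddCommGroup E] [InnerProductSpace ℂ E] (x : E) :
    ‖x‖ ^ 2 = (inner ℂ x x).re :=
  (inner_self_eq_norm_sq (𝕜 := ℂ) x).symm

/-- The deviation of `W_i* W_i` from `W_i W_i*` at a Poisson kernel. -/
theorem norm_ampliation_commCreation_sq_le (hC : IsCommutingATuple A C) (i : Fin n) {m : ℕ}
    (hm : 0 < m) (h : N) :
    ‖ampliation N (commCreation A i) (commPoissonKernel A C h)‖ ^ 2 ≤
      ‖ampliation N (star (commCreation A i)) (commPoissonKernel A C h)‖ ^ 2 +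
        ∑ β ∈ shortWords n m, ‖poissonCoeff A C β h‖ ^ 2 +
          (m : ℝ)⁻¹ * ‖commPoissonKernel A C h‖ ^ 2 := by
  set W := commCreation A i
  set Q := compression (commFock A) (basisProjection (shortWords n m)) with hQ
  set ξ := commPoissonKernel A C h with hξ
  have hQξ : inner ℂ ξ (ampliation N Q ξ) =
      ((∑ β ∈ shortWords n m, ‖poissonCoeff A C β h‖ ^ 2 : ℝ) : ℂ) := by
    rw [hQ, compression, ampliation_comp_apply, ← inner_conj_symm, inner_ampliation_left,
      inner_conj_symm, Submodule.adjoint_orthogonalProjectionOnto, ampliation_comp_apply,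
      ampliation_subtype_commPoissonKernel hC, inner_ampliation_basisProjection hC.contractive]
  have hW1 : inner ℂ ξ (ampliation N (star W * W) ξ) = inner ℂ (ampliation N W ξ) (ampliation N W ξ) := by
    rw [inner_ampliation_left, ampliation_mul_apply]; rfl
  have hW2 : inner ℂ ξ (ampliation N (W * star W) ξ) =
      inner ℂ (ampliation N (star W) ξ) (ampliation N (star W) ξ) := by
    rw [inner_ampliation_left, ampliation_mul_apply, ContinuousLinearMap.star_eq_adjoint,
      ContinuousLinearMap.adjoint_adjoint]
  -- The estimate `norm_commCreation_sq_le` on single vectors is an operator inequality, and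
  -- operator positivity survives tensoring with the identity.
  have hpos : 0 ≤ W * star W + Q + ((m : ℂ)⁻¹) • (1 : commFock A →L[ℂ] commFock A) - star W * W := by
    rw [ContinuousLinearMap.nonneg_iff_isPositive, ContinuousLinearMap.isPositive_iff_complex]
    intro v
    have h1 : inner ℂ ((W * star W + Q + ((m : ℂ)⁻¹) • (1 : commFock A →L[ℂ] commFock A) - star W * W) v) v
        = ((‖star W v‖ ^ 2 + ∑ β ∈ shortWords n m, ‖coord β (v : FullFock n)‖ ^ 2 +
          (m : ℝ)⁻¹ * ‖v‖ ^ 2 - ‖W v‖ ^ 2 : ℝ) : ℂ) := by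
      rw [← inner_conj_symm, sub_apply, add_apply, add_apply, inner_sub_right, inner_add_right,
        inner_add_right, smul_apply, inner_smul_right, hQ, inner_compression_right,
        inner_basisProjection, mul_apply_eq_comp, mul_apply_eq_comp, inner_star_right,
        ← inner_star_left, one_apply_eq_self, inner_self_eq_norm_sq_to_K,
        inner_self_eq_norm_sq_to_K, inner_self_eq_norm_sq_to_K]
      simp
    rw [h1]
    refine ⟨by rw [RCLike.re_to_complex, Complex.ofReal_re], ?_⟩
    rw [RCLike.re_to_complex, Complex.ofReal_re]
    exact sub_nonneg.2 (norm_commCreation_sq_le i hm v)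
  have h2 := re_inner_ampliation_nonneg hpos ξ
  rw [ampliation_sub, ampliation_add, ampliation_add, ampliation_smul, ampliation_one, sub_apply,
    add_apply, add_apply, smul_apply, inner_sub_right, inner_add_right, inner_add_right,
    inner_smul_right, hQξ, hW1, hW2, one_apply_eq_self] at h2
  rw [norm_sq_eq_re_inner, norm_sq_eq_re_inner (ampliation N (star W) ξ), norm_sq_eq_re_inner ξ]
  have h3 : (((m : ℂ)⁻¹) * inner ℂ ξ ξ).re = (m : ℝ)⁻¹ * (inner ℂ ξ ξ).re := by
    rw [← Complex.ofReal_natCast, ← Complex.ofReal_inv, Complex.re_ofReal_mul]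
  rw [Complex.sub_re, Complex.add_re, Complex.add_re, Complex.ofReal_re, h3] at h2
  linarith

end Estimates

/-! ### Limits on spherical vectors and on vectors generated by wandering vectors -/

section PoissonLimits

variable {n : ℕ} {A : Matrix (Fin n) (Fin n) ℂ} {N : Type u} [NormedAddCommGroup N]
  [InnerProductSpace ℂ N] [CompleteSpace N] {C : Fin n → N →L[ℂ] N}

theorem norm_star_apply_le (hC : IsContractiveTuple C) (i : Fin n) (h : N) :
    ‖star (C i) h‖ ≤ ‖h‖ := by
  refine (pow_le_pow_iff_left₀ (norm_nonneg _) (norm_nonneg _) two_ne_zero).1 ?_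
  exact (Finset.single_le_sum (f := fun i => ‖star (C i) h‖ ^ 2) (fun _ _ => by positivity)
    (Finset.mem_univ i)).trans (sum_norm_star_sq_le hC h)

theorem norm_star_wordProd_le (hC : IsContractiveTuple C) (α : List (Fin n)) (h : N) :
    ‖star (wordProd C α) h‖ ≤ ‖h‖ := by
  induction α generalizing h with
  | nil => simp [wordProd_nil]
  | cons i α ih =>
    rw [star_wordProd_cons_apply]
    exact (ih _).trans (norm_star_apply_le hC i h)

theorem star_wordProd_scale_apply (r : ℝ) (α : List (Fin n)) (h : N) :
    star (wordProd (scale r C) α) h = (r : ℂ) ^ α.length • star (wordProd C α) h := by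
  simp [wordProd_scale, star_smul]

/-- At a spherical vector `y` the defect of `rC` satisfies `‖Δ_r y‖² = (1 - r²) ‖y‖²`, so each fixed
coefficient of the kernel dies out as `r → 1`. -/
theorem norm_poissonCoeff_scale_sq_le (hC : IsCommutingATuple A C) {r : ℝ} (h0 : 0 ≤ r) (h1 : r < 1)
    {h : N} (β : List (Fin n)) (hsph : ∑ j, ‖star (C j) (star (wordProd C β) h)‖ ^ 2 =
      ‖star (wordProd C β) h‖ ^ 2) :
    ‖poissonCoeff A (scale r C) β h‖ ^ 2 ≤ (1 - r ^ 2) * ‖h‖ ^ 2 := by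
  have hS := hC.scale h0 h1.le
  rw [poissonCoeff_eq hS.rel, star_wordProd_scale_apply]
  set y := star (wordProd C β) h with hy
  have h2 := norm_defect_sq hS.contractive y
  simp only [star_scale, norm_smul, mul_pow, ← Finset.mul_sum, Complex.norm_real,
    Real.norm_eq_abs, sq_abs] at h2
  rw [hsph] at h2
  have h3 : ‖y‖ ^ 2 ≤ ‖h‖ ^ 2 :=
    pow_le_pow_left₀ (norm_nonneg _) (norm_star_wordProd_le hC.contractive β h) 2
  have h4 : (r ^ β.length) ^ 2 ≤ 1 := pow_le_one₀ (by positivity) (pow_le_one₀ h0 h1.le)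
  rw [map_smul, norm_smul, mul_pow, norm_pow, Complex.norm_real, Real.norm_eq_abs, abs_of_nonneg h0]
  have h5 : ‖defect (scale r C) y‖ ^ 2 = (1 - r ^ 2) * ‖y‖ ^ 2 := by linarith
  have h6 : 0 ≤ 1 - r ^ 2 := by nlinarith
  calc _ ≤ 1 * ‖defect (scale r C) y‖ ^ 2 := by gcongr
    _ = (1 - r ^ 2) * ‖y‖ ^ 2 := by rw [one_mul, h5]
    _ ≤ _ := by gcongr

/-- Expand the square. Exact intertwining of `W_i*` makes the cross term `r ‖C_i h‖²`, and `hnorm`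
bounds the leading part of the first term by `r² ‖C_i h‖²`; together with `‖C_i h‖²` this gives `(1
- r)² ‖C_i h‖²`. -/
theorem norm_intertwining_defect_sq_le (hC : IsCommutingATuple A C) (i : Fin n) {h : N}
    (hsph : ∀ β, ∑ j, ‖star (C j) (star (wordProd C β) h)‖ ^ 2 = ‖star (wordProd C β) h‖ ^ 2)
    (hnorm : ‖star (C i) h‖ ≤ ‖C i h‖) {r : ℝ} (h0 : 0 ≤ r) (h1 : r < 1) {m : ℕ} (hm : 0 < m) :
    ‖ampliation N (commCreation A i) (poissonFamily A C r h) - poissonFamily A C r (C i h)‖ ^ 2 ≤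
      (1 - r) ^ 2 * ‖C i h‖ ^ 2 + (shortWords n m).card * (1 - r ^ 2) * ‖h‖ ^ 2 +
        (m : ℝ)⁻¹ * ‖h‖ ^ 2 := by
  have hS := hC.scale h0 h1.le
  set ξ := poissonFamily A C r h with hξ
  set η := poissonFamily A C r (C i h) with hη
  have hξn : ‖ξ‖ = ‖h‖ := norm_poissonFamily hC r h0 h1 h
  have hηn : ‖η‖ = ‖C i h‖ := norm_poissonFamily hC r h0 h1 _
  have e1 := norm_ampliation_commCreation_sq_le hS i hm h
  change ‖ampliation N (commCreation A i) ξ‖ ^ 2 ≤ ‖ampliation N (star (commCreation A i)) ξ‖ ^ 2 +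
    _ + (m : ℝ)⁻¹ * ‖ξ‖ ^ 2 at e1
  have e2 : ‖ampliation N (star (commCreation A i)) ξ‖ ^ 2 = r ^ 2 * ‖star (C i) h‖ ^ 2 := by
    have e3 := ampliation_star_commCreation hS i h
    change ampliation N (star (commCreation A i)) ξ = _ at e3
    rw [e3, norm_commPoissonKernel_scale hC h0 h1, star_scale, norm_smul, mul_pow]
    simp
  have e3 : ∑ β ∈ shortWords n m, ‖poissonCoeff A (scale r C) β h‖ ^ 2 ≤
      (shortWords n m).card * (1 - r ^ 2) * ‖h‖ ^ 2 := by
    rw [mul_assoc, ← nsmul_eq_mul]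
    exact Finset.sum_le_card_nsmul _ _ _ fun β _ =>
      norm_poissonCoeff_scale_sq_le hC h0 h1 β (hsph β)
  have e4 : inner ℂ (ampliation N (commCreation A i) ξ) η = ((r * ‖C i h‖ ^ 2 : ℝ) : ℂ) := by
    rw [inner_ampliation_left, ← ContinuousLinearMap.star_eq_adjoint]
    have e5 := ampliation_star_commCreation hS i (C i h)
    change ampliation N (star (commCreation A i)) η = _ at e5
    rw [e5, hξ, poissonFamily, inner_commPoissonKernel_scale hC h0 h1, star_scale,
      inner_smul_right, inner_star_right, inner_self_eq_norm_sq_to_K]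
    push_cast
    rfl
  have e5 := norm_sub_sq (𝕜 := ℂ) (ampliation N (commCreation A i) ξ) η
  rw [e4, RCLike.re_to_complex, Complex.ofReal_re, hηn] at e5
  have e6 : ‖star (C i) h‖ ^ 2 ≤ ‖C i h‖ ^ 2 := pow_le_pow_left₀ (norm_nonneg _) hnorm 2
  have e7 := mul_le_mul_of_nonneg_left e6 (sq_nonneg r)
  rw [e2, hξn] at e1
  rw [e5]
  nlinarith

/-- Asymptotic intertwining on the spherical part of a tuple. -/
theorem asymptoticallyIntertwines_of_spherical (hC : IsCommutingATuple A C) (i : Fin n) {h : N}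
    (hsph : ∀ β, ∑ j, ‖star (C j) (star (wordProd C β) h)‖ ^ 2 = ‖star (wordProd C β) h‖ ^ 2)
    (hnorm : ‖star (C i) h‖ ≤ ‖C i h‖) :
    AsymptoticallyIntertwines (poissonFamily A C) (commCreation A i) (C i) h := by
  refine Metric.tendsto_nhds.2 fun ε hε => ?_
  -- The order of choices matters: `m` is fixed before `r → 1`, because the number of short words
  -- grows with `m`.
  obtain ⟨m, hm0, hm⟩ : ∃ m : ℕ, 0 < m ∧ (m : ℝ)⁻¹ * ‖h‖ ^ 2 < ε ^ 2 / 2 := by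
    have h1 : Filter.Tendsto (fun m : ℕ => (m : ℝ)⁻¹ * ‖h‖ ^ 2) Filter.atTop (𝓝 (0 * ‖h‖ ^ 2)) :=
      tendsto_inv_atTop_nhds_zero_nat.mul_const _
    rw [zero_mul] at h1
    exact ((Filter.eventually_gt_atTop 0).and (h1.eventually_lt_const (by positivity))).exists
  have h2 : Filter.Tendsto (fun r : ℝ => (1 - r) ^ 2 * ‖C i h‖ ^ 2 +
      (shortWords n m).card * (1 - r ^ 2) * ‖h‖ ^ 2) (𝓝[<] 1) (𝓝 0) := by
    have h3 : Continuous fun r : ℝ => (1 - r) ^ 2 * ‖C i h‖ ^ 2 +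
      (shortWords n m).card * (1 - r ^ 2) * ‖h‖ ^ 2 := by fun_prop
    have h4 := h3.tendsto 1
    simp only [sub_self, one_pow, mul_zero, zero_mul, add_zero, ne_eq, OfNat.ofNat_ne_zero,
      not_false_eq_true, zero_pow] at h4
    exact h4.mono_left nhdsWithin_le_nhds
  filter_upwards [h2.eventually_lt_const (show (0 : ℝ) < ε ^ 2 / 2 by positivity),
    eventually_mem_Ico] with r hr1 hr2
  rw [dist_zero_right]
  refine (pow_lt_pow_iff_left₀ (norm_nonneg _) hε.le two_ne_zero).1 ?_
  refine (norm_intertwining_defect_sq_le hC i hsph hnorm hr2.1 hr2.2 hm0).trans_lt ?_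
  linarith

/-- Here `Δ² e = e`, so `z = Δ e - e` satisfies `Δ z = -z`, and positivity of `Δ` forces `z = 0`. -/
theorem defect_apply_eq_self (hC : IsContractiveTuple C) {e : N} (he : ∀ j, star (C j) e = 0) :
    defect C e = e := by
  set z := defect C e - e with hz
  have h1 : defect C z = -z := by
    refine ext_inner_left ℂ fun x => ?_
    have h2 : inner ℂ x (defect C (defect C e)) = inner ℂ x e := by
      have hsa : star (defect C) = defect C := (CFC.sqrt_nonneg _).isSelfAdjoint
      rw [← inner_star_left, hsa, inner_defect _ hC]
      simp [he]
    rw [hz, map_sub, inner_sub_right, h2, inner_neg_right, inner_sub_right, neg_sub]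
  have h2 : (0 : N →L[ℂ] N) ≤ defect C := CFC.sqrt_nonneg _
  have h3 := (((ContinuousLinearMap.nonneg_iff_isPositive _).1 h2).re_inner_nonneg_right z)
  rw [h1, inner_neg_right, map_neg, inner_self_eq_norm_sq] at h3
  have h4 : ‖z‖ ^ 2 = 0 := le_antisymm (by linarith) (by positivity)
  have h5 : z = 0 := norm_eq_zero.1 (pow_eq_zero_iff two_ne_zero |>.1 h4)
  exact sub_eq_zero.1 h5

/-- Convergence of the Poisson kernels on vectors generated by a wandering vector. -/
theorem tendsto_poissonFamily_of_wandering (hC : IsCommutingATuple A C) {e h : N} {v : commFock A}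
    (he : ∀ j, star (C j) e = 0) (hn : ‖h‖ = ‖v‖ * ‖e‖)
    (hv : ∀ α, inner ℂ e (star (wordProd C α) h) = coord α (v : FullFock n) * ((‖e‖ ^ 2 : ℝ) : ℂ)) :
    Filter.Tendsto (fun r => poissonFamily A C r h) (𝓝[<] 1) (𝓝 (simpleTensor v e)) := by
  -- The pairing of the kernel with the expected limit is an Abel sum of the series for `‖h‖²`. Both
  -- vectors have norm `‖h‖`, so convergence of the pairing to `‖h‖²` forces norm convergence.
  have h1 : ∀ r : ℝ, 0 ≤ r → r < 1 → HasSum (fun α : List (Fin n) =>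
      r ^ α.length * ‖coord α (v : FullFock n)‖ ^ 2 * ‖e‖ ^ 2)
      (inner ℂ (simpleTensor v e) (poissonFamily A C r h)).re := by
    intro r h0 h1
    have hS := hC.scale h0 h1.le
    rw [poissonFamily, inner_commPoissonKernel]
    refine (Complex.hasSum_re (hasSum_inner_coord _ _)).congr_fun fun α => ?_
    have he' : ∀ j, star (scale r C j) e = 0 := fun j => by rw [star_scale, he, smul_zero]
    have hsa : star (defect (scale r C)) = defect (scale r C) := (CFC.sqrt_nonneg _).isSelfAdjoint
    rw [coord_slice_poissonKernel hS.contractive, poissonCoeff_eq hS.rel, ← hsa, inner_star_right,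
      defect_apply_eq_self hS.contractive he', star_wordProd_scale_apply, inner_smul_right, hv]
    have h3 := Complex.conj_mul' (coord α (v : FullFock n))
    rw [starRingEnd_apply] at h3
    rw [mul_left_comm, ← mul_assoc (star _), h3, ← Complex.ofReal_re (_ * _)]
    push_cast
    ring_nf
  have h2 : HasSum (fun α : List (Fin n) => ‖coord α (v : FullFock n)‖ ^ 2 * ‖e‖ ^ 2)
      (‖h‖ ^ 2) := by
    rw [hn, mul_pow]
    exact (hasSum_norm_coord_sq (v : FullFock n)).mul_right _
  have h3 : Filter.Tendsto (fun r : ℝ => ∑' α : List (Fin n),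
      r ^ α.length * ‖coord α (v : FullFock n)‖ ^ 2 * ‖e‖ ^ 2) (𝓝[<] 1) (𝓝 (‖h‖ ^ 2)) := by
    rw [← h2.tsum_eq]
    refine tendsto_tsum_of_dominated_convergence h2.summable (fun α => ?_)
      (eventually_mem_Ico.mono fun r hr α => ?_)
    · have h4 : Continuous fun r : ℝ => r ^ α.length * ‖coord α (v : FullFock n)‖ ^ 2 * ‖e‖ ^ 2 := by
        fun_prop
      have h5 := h4.tendsto 1
      rw [one_pow, one_mul] at h5
      exact h5.mono_left nhdsWithin_le_nhds
    · rw [mul_assoc, norm_mul, Real.norm_of_nonneg (pow_nonneg hr.1 _),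
        Real.norm_of_nonneg (mul_nonneg (sq_nonneg _) (sq_nonneg _))]
      exact mul_le_of_le_one_left (by positivity) (pow_le_one₀ hr.1 hr.2.le)
  rw [tendsto_iff_norm_sub_tendsto_zero]
  have h4 : Filter.Tendsto (fun r => ‖poissonFamily A C r h - simpleTensor v e‖ ^ 2) (𝓝[<] 1)
      (𝓝 0) := by
    have h5 := (h3.const_mul 2).const_sub (2 * ‖h‖ ^ 2)
    rw [sub_self] at h5
    refine h5.congr' (eventually_mem_Ico.mono fun r hr => ?_)
    beta_reduce
    rw [norm_sub_sq (𝕜 := ℂ), norm_poissonFamily hC r hr.1 hr.2, norm_simpleTensor,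
      ← hn, (h1 r hr.1 hr.2).tsum_eq, ← inner_conj_symm, Complex.conj_re,
      RCLike.re_to_complex]
    ring
  have h5 := h4.sqrt
  simpa using h5

end PoissonLimits

/-! ### Cuntz–Krieger tuples and their wandering vectors -/

section CuntzKrieger

variable {n : ℕ} {A : Matrix (Fin n) (Fin n) ℂ} {L : Type u} [NormedAddCommGroup L]
  [InnerProductSpace ℂ L] [CompleteSpace L] {R : Fin n → L →L[ℂ] L}

/-- Cuntz-Krieger tuples: partial isometries with orthogonal ranges, the `A`-relations and the
Cuntz-Krieger relations. -/
structure IsCuntzKriegerTuple (A : Matrix (Fin n) (Fin n) ℂ) (R : Fin n → L →L[ℂ] L) : Prop where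
  partialIsometry : ∀ i, R i * star (R i) * R i = R i
  orthogonalRanges : ∀ i j, i ≠ j → star (R i) * R j = 0
  aRelations : SatisfiesARelations A R
  cuntzKrieger : ∀ i, star (R i) * R i = 1 - ∑ j, (1 - A i j) • (R j * star (R j))

theorem satisfiesARelations_of_mul_eq_zero {H : Type*} [NormedAddCommGroup H]
    [InnerProductSpace ℂ H] {T : Fin n → H →L[ℂ] H} (h : ∀ i j, A i j ≠ 1 → T i * T j = 0) :
    SatisfiesARelations A T := by
  intro i j
  by_cases hij : A i j = 1
  · rw [hij, one_smul]
  · rw [h i j hij, smul_zero]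

namespace IsCuntzKriegerTuple

variable (hR : IsCuntzKriegerTuple A R)
include hR

theorem star_mul_mul_star (i : Fin n) : star (R i) * R i * star (R i) = star (R i) := by
  have := congrArg star (hR.partialIsometry i)
  rwa [star_mul, star_mul, star_star, ← mul_assoc] at this

theorem star_apply_apply_of_ne {i j : Fin n} (h : i ≠ j) (x : L) : star (R i) (R j x) = 0 :=
  DFunLike.congr_fun (hR.orthogonalRanges i j h) x

theorem star_apply_sum (k : Fin n) (x : Fin n → L) :
    star (R k) (∑ j, R j (x j)) = star (R k) (R k (x k)) := by
  rw [map_sum]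
  exact Finset.sum_eq_single k (fun j _ hj => hR.star_apply_apply_of_ne hj.symm _) (by simp)

/-- Removing the range components of `x` leaves a wandering vector; this is the source of all
wandering vectors used later. -/
theorem star_apply_sub_eq_zero (k : Fin n) (x : L) :
    star (R k) (x - ∑ j, R j (star (R j) x)) = 0 := by
  rw [map_sub, hR.star_apply_sum k fun j => star (R j) x]
  have := DFunLike.congr_fun (hR.star_mul_mul_star k) x
  simp only [mul_apply_eq_comp] at this
  rw [this, sub_self]

theorem norm_sub_sum_sq (x : L) :
    ‖x - ∑ j, R j (star (R j) x)‖ ^ 2 = ‖x‖ ^ 2 - ∑ j, ‖star (R j) x‖ ^ 2 := by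
  have h1 : ∀ z, (∀ k, star (R k) z = 0) → inner ℂ z (∑ j, R j (star (R j) x)) = 0 := by
    intro z hz
    rw [inner_sum]
    refine Finset.sum_eq_zero fun j _ => ?_
    rw [← inner_star_left, hz, inner_zero_left]
  have h2 : inner ℂ (x - ∑ j, R j (star (R j) x)) (x - ∑ j, R j (star (R j) x)) =
      ((‖x‖ ^ 2 - ∑ j, ‖star (R j) x‖ ^ 2 : ℝ) : ℂ) := by
    rw [inner_sub_right, h1 _ fun k => hR.star_apply_sub_eq_zero k x, sub_zero, inner_sub_left,
      sum_inner, inner_self_eq_norm_sq_to_K]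
    simp only [← inner_star_right, inner_self_eq_norm_sq_to_K]
    push_cast
    rfl
  rw [inner_self_eq_norm_sq_to_K] at h2
  refine Complex.ofReal_injective (Eq.trans ?_ h2)
  push_cast
  rfl

theorem contractive : IsContractiveTuple R :=
  isContractiveTuple_of_sum_le fun x => by
    have := hR.norm_sub_sum_sq x
    nlinarith [sq_nonneg ‖x - ∑ j, R j (star (R j) x)‖]

/-- The Cuntz–Krieger relation removes from `R_i* R_i` only ranges of `R_j` with `a_{ij} ≠ 1`. For
nonempty `β`, `R^β e` lies in the range of its first letter, which `i` may precede; for empty `β`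
every `R_j*` kills `e`. -/
theorem star_apply_apply_wordProd {e : L} (he : ∀ k, star (R k) e = 0) {i : Fin n}
    {β : List (Fin n)} (h : IsAWord A (i :: β)) :
    star (R i) (R i (wordProd R β e)) = wordProd R β e := by
  have h1 : ∀ y, star (R i) (R i y) = y - ∑ j, (1 - A i j) • R j (star (R j) y) := by
    intro y
    have := DFunLike.congr_fun (hR.cuntzKrieger i) y
    simpa [sum_apply] using this
  rw [h1, sub_eq_self]
  refine Finset.sum_eq_zero fun j _ => ?_
  cases β with
  | nil => simp [wordProd_nil, he]
  | cons k β =>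
    rw [wordProd_cons, mul_apply_eq_comp]
    by_cases hjk : j = k
    · subst hjk
      rw [(List.isChain_cons_cons.1 h).1, sub_self, zero_smul]
    · rw [hR.star_apply_apply_of_ne hjk, map_zero, smul_zero]

theorem inner_wordProd_wordProd {e e' : L} (he : ∀ k, star (R k) e = 0)
    (he' : ∀ k, star (R k) e' = 0) (α β : List (Fin n)) :
    inner ℂ (wordProd R β e') (wordProd R α e) =
      open Classical in if α = β ∧ IsAWord A α then inner ℂ e' e else 0 := by
  induction α generalizing β with
  | nil =>
    cases β with
    | nil => simp [wordProd_nil, IsAWord]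
    | cons j β => simp [wordProd_nil, wordProd_cons, ← inner_star_right, he]
  | cons i α ih =>
    cases β with
    | nil => simp [wordProd_nil, wordProd_cons, ← inner_star_left, he']
    | cons j β =>
      by_cases hα : IsAWord A (i :: α)
      · rw [wordProd_cons, mul_apply_eq_comp, wordProd_cons, mul_apply_eq_comp, ← inner_star_right]
        by_cases hij : i = j
        · subst hij
          rw [hR.star_apply_apply_wordProd he hα, ih]
          have : IsAWord A α := hα.of_cons
          simp [hα, this]
        · rw [hR.star_apply_apply_of_ne (Ne.symm hij), inner_zero_right, if_neg]
          simp [hij]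
      · rw [hR.aRelations.wordProd_eq_zero hα]
        simp [hα]

end IsCuntzKriegerTuple

/-! ### The maximal commuting subspace and piece -/

section MaximalCommuting

theorem lift_commutatorPoly {H : Type*} [NormedAddCommGroup H] [InnerProductSpace ℂ H]
    (R : Fin n → H →L[ℂ] H) (i j : Fin n) :
    FreeAlgebra.lift ℂ R (commutatorPoly (i, j)) = R i * R j - R j * R i := by
  simp [commutatorPoly]

theorem star_mem_maximalCommutingSubspace {x : L} (hx : x ∈ maximalCommutingSubspace R)
    (i : Fin n) : star (R i) x ∈ maximalCommutingSubspace R :=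
  (isGreatest_maximalSubspace commutatorPoly R).1.2.1 i x hx

theorem star_comm_of_mem {x : L} (hx : x ∈ maximalCommutingSubspace R) (i j : Fin n) :
    star (R i) (star (R j) x) = star (R j) (star (R i) x) := by
  have := (isGreatest_maximalSubspace commutatorPoly R).1.2.2 (j, i) x hx
  rw [lift_commutatorPoly, star_sub, star_mul, star_mul, sub_apply, sub_eq_zero] at this
  exact this

/-- The vectors with this property form a closed coinvariant subspace, and maximality applies;
quantifying over `γ` is what makes it coinvariant. -/
theorem mem_maximalCommutingSubspace_of_comm {x : L} (hx : ∀ γ i j,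
    star (R i) (star (R j) (star (wordProd R γ) x)) =
      star (R j) (star (R i) (star (wordProd R γ) x))) : x ∈ maximalCommutingSubspace R := by
  let M : Submodule ℂ L := ⨅ (γ : List (Fin n)) (i : Fin n) (j : Fin n),
    (star (R i) * star (R j) * star (wordProd R γ) -
      star (R j) * star (R i) * star (wordProd R γ)).ker
  have hM : ∀ y, y ∈ M ↔ ∀ γ i j, star (R i) (star (R j) (star (wordProd R γ) y)) =
      star (R j) (star (R i) (star (wordProd R γ) y)) := by
    intro y
    simp [M, Submodule.mem_iInf, sub_eq_zero]
  refine (isGreatest_maximalSubspace commutatorPoly R).2 ⟨?_, fun i y hy => ?_, fun lm y hy => ?_⟩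
    ((hM x).2 hx)
  · simp only [M, Submodule.coe_iInf]
    exact isClosed_iInter fun γ => isClosed_iInter fun i => isClosed_iInter fun j =>
      ContinuousLinearMap.isClosed_ker _
  · rw [hM] at hy ⊢
    intro γ k l
    simpa only [star_wordProd_cons_apply] using hy (i :: γ) k l
  · obtain ⟨i, j⟩ := lm
    have := (hM y).1 hy [] j i
    rw [wordProd_nil, star_one, one_apply_eq_self] at this
    rw [lift_commutatorPoly, star_sub, star_mul, star_mul, sub_apply, sub_eq_zero]
    exact this

theorem isDilation_maximalCommutingPiece (R : Fin n → L →L[ℂ] L) :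
    IsDilation (maximalCommutingPiece R) R (maximalCommutingSubspace R).subtypeₗᵢ :=
  fun i h => (coe_star_compression
    (fun _ hx => star_mem_maximalCommutingSubspace hx i) h).symm

theorem coe_star_maximalCommutingPiece (i : Fin n) (h : maximalCommutingSubspace R) :
    (star (maximalCommutingPiece R i) h : L) = star (R i) h :=
  (isDilation_maximalCommutingPiece R i h).symm

theorem coe_star_wordProd_maximalCommutingPiece (α : List (Fin n))
    (h : maximalCommutingSubspace R) :
    (star (wordProd (maximalCommutingPiece R) α) h : L) = star (wordProd R α) h :=
  ((isDilation_maximalCommutingPiece R).star_wordProd α h).symm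

theorem IsCuntzKriegerTuple.isCommutingATuple (hR : IsCuntzKriegerTuple A R) :
    IsCommutingATuple A (maximalCommutingPiece R) where
  contractive := isContractiveTuple_of_sum_le fun x => by
    have := sum_norm_star_sq_le hR.contractive (x : L)
    simpa only [← coe_star_maximalCommutingPiece, Submodule.norm_coe] using this
  comm i j := by
    apply star_injective
    rw [star_mul, star_mul]
    ext x
    simp only [mul_apply_eq_comp, coe_star_maximalCommutingPiece]
    exact star_comm_of_mem x.2 j i
  rel := satisfiesARelations_of_mul_eq_zero fun i j hij => by
    apply star_injective
    rw [star_mul, star_zero]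
    ext x
    simp only [mul_apply_eq_comp, coe_star_maximalCommutingPiece]
    have := congrArg star (hR.aRelations.mul_eq_zero hij)
    rw [star_mul, star_zero] at this
    exact DFunLike.congr_fun this (x : L)

end MaximalCommuting

end CuntzKrieger

/-! ### The part generated by wandering vectors -/

section WanderingVectors

variable {n : ℕ} {A : Matrix (Fin n) (Fin n) ℂ} {L : Type u} [NormedAddCommGroup L]
  [InnerProductSpace ℂ L] [CompleteSpace L] {R : Fin n → L →L[ℂ] L}

/-- The operator `e^α ↦ R^α e` from the full Fock space, for a wandering vector `e`. -/
def wanderingMap (A : Matrix (Fin n) (Fin n) ℂ) (R : Fin n → L →L[ℂ] L) (e : L) :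
    FullFock n →L[ℂ] L :=
  ContinuousLinearMap.adjoint (slice e ∘L poissonKernel A R)

namespace IsCuntzKriegerTuple

variable (hR : IsCuntzKriegerTuple A R) {e : L} (he : ∀ k, star (R k) e = 0)
include hR he

/-- The defect operator fixes `e`, so slicing the Poisson kernel by `e` leaves the plain matrix
coefficients. -/
theorem coord_adjoint_wanderingMap (α : List (Fin n)) (x : L) :
    coord α (ContinuousLinearMap.adjoint (wanderingMap A R e) x) =
      inner ℂ e (star (wordProd R α) x) := by
  have hsa : star (defect R) = defect R := (CFC.sqrt_nonneg _).isSelfAdjoint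
  rw [wanderingMap, ContinuousLinearMap.adjoint_adjoint, ContinuousLinearMap.comp_apply,
    coord_slice_poissonKernel hR.contractive, poissonCoeff_eq hR.aRelations, ← hsa,
    inner_star_right, defect_apply_eq_self hR.contractive he]

theorem wanderingMap_fockBasis (α : List (Fin n)) :
    wanderingMap A R e (fockBasis α) = wordProd R α e := by
  refine ext_inner_left ℂ fun x => ?_
  rw [← ContinuousLinearMap.adjoint_inner_left, ← inner_conj_symm, ← coord_apply,
    hR.coord_adjoint_wanderingMap he, inner_conj_symm, inner_star_left]

theorem adjoint_wanderingMap_wordProd {e' : L} (he' : ∀ k, star (R k) e' = 0) (α : List (Fin n)) :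
    ContinuousLinearMap.adjoint (wanderingMap A R e) (wordProd R α e') =
      open Classical in if IsAWord A α then inner ℂ e e' • fockBasis α else 0 := by
  refine ext_coord fun β => ?_
  rw [hR.coord_adjoint_wanderingMap he, inner_star_right, hR.inner_wordProd_wordProd he' he]
  by_cases hα : IsAWord A α
  · by_cases h : α = β
    · subst h
      simp only [hα, and_self, if_true, map_smul, coord_fockBasis, smul_eq_mul, mul_one]
    · simp [h, hα, coord_fockBasis, Ne.symm h]
  · simp [hα]

theorem inner_star_wordProd_wanderingMap {v : FullFock n} (hv : v ∈ commFock A) {e' : L}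
    (he' : ∀ k, star (R k) e' = 0) (α : List (Fin n)) :
    inner ℂ e' (star (wordProd R α) (wanderingMap A R e v)) = coord α v * inner ℂ e' e := by
  rw [inner_star_right, ← ContinuousLinearMap.adjoint_inner_left,
    hR.adjoint_wanderingMap_wordProd he he']
  by_cases hα : IsAWord A α
  · rw [if_pos hα, inner_smul_left, inner_conj_symm, mul_comm, coord_apply]
  · rw [if_neg hα, inner_zero_left, (mem_commFock_iff.1 hv).2 α fun h => hα h.isAWord, zero_mul]

/-- Vectors of the commuting `A`-Fock space are supported on `A`-words, along which the `R^α e` are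
orthogonal of norm `‖e‖`; hence `Ψ* Ψ = ‖e‖²` there. -/
theorem norm_wanderingMap {v : FullFock n} (hv : v ∈ commFock A) :
    ‖wanderingMap A R e v‖ = ‖v‖ * ‖e‖ := by
  have h1 : ContinuousLinearMap.adjoint (wanderingMap A R e) (wanderingMap A R e v) =
      ((‖e‖ ^ 2 : ℝ) : ℂ) • v := by
    refine ext_coord fun α => ?_
    rw [hR.coord_adjoint_wanderingMap he, hR.inner_star_wordProd_wanderingMap he hv he, map_smul,
      inner_self_eq_norm_sq_to_K, smul_eq_mul, mul_comm]
    push_cast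
    rfl
  have h2 : ‖wanderingMap A R e v‖ ^ 2 = (‖v‖ * ‖e‖) ^ 2 := by
    rw [norm_sq_eq_re_inner, ← ContinuousLinearMap.adjoint_inner_right, h1, inner_smul_right,
      Complex.re_ofReal_mul, ← norm_sq_eq_re_inner]
    ring
  exact (pow_left_inj₀ (norm_nonneg _) (by positivity) two_ne_zero).1 h2

theorem star_wanderingMap {v : FullFock n} (hv : v ∈ commFock A) (i : Fin n) :
    star (R i) (wanderingMap A R e v) = wanderingMap A R e (star (leftCreation i) v) := by
  have h1 := (hasSum_coord v).mapL (star (R i) ∘L wanderingMap A R e)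
  have h2 := (hasSum_coord v).mapL (wanderingMap A R e ∘L star (leftCreation i))
  refine h1.unique (h2.congr_fun fun α => ?_)
  simp only [ContinuousLinearMap.comp_apply, map_smul]
  by_cases hα : IsAWord A α
  · rw [hR.wanderingMap_fockBasis he, ContinuousLinearMap.star_eq_adjoint (leftCreation i)]
    congr 1
    cases α with
    | nil => rw [adjoint_leftCreation_nil, wordProd_nil, one_apply_eq_self, he, map_zero]
    | cons j α =>
      rw [adjoint_leftCreation_cons, wordProd_cons, mul_apply_eq_comp]
      by_cases hij : i = j
      · subst hij
        rw [hR.star_apply_apply_wordProd he hα, if_pos rfl, hR.wanderingMap_fockBasis he]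
      · rw [hR.star_apply_apply_of_ne hij, if_neg hij, map_zero]
  · rw [(mem_commFock_iff.1 hv).2 α fun h => hα h.isAWord, zero_smul, zero_smul]

/-- `R_i*` acts on the image as `L_i*`, and the `L_i*` commute on permutation invariant vectors. -/
theorem wanderingMap_mem {v : FullFock n} (hv : v ∈ commFock A) :
    wanderingMap A R e v ∈ maximalCommutingSubspace R := by
  refine mem_maximalCommutingSubspace_of_comm fun γ i j => ?_
  have h1 : ∀ γ, ∀ v ∈ commFock A, ∃ w ∈ commFock A,
      star (wordProd R γ) (wanderingMap A R e v) = wanderingMap A R e w := by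
    intro γ
    induction γ with
    | nil => exact fun v hv => ⟨v, hv, by simp [wordProd_nil]⟩
    | cons k γ ih =>
      intro v hv
      rw [star_wordProd_cons_apply, hR.star_wanderingMap he hv]
      exact ih _ (adjoint_leftCreation_mem k hv)
  obtain ⟨w, hw, hwe⟩ := h1 γ v hv
  rw [hwe, hR.star_wanderingMap he hw, hR.star_wanderingMap he hw,
    hR.star_wanderingMap he (adjoint_leftCreation_mem j hw),
    hR.star_wanderingMap he (adjoint_leftCreation_mem i hw)]
  congr 1
  refine ext_coord fun α => ?_
  simp only [ContinuousLinearMap.star_eq_adjoint, coord_adjoint_leftCreation]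
  exact (mem_commFock_iff.1 hw).1 _ _ (List.Perm.swap i j α)

/-- On the maximal commuting subspace `(R^α)*` equals `(C^α)*`, which depends on `α` only up to
order and vanishes off symmetric `A`-words. -/
theorem adjoint_wanderingMap_mem {x : L} (hx : x ∈ maximalCommutingSubspace R) :
    ContinuousLinearMap.adjoint (wanderingMap A R e) x ∈ commFock A := by
  have hC := hR.isCommutingATuple
  have h1 : ∀ α, coord α (ContinuousLinearMap.adjoint (wanderingMap A R e) x) =
      inner ℂ e (star (wordProd (maximalCommutingPiece R) α) ⟨x, hx⟩ : L) := by
    intro α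
    rw [hR.coord_adjoint_wanderingMap he, coe_star_wordProd_maximalCommutingPiece]
  rw [mem_commFock_iff]
  refine ⟨fun α β h => by rw [h1, h1, wordProd_perm hC.comm h], fun α hα => ?_⟩
  rw [h1, wordProd_eq_zero_of_not_symmetric hC.rel hC.comm hα]
  simp

/-- The maximal commuting piece acts on the vectors generated by a wandering vector as the creation
operators. -/
theorem maximalCommutingPiece_wanderingMap (v : commFock A) (i : Fin n) :
    (maximalCommutingPiece R i ⟨wanderingMap A R e v, hR.wanderingMap_mem he v.2⟩ : L) =
      wanderingMap A R e (commCreation A i v : commFock A) := by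
  suffices maximalCommutingPiece R i ⟨wanderingMap A R e v, hR.wanderingMap_mem he v.2⟩ =
      ⟨_, hR.wanderingMap_mem he (commCreation A i v).2⟩ by rw [this]
  refine ext_inner_left ℂ fun x => ?_
  have h1 : ContinuousLinearMap.adjoint (wanderingMap A R e) (star (R i) (x : L)) =
      star (leftCreation i) (ContinuousLinearMap.adjoint (wanderingMap A R e) x) := by
    refine ext_coord fun α => ?_
    rw [ContinuousLinearMap.star_eq_adjoint (leftCreation i), coord_adjoint_leftCreation,
      hR.coord_adjoint_wanderingMap he, hR.coord_adjoint_wanderingMap he, star_wordProd_cons_apply]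
  rw [maximalCommutingPiece, inner_compression_right, Submodule.coe_inner, ← inner_star_left,
    ← ContinuousLinearMap.adjoint_inner_left, h1, inner_star_left]
  refine (inner_projection_right (commFock A)
    ⟨_, hR.adjoint_wanderingMap_mem he x.2⟩ (leftCreation i (v : FullFock n))).symm.trans ?_
  exact ContinuousLinearMap.adjoint_inner_left (wanderingMap A R e)
    ((commCreation A i v : commFock A) : FullFock n) (x : L)

theorem wandering_mem : e ∈ maximalCommutingSubspace R := by
  have hv : fockBasis [] ∈ commFock A := by
    rw [mem_commFock_iff]
    refine ⟨fun α β h => ?_, fun α hα => ?_⟩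
    · simp only [coord_fockBasis, h.length_eq, ← List.length_eq_zero_iff]
    · rw [coord_fockBasis, if_neg]
      rintro rfl
      exact hα fun i => i.elim0
  have := hR.wanderingMap_mem he hv
  rwa [hR.wanderingMap_fockBasis he, wordProd_nil, one_apply_eq_self] at this

theorem tendsto_poissonFamily_wanderingMap (v : commFock A) :
    Filter.Tendsto (fun r => poissonFamily A (maximalCommutingPiece R) r
      ⟨wanderingMap A R e v, hR.wanderingMap_mem he v.2⟩) (𝓝[<] 1)
      (𝓝 (simpleTensor v ⟨e, hR.wandering_mem he⟩)) := by
  refine tendsto_poissonFamily_of_wandering hR.isCommutingATuple (fun j => ?_) ?_ fun α => ?_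
  · ext
    rw [coe_star_maximalCommutingPiece]
    exact he j
  · exact hR.norm_wanderingMap he v.2
  · rw [Submodule.coe_inner, coe_star_wordProd_maximalCommutingPiece]
    refine (hR.inner_star_wordProd_wanderingMap he v.2 he α).trans ?_
    rw [inner_self_eq_norm_sq_to_K]
    push_cast
    rfl

theorem asymptoticallyIntertwines_wanderingMap (v : commFock A) (i : Fin n) :
    AsymptoticallyIntertwines (poissonFamily A (maximalCommutingPiece R)) (commCreation A i)
      (maximalCommutingPiece R i) ⟨wanderingMap A R e v, hR.wanderingMap_mem he v.2⟩ := by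
  have h1 := ((ampliation (maximalCommutingSubspace R) (commCreation A i)).continuous.tendsto _).comp
    (hR.tendsto_poissonFamily_wanderingMap he v)
  have h2 := hR.tendsto_poissonFamily_wanderingMap he (commCreation A i v)
  rw [ampliation_simpleTensor] at h1
  have h3 := h1.sub h2
  rw [sub_self] at h3
  have h4 : maximalCommutingPiece R i ⟨wanderingMap A R e v, hR.wanderingMap_mem he v.2⟩ =
      ⟨_, hR.wanderingMap_mem he (commCreation A i v).2⟩ :=
    Subtype.ext (hR.maximalCommutingPiece_wanderingMap he v i)
  rw [AsymptoticallyIntertwines, h4]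
  exact h3

end IsCuntzKriegerTuple

end WanderingVectors

/-! ### Weak operator limits along ultrafilters -/

section WeakLimits

variable {L : Type u} [NormedAddCommGroup L] [InnerProductSpace ℂ L] [CompleteSpace L]

/-- Bounded sequences of operators have weak operator limits along ultrafilters. -/
theorem exists_weak_limit (U : Ultrafilter ℕ) {Y : ℕ → L →L[ℂ] L} {M : ℝ}
    (hY : ∀ m, ‖Y m‖ ≤ M) :
    ∃ X : L →L[ℂ] L, ∀ x y, Filter.Tendsto (fun m => inner ℂ x (Y m y)) U (𝓝 (inner ℂ x (X y))) := by
  have hb : ∀ x y m, ‖inner ℂ (Y m x) y‖ ≤ M * ‖x‖ * ‖y‖ := fun x y m =>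
    (norm_inner_le_norm _ _).trans (mul_le_mul_of_nonneg_right
      (((Y m).le_opNorm x).trans (mul_le_mul_of_nonneg_right (hY m) (norm_nonneg x)))
      (norm_nonneg y))
  -- Each matrix coefficient stays in a compact disc; the limits form a bounded sesquilinear form,
  -- which represents the desired operator.
  have hlim : ∀ x y, ∃ c : ℂ, ‖c‖ ≤ M * ‖x‖ * ‖y‖ ∧
      Filter.Tendsto (fun m => inner ℂ (Y m x) y) U (𝓝 c) := by
    intro x y
    obtain ⟨c, hc, hcU⟩ := (isCompact_closedBall (0 : ℂ) (M * ‖x‖ * ‖y‖)).ultrafilter_le_nhds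
      (U.map fun m => inner ℂ (Y m x) y) (by
        rw [Filter.le_principal_iff]
        exact Filter.mem_map.2 (Filter.univ_mem' fun m => by simpa using hb x y m))
    exact ⟨c, by simpa using hc, hcU⟩
  choose b hb1 hb2 using hlim
  let B : L →L⋆[ℂ] L →L[ℂ] ℂ := LinearMap.mkContinuous₂
    (LinearMap.mk₂'ₛₗ (starRingEnd ℂ) (RingHom.id ℂ) b
      (fun x x' y => tendsto_nhds_unique (hb2 _ _) (((hb2 x y).add (hb2 x' y)).congr fun m => by
        rw [map_add, inner_add_left]))
      (fun c x y => tendsto_nhds_unique (hb2 _ _) (((hb2 x y).const_mul _).congr fun m => by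
        rw [map_smul, inner_smul_left]))
      (fun x y y' => tendsto_nhds_unique (hb2 _ _) (((hb2 x y).add (hb2 x y')).congr fun m => by
        rw [inner_add_right]))
      (fun c x y => tendsto_nhds_unique (hb2 _ _) (((hb2 x y).const_mul _).congr fun m => by
        rw [inner_smul_right]; rfl))) M hb1
  refine ⟨InnerProductSpace.continuousLinearMapOfBilin B, fun x y => ?_⟩
  have h1 : inner ℂ (InnerProductSpace.continuousLinearMapOfBilin B y) x = b y x :=
    InnerProductSpace.continuousLinearMapOfBilin_apply B y x
  have h2 := (Complex.continuous_conj.tendsto _).comp (hb2 y x)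
  rw [← h1, inner_conj_symm] at h2
  exact h2.congr fun m => inner_conj_symm _ _

/-- A weak limit of operators which asymptotically intertwine `P` and `Q` intertwines them. -/
theorem mul_eq_mul_of_weak_limit (U : Ultrafilter ℕ) {Y : ℕ → L →L[ℂ] L} {X P Q : L →L[ℂ] L}
    (hX : ∀ x y, Filter.Tendsto (fun m => inner ℂ x (Y m y)) U (𝓝 (inner ℂ x (X y))))
    (h : Filter.Tendsto (fun m => ‖P * Y m - Y m * Q‖) U (𝓝 0)) : P * X = X * Q := by
  refine ContinuousLinearMap.ext fun y => ext_inner_left ℂ fun x => ?_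
  have h1 := (hX (star P x) y).sub (hX x (Q y))
  have h2 : Filter.Tendsto (fun m => inner ℂ (star P x) (Y m y) - inner ℂ x (Y m (Q y))) U (𝓝 0) := by
    refine squeeze_zero_norm (fun m => ?_) (by simpa using (h.const_mul ‖x‖).mul_const ‖y‖)
    rw [inner_star_left, ← inner_sub_right]
    refine (norm_inner_le_norm _ _).trans ?_
    rw [mul_assoc]
    exact mul_le_mul_of_nonneg_left ((P * Y m - Y m * Q).le_opNorm y) (norm_nonneg x)
  have h3 := tendsto_nhds_unique h1 h2
  rw [inner_star_left] at h3
  exact sub_eq_zero.1 h3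

end WeakLimits

/-! ### The map `Y ↦ ∑ R_j Y R_j*` for Cuntz–Krieger tuples -/

section Harmonic

variable {n : ℕ} {A : Matrix (Fin n) (Fin n) ℂ} {L : Type u} [NormedAddCommGroup L]
  [InnerProductSpace ℂ L] [CompleteSpace L] {R : Fin n → L →L[ℂ] L}

/-- The map `Y ↦ ∑ R_j Y R_j*`. -/
def conjMap (R : Fin n → L →L[ℂ] L) (Y : L →L[ℂ] L) : L →L[ℂ] L := ∑ j, R j * Y * star (R j)

theorem conjMap_apply (Y : L →L[ℂ] L) (x : L) :
    conjMap R Y x = ∑ j, R j (Y (star (R j) x)) := by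
  simp [conjMap, sum_apply]

theorem inner_conjMap (Y : L →L[ℂ] L) (x y : L) :
    inner ℂ x (conjMap R Y y) = ∑ j, inner ℂ (star (R j) x) (Y (star (R j) y)) := by
  rw [conjMap_apply, inner_sum]
  exact Finset.sum_congr rfl fun j _ => (inner_star_left _ _ _).symm

theorem norm_conjMap_le (hR : IsContractiveTuple R) (Y : L →L[ℂ] L) : ‖conjMap R Y‖ ≤ ‖Y‖ := by
  refine ContinuousLinearMap.opNorm_le_bound _ (norm_nonneg Y) fun y => ?_
  have key : ∀ x, ‖inner ℂ x (conjMap R Y y)‖ ≤ ‖Y‖ * ‖y‖ * ‖x‖ := by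
    intro x
    rw [inner_conjMap]
    have h1 : ∑ j, ‖star (R j) x‖ * ‖star (R j) y‖ ≤ ‖x‖ * ‖y‖ := by
      refine (Real.sum_mul_le_sqrt_mul_sqrt _ _ _).trans (mul_le_mul ?_ ?_ (Real.sqrt_nonneg _)
        (norm_nonneg _))
      · exact Real.sqrt_le_iff.2 ⟨norm_nonneg _, sum_norm_star_sq_le hR x⟩
      · exact Real.sqrt_le_iff.2 ⟨norm_nonneg _, sum_norm_star_sq_le hR y⟩
    calc _ ≤ ∑ j, ‖star (R j) x‖ * (‖Y‖ * ‖star (R j) y‖) := by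
          refine (norm_sum_le _ _).trans (Finset.sum_le_sum fun j _ => ?_)
          exact (norm_inner_le_norm _ _).trans
            (mul_le_mul_of_nonneg_left (Y.le_opNorm _) (norm_nonneg _))
      _ = ‖Y‖ * ∑ j, ‖star (R j) x‖ * ‖star (R j) y‖ := by
          rw [Finset.mul_sum]
          exact Finset.sum_congr rfl fun j _ => by ring
      _ ≤ ‖Y‖ * (‖x‖ * ‖y‖) := mul_le_mul_of_nonneg_left h1 (norm_nonneg Y)
      _ = _ := by ring
  have h2 := key (conjMap R Y y)
  rcases (norm_nonneg (conjMap R Y y)).eq_or_lt with h0 | h0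
  · rw [← h0]
    positivity
  · refine le_of_mul_le_mul_right ?_ h0
    refine le_trans (le_of_eq ?_) h2
    rw [inner_self_eq_norm_sq_to_K, norm_pow, sq]
    simp

namespace IsCuntzKriegerTuple

variable (hR : IsCuntzKriegerTuple A R)
include hR

theorem star_mul_conjMap (Y : L →L[ℂ] L) (j : Fin n) :
    star (R j) * conjMap R Y = star (R j) * R j * Y * star (R j) := by
  rw [conjMap, Finset.mul_sum, Finset.sum_eq_single j]
  · simp only [mul_assoc]
  · intro k _ hk
    rw [← mul_assoc, ← mul_assoc, hR.orthogonalRanges j k hk.symm, zero_mul, zero_mul]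
  · simp

theorem conjMap_mul (Y : L →L[ℂ] L) (j : Fin n) :
    conjMap R Y * R j = R j * Y * (star (R j) * R j) := by
  rw [conjMap, Finset.sum_mul, Finset.sum_eq_single j]
  · simp only [mul_assoc]
  · intro k _ hk
    rw [mul_assoc, hR.orthogonalRanges k j hk, mul_zero]
  · simp

/-- By the Cuntz–Krieger relation `R_j* R_j` is a combination of `1` and the range projections `R_k
R_k*`, and orthogonality of the ranges makes each of these commute with the values of `conjMap R`.
-/
theorem commute_star_mul_self (Y : L →L[ℂ] L) (j : Fin n) :
    Commute (star (R j) * R j) (conjMap R Y) := by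
  rw [hR.cuntzKrieger]
  refine (Commute.one_left _).sub_left (Commute.sum_left _ _ _ fun k _ => Commute.smul_left ?_ _)
  have h1 : R k * star (R k) * conjMap R Y = R k * Y * star (R k) := by
    rw [mul_assoc, hR.star_mul_conjMap, ← mul_assoc, ← mul_assoc, ← mul_assoc,
      hR.partialIsometry]
  have h2 : conjMap R Y * (R k * star (R k)) = R k * Y * star (R k) := by
    rw [← mul_assoc, hR.conjMap_mul, mul_assoc, hR.star_mul_mul_star]
  exact h1.trans h2.symm

/-- One application of `conjMap` leaves the factor `R_j* R_j` in front; a second one lets it commute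
through and be absorbed by `R_j*`. Thus passing `R_j*` across lowers the iterate by one. -/
theorem star_mul_conjMap_conjMap (Y : L →L[ℂ] L) (j : Fin n) :
    star (R j) * conjMap R (conjMap R Y) = conjMap R Y * star (R j) := by
  rw [hR.star_mul_conjMap, (hR.commute_star_mul_self Y j).eq, mul_assoc, hR.star_mul_mul_star]

theorem conjMap_conjMap_mul (Y : L →L[ℂ] L) (j : Fin n) :
    conjMap R (conjMap R Y) * R j = R j * conjMap R Y := by
  rw [hR.conjMap_mul, mul_assoc, ← (hR.commute_star_mul_self Y j).eq, ← mul_assoc, ← mul_assoc,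
    hR.partialIsometry]

end IsCuntzKriegerTuple

end Harmonic

/-! ### Averages and telescoping -/

section Averages

variable {L : Type u} [NormedAddCommGroup L] [InnerProductSpace ℂ L] [CompleteSpace L]

/-- The averages `(B_0 + ⋯ + B_m) / (m + 1)`. -/
def average (B : ℕ → L →L[ℂ] L) (m : ℕ) : L →L[ℂ] L :=
  ((m : ℂ) + 1)⁻¹ • ∑ k ∈ Finset.range (m + 1), B k

theorem norm_inv_cast_add_one (m : ℕ) : ‖((m : ℂ) + 1)⁻¹‖ = ((m : ℝ) + 1)⁻¹ := by
  rw [norm_inv]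
  congr 1
  have : ((m : ℂ) + 1) = ((m + 1 : ℕ) : ℂ) := by push_cast; rfl
  rw [this, Complex.norm_natCast]
  push_cast
  rfl

theorem norm_average_le {B : ℕ → L →L[ℂ] L} {M : ℝ} (hB : ∀ k, ‖B k‖ ≤ M) (m : ℕ) :
    ‖average B m‖ ≤ M := by
  have h1 : ‖∑ k ∈ Finset.range (m + 1), B k‖ ≤ (m + 1) * M := by
    refine (norm_sum_le _ _).trans ((Finset.sum_le_sum fun k _ => hB k).trans (le_of_eq ?_))
    simp
  rw [average, norm_smul, norm_inv_cast_add_one, inv_mul_le_iff₀ (by positivity)]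
  exact h1

theorem tendsto_norm_of_telescope {M : ℝ} {Y D : ℕ → L →L[ℂ] L}
    (hY : ∀ m, Y m = ((m : ℂ) + 1)⁻¹ • D m) (hD : ∀ m, ‖D m‖ ≤ M) :
    Filter.Tendsto (fun m => ‖Y m‖) Filter.atTop (𝓝 0) := by
  have h1 : Filter.Tendsto (fun m : ℕ => ((m : ℝ) + 1)⁻¹ * M) Filter.atTop (𝓝 0) := by
    have := (tendsto_one_div_add_atTop_nhds_zero_nat (𝕜 := ℝ)).mul_const M
    simpa using this
  refine squeeze_zero (fun m => norm_nonneg _) (fun m => ?_) h1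
  rw [hY, norm_smul, norm_inv_cast_add_one]
  exact mul_le_mul_of_nonneg_left (hD m) (by positivity)

/-- The shift relation telescopes the commutator to `P (B_0 - B_{m+1}) / (m + 1)`. -/
theorem tendsto_average_of_mul_succ {B : ℕ → L →L[ℂ] L} {M : ℝ} (hB : ∀ k, ‖B k‖ ≤ M)
    {P : L →L[ℂ] L} (h : ∀ k, P * B (k + 1) = B k * P) :
    Filter.Tendsto (fun m => ‖P * average B m - average B m * P‖) Filter.atTop (𝓝 0) := by
  refine tendsto_norm_of_telescope (D := fun m => P * (B 0 - B (m + 1)))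
    (M := ‖P‖ * (M + M)) (fun m => ?_) fun m => ?_
  · rw [average, mul_smul_comm, smul_mul_assoc, ← smul_sub, ← Finset.sum_range_sub' B,
      Finset.sum_mul, ← Finset.sum_congr rfl fun k _ => h k, ← Finset.mul_sum, ← mul_sub,
      ← Finset.sum_sub_distrib]
  · exact (norm_mul_le _ _).trans (mul_le_mul_of_nonneg_left
      ((norm_sub_le _ _).trans (add_le_add (hB _) (hB _))) (norm_nonneg _))

theorem tendsto_average_of_succ_mul {B : ℕ → L →L[ℂ] L} {M : ℝ} (hB : ∀ k, ‖B k‖ ≤ M)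
    {P : L →L[ℂ] L} (h : ∀ k, B (k + 1) * P = P * B k) :
    Filter.Tendsto (fun m => ‖P * average B m - average B m * P‖) Filter.atTop (𝓝 0) := by
  refine tendsto_norm_of_telescope (D := fun m => (B (m + 1) - B 0) * P)
    (M := (M + M) * ‖P‖) (fun m => ?_) fun m => ?_
  · rw [average, mul_smul_comm, smul_mul_assoc, ← smul_sub, ← Finset.sum_range_sub B,
      Finset.mul_sum, ← Finset.sum_congr rfl fun k _ => h k, ← Finset.sum_mul, ← sub_mul,
      ← Finset.sum_sub_distrib]
  · exact (norm_mul_le _ _).trans (mul_le_mul_of_nonneg_right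
      ((norm_sub_le _ _).trans (add_le_add (hB _) (hB _))) (norm_nonneg _))

end Averages

/-! ### Normality on spherical vectors -/

section Normality

variable {n : ℕ} {A : Matrix (Fin n) (Fin n) ℂ} {L : Type u} [NormedAddCommGroup L]
  [InnerProductSpace ℂ L] [CompleteSpace L] {R : Fin n → L →L[ℂ] L}

theorem norm_iterate_conjMap_le (hR : IsContractiveTuple R) (Y : L →L[ℂ] L) (k : ℕ) :
    ‖(conjMap R)^[k] Y‖ ≤ ‖Y‖ := by
  induction k with
  | zero => rfl
  | succ k ih =>
    rw [Function.iterate_succ_apply']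
    exact (norm_conjMap_le hR _).trans ih

theorem commute_conjMap {X Y : L →L[ℂ] L} (h1 : ∀ j, Commute X (R j))
    (h2 : ∀ j, Commute X (star (R j))) (h : Commute X Y) : Commute X (conjMap R Y) :=
  Commute.sum_right _ _ _ fun j _ => ((h1 j).mul_right h).mul_right (h2 j)

theorem commute_iterate_conjMap {X Y : L →L[ℂ] L} (h1 : ∀ j, Commute X (R j))
    (h2 : ∀ j, Commute X (star (R j))) (h : Commute X Y) (k : ℕ) :
    Commute X ((conjMap R)^[k] Y) := by
  induction k with
  | zero => exact h
  | succ k ih =>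
    rw [Function.iterate_succ_apply']
    exact commute_conjMap h1 h2 ih

/-- There is a normal operator which commutes with the tuple and its adjoints and is a weak limit of
averages of the operators obtained from `R_i` by iterating `Y ↦ ∑ R_j Y R_j*`. -/
theorem IsCuntzKriegerTuple.exists_normal (hR : IsCuntzKriegerTuple A R) (i : Fin n) :
    ∃ X : L →L[ℂ] L, (∀ j, Commute X (R j)) ∧ (∀ j, Commute X (star (R j))) ∧
      star X * X = X * star X ∧ ∀ (x y : L) (c : ℂ),
        (∀ k, inner ℂ x ((conjMap R)^[k] (R i) y) = c) → inner ℂ x (X y) = c := by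
  -- The sequence starts at the first iterate, since the shift relations fail in general between
  -- `R_i` itself and its first iterate.
  set B : ℕ → L →L[ℂ] L := fun k => (conjMap R)^[k + 1] (R i) with hBdef
  have hB : ∀ k, ‖B k‖ ≤ ‖R i‖ := fun k => norm_iterate_conjMap_le hR.contractive _ _
  have hU : (Filter.hyperfilter ℕ : Filter ℕ) ≤ Filter.atTop := by
    rw [← Nat.cofinite_eq_atTop]
    exact Filter.hyperfilter_le_cofinite
  obtain ⟨X, hX⟩ := exists_weak_limit (Filter.hyperfilter ℕ) (norm_average_le hB)
  have hXR : ∀ j, Commute X (R j) := fun j =>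
    (mul_eq_mul_of_weak_limit _ hX ((tendsto_average_of_succ_mul hB fun k => by
      simp only [hBdef, Function.iterate_succ_apply']
      exact hR.conjMap_conjMap_mul _ j).mono_left hU)).symm
  have hXR' : ∀ j, Commute X (star (R j)) := fun j =>
    (mul_eq_mul_of_weak_limit _ hX ((tendsto_average_of_mul_succ hB fun k => by
      simp only [hBdef, Function.iterate_succ_apply']
      exact hR.star_mul_conjMap_conjMap _ j).mono_left hU)).symm
  refine ⟨X, hXR, hXR', ?_, fun x y c hc => ?_⟩
  -- `X*` commutes with all `R_j` and `R_j*`, hence with every iterate and every average, hence with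
  -- their weak limit `X`.
  · have h1 : ∀ j, Commute (star X) (R j) := fun j => by
      simpa using (hXR' j).star_star
    have h2 : ∀ j, Commute (star X) (star (R j)) := fun j => (hXR j).star_star
    refine mul_eq_mul_of_weak_limit _ hX ?_
    have h3 : ∀ m, star X * average B m - average B m * star X = 0 := fun m =>
      sub_eq_zero.2 (Commute.smul_right (Commute.sum_right _ _ _ fun k _ =>
        commute_iterate_conjMap h1 h2 (h1 i) (k + 1)) _).eq
    simp only [h3, norm_zero]
    exact tendsto_const_nhds
  · refine tendsto_nhds_unique (hX x y) (tendsto_const_nhds.congr fun m => ?_)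
    rw [average, smul_apply, sum_apply, inner_smul_right, inner_sum,
      Finset.sum_congr rfl fun k _ => hc (k + 1), Finset.sum_const, Finset.card_range,
      nsmul_eq_mul, ← mul_assoc, Nat.cast_add_one, inv_mul_cancel₀ (Nat.cast_add_one_ne_zero m),
      one_mul]

theorem star_wordProd_apply_of_commute {X : L →L[ℂ] L} (hX : ∀ j, Commute X (star (R j)))
    (γ : List (Fin n)) (x : L) :
    star (wordProd R γ) (X x) = X (star (wordProd R γ) x) := by
  induction γ generalizing x with
  | nil => simp [wordProd_nil]
  | cons j γ ih =>
    rw [star_wordProd_cons_apply, star_wordProd_cons_apply, ← ih]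
    exact congrArg _ (DFunLike.congr_fun (hX j) x).symm

theorem apply_mem_maximalCommutingSubspace {X : L →L[ℂ] L} (hX : ∀ j, Commute X (star (R j))) {x : L}
    (hx : x ∈ maximalCommutingSubspace R) : X x ∈ maximalCommutingSubspace R := by
  have h1 : ∀ j y, star (R j) (X y) = X (star (R j) y) := fun j y =>
    (DFunLike.congr_fun (hX j) y).symm
  have h2 : ∀ γ, star (wordProd R γ) x ∈ maximalCommutingSubspace R := by
    intro γ
    have := coe_star_wordProd_maximalCommutingPiece γ ⟨x, hx⟩
    rw [← this]
    exact Subtype.coe_prop _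
  refine mem_maximalCommutingSubspace_of_comm fun γ i j => ?_
  rw [star_wordProd_apply_of_commute hX, h1, h1, h1, h1, star_comm_of_mem (h2 γ)]

section Spherical

variable {h : L} (hsph : ∀ α, ∑ j, R j (star (R j) (star (wordProd R α) h)) =
  star (wordProd R α) h)
include hsph

theorem spherical_star (j : Fin n) (α : List (Fin n)) :
    ∑ k, R k (star (R k) (star (wordProd R α) (star (R j) h))) =
      star (wordProd R α) (star (R j) h) := by
  simpa only [star_wordProd_cons_apply] using hsph (j :: α)

/-- Each iteration moves some `R_j*` onto both vectors. Commutativity on `x` puts `R_i*` innermost,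
and sphericality of `h` sums the remaining `R_j R_j*` to the identity. -/
theorem inner_iterate_conjMap_right (i : Fin n) (k : ℕ) {x : L}
    (hx : x ∈ maximalCommutingSubspace R) :
    inner ℂ x ((conjMap R)^[k] (R i) h) = inner ℂ (star (R i) x) h := by
  induction k generalizing x h with
  | zero => exact (inner_star_left _ _ _).symm
  | succ k ih =>
    rw [Function.iterate_succ_apply', inner_conjMap, Finset.sum_congr rfl fun j _ =>
      ih (spherical_star hsph j) (star_mem_maximalCommutingSubspace hx j)]
    have h0 := hsph []
    simp only [wordProd_nil, star_one, one_apply_eq_self] at h0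
    conv_rhs => rw [← h0, inner_sum]
    refine Finset.sum_congr rfl fun j _ => ?_
    rw [star_comm_of_mem hx, inner_star_left]

/-- Here `h` supplies both commutativity and sphericality, the latter at `R_i* h`, so `x` may be
arbitrary. This gives `X* h`, where the previous lemma gives `X h`. -/
theorem inner_iterate_conjMap_left (i : Fin n) (k : ℕ) (hh : h ∈ maximalCommutingSubspace R) (x : L) :
    inner ℂ h ((conjMap R)^[k] (R i) x) = inner ℂ (star (R i) h) x := by
  induction k generalizing x h with
  | zero => exact (inner_star_left _ _ _).symm
  | succ k ih =>
    rw [Function.iterate_succ_apply', inner_conjMap, Finset.sum_congr rfl fun j _ =>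
      ih (spherical_star hsph j) (star_mem_maximalCommutingSubspace hh j) _]
    simp only [star_comm_of_mem hh i, inner_star_right]
    rw [← sum_inner]
    have := hsph [i]
    simp only [star_wordProd_cons_apply, wordProd_nil, star_one, one_apply_eq_self] at this
    rw [this]

/-- On vectors on which the tuple acts spherically, the maximal commuting piece is normal. -/
theorem IsCuntzKriegerTuple.norm_star_maximalCommutingPiece (hR : IsCuntzKriegerTuple A R)
    (hh : h ∈ maximalCommutingSubspace R) (i : Fin n) :
    ‖star (maximalCommutingPiece R i) ⟨h, hh⟩‖ = ‖maximalCommutingPiece R i ⟨h, hh⟩‖ := by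
  obtain ⟨X, hX1, hX2, hX3, hX4⟩ := hR.exists_normal i
  have hm : X h ∈ maximalCommutingSubspace R := apply_mem_maximalCommutingSubspace hX2 hh
  have hm' : star X h ∈ maximalCommutingSubspace R :=
    apply_mem_maximalCommutingSubspace (fun j => (hX1 j).star_star) hh
  have h1 : maximalCommutingPiece R i ⟨h, hh⟩ = ⟨X h, hm⟩ := by
    refine ext_inner_left ℂ fun x => ?_
    rw [maximalCommutingPiece, inner_compression_right, Submodule.coe_inner, ← inner_star_left]
    exact (hX4 x h _ fun k => inner_iterate_conjMap_right hsph i k x.2).symm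
  have h2 : star (maximalCommutingPiece R i) ⟨h, hh⟩ = ⟨star X h, hm'⟩ := by
    refine ext_inner_right ℂ fun x => ?_
    rw [Submodule.coe_inner, Submodule.coe_inner, coe_star_maximalCommutingPiece,
      inner_star_left X]
    exact ((hX4 h x _ fun k => inner_iterate_conjMap_left hsph i k hh x)).symm
  rw [h1, h2, Submodule.coe_norm, Submodule.coe_norm]
  have h3 : ‖star X h‖ ^ 2 = ‖X h‖ ^ 2 := by
    rw [norm_sq_eq_re_inner, norm_sq_eq_re_inner, inner_star_left, ← inner_star_right]
    have := DFunLike.congr_fun hX3 h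
    simp only [mul_apply_eq_comp] at this
    rw [this]
  exact (pow_left_inj₀ (norm_nonneg _) (norm_nonneg _) two_ne_zero).1 h3

end Spherical

end Normality

/-! ### Asymptotic intertwining for the maximal commuting piece -/

section Intertwining

variable {n : ℕ} {A : Matrix (Fin n) (Fin n) ℂ} {L : Type u} [NormedAddCommGroup L]
  [InnerProductSpace ℂ L] [CompleteSpace L] {R : Fin n → L →L[ℂ] L}

/-- The vectors at which the asymptotic intertwining relation holds form a closed subspace. -/
def intertwiningSubspace {G : Type v} [NormedAddCommGroup G] [InnerProductSpace ℂ G]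
    {N : Type u} [NormedAddCommGroup N] [InnerProductSpace ℂ N]
    (K : ℝ → N →L[ℂ] HilbertTensor G N) (X : G →L[ℂ] G) (Y : N →L[ℂ] N) : Submodule ℂ N where
  carrier := {h | AsymptoticallyIntertwines K X Y h}
  add_mem' h1 h2 := h1.vec_add h2
  zero_mem' := by simp [AsymptoticallyIntertwines]
  smul_mem' c _ h := h.vec_smul c

theorem isClosed_intertwiningSubspace {G : Type v} [NormedAddCommGroup G] [InnerProductSpace ℂ G]
    {N : Type u} [NormedAddCommGroup N] [InnerProductSpace ℂ N]
    {K : ℝ → N →L[ℂ] HilbertTensor G N} (hK : ∀ r, 0 ≤ r → r < 1 → ∀ h, ‖K r h‖ = ‖h‖)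
    (X : G →L[ℂ] G) (Y : N →L[ℂ] N) :
    IsClosed (intertwiningSubspace K X Y : Set N) := by
  refine isClosed_of_closure_subset fun h hh => AsymptoticallyIntertwines.of_approx hK fun ε hε => ?_
  obtain ⟨k, hk, hkε⟩ := Metric.mem_closure_iff.1 hh ε hε
  refine ⟨X, Y, k, hk, ?_, ?_, ?_⟩
  · rw [sub_self, norm_zero]; exact hε.le
  · rw [sub_self, norm_zero]; exact hε.le
  · rw [← dist_eq_norm]; exact hkε.le

namespace IsCuntzKriegerTuple

variable (hR : IsCuntzKriegerTuple A R)
include hR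

/-- A vector of the maximal commuting subspace that is orthogonal to everything generated by wandering
vectors is spherical. -/
theorem spherical_of_forall_inner_eq_zero {h : L} (hh : h ∈ maximalCommutingSubspace R)
    (horth : ∀ (e : L) (_ : ∀ k, star (R k) e = 0) (v : commFock A),
      inner ℂ (wanderingMap A R e v) h = 0) (α : List (Fin n)) :
    ∑ j, R j (star (R j) (star (wordProd R α) h)) = star (wordProd R α) h := by
  set y := star (wordProd R α) h with hy
  -- This is the wandering part of `y`. Orthogonality of `h` kills the adjoint wandering map of `e`
  -- at `h`, whose coordinate at `α` is `⟪e, y⟫`; thus `e` is orthogonal to `y`, and so to itself.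
  set e := y - ∑ j, R j (star (R j) y) with he
  have he0 : ∀ k, star (R k) e = 0 := fun k => hR.star_apply_sub_eq_zero k y
  have h1 : ContinuousLinearMap.adjoint (wanderingMap A R e) h = 0 := by
    have hm := hR.adjoint_wanderingMap_mem he0 hh
    have := horth e he0 ⟨_, hm⟩
    rw [← ContinuousLinearMap.adjoint_inner_right] at this
    exact inner_self_eq_zero.1 this
  have h2 : inner ℂ e y = 0 := by
    rw [hy, ← hR.coord_adjoint_wanderingMap he0, h1, map_zero]
  have h3 : inner ℂ e (∑ j, R j (star (R j) y)) = 0 := by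
    rw [inner_sum]
    exact Finset.sum_eq_zero fun j _ => by rw [← inner_star_left, he0, inner_zero_left]
  have h4 : inner ℂ e e = 0 := by
    conv_lhs => rw [he, ← he]
    have : inner ℂ e (y - ∑ j, R j (star (R j) y)) = 0 := by rw [inner_sub_right, h2, h3, sub_zero]
    exact this
  exact (sub_eq_zero.1 (inner_self_eq_zero.1 h4)).symm

theorem asymptoticallyIntertwines_of_forall_inner_eq_zero (i : Fin n)
    (h : maximalCommutingSubspace R)
    (horth : ∀ (e : L) (_ : ∀ k, star (R k) e = 0) (v : commFock A),
      inner ℂ (wanderingMap A R e v) (h : L) = 0) :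
    AsymptoticallyIntertwines (poissonFamily A (maximalCommutingPiece R)) (commCreation A i)
      (maximalCommutingPiece R i) h := by
  have hs := hR.spherical_of_forall_inner_eq_zero h.2 horth
  refine asymptoticallyIntertwines_of_spherical hR.isCommutingATuple i (fun β => ?_)
    (hR.norm_star_maximalCommutingPiece hs h.2 i).le
  have h1 := hR.norm_sub_sum_sq (star (wordProd R β) (h : L))
  rw [hs β, sub_self, norm_zero] at h1
  simp only [← coe_star_maximalCommutingPiece, ← coe_star_wordProd_maximalCommutingPiece,
    Submodule.coe_norm] at h1 ⊢
  linarith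

/-- The Poisson kernels of the maximal commuting piece of a Cuntz-Krieger tuple asymptotically
intertwine it with the creation operators. -/
theorem asymptoticallyIntertwines (i : Fin n) (h : maximalCommutingSubspace R) :
    AsymptoticallyIntertwines (poissonFamily A (maximalCommutingPiece R)) (commCreation A i)
      (maximalCommutingPiece R i) h := by
  have hC := hR.isCommutingATuple
  set Z := intertwiningSubspace (poissonFamily A (maximalCommutingPiece R)) (commCreation A i)
    (maximalCommutingPiece R i) with hZ
  have hZc : IsClosed (Z : Set (maximalCommutingSubspace R)) :=
    isClosed_intertwiningSubspace (fun r h0 h1 => norm_poissonFamily hC r h0 h1) _ _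
  have : CompleteSpace Z := hZc.completeSpace_coe
  -- `Z` contains all vectors generated by wandering vectors, so whatever is orthogonal to `Z` is
  -- spherical and belongs to `Z` after all; thus `Z` is everything.
  have h1 : Zᗮ ≤ Z := by
    intro k hk
    refine hR.asymptoticallyIntertwines_of_forall_inner_eq_zero i k fun e he v => ?_
    exact (Submodule.mem_orthogonal Z k).1 hk
      ⟨_, hR.wanderingMap_mem he v.2⟩ (hR.asymptoticallyIntertwines_wanderingMap he v i)
  have h2 : h ∈ Z ⊔ Zᗮ := by
    rw [Submodule.sup_orthogonal_of_hasOrthogonalProjection]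
    trivial
  exact sup_le le_rfl h1 h2

/-- The maximal commuting piece of a Cuntz-Krieger tuple is the image of the tuple of creation
operators under a representation, which is the limit of the Poisson transforms. -/
theorem exists_representation_maximalCommutingPiece :
    ∃ π : creationAlgebra A →⋆ₐ[ℂ]
        (maximalCommutingSubspace R →L[ℂ] maximalCommutingSubspace R),
      (∀ (X : creationAlgebra A) h, AsymptoticallyIntertwines
        (poissonFamily A (maximalCommutingPiece R)) ↑X (π X) h) ∧
      ∀ i, π ⟨commCreation A i, commCreation_mem A i⟩ = maximalCommutingPiece R i :=
  exists_representation (fun r h0 h1 => norm_poissonFamily hR.isCommutingATuple r h0 h1)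
    hR.asymptoticallyIntertwines
    (asymptoticallyIntertwines_star_commCreation hR.isCommutingATuple)

end IsCuntzKriegerTuple

end Intertwining

/-! ### Uniqueness of minimal Stinespring dilations -/

section Stinespring

variable {H : Type u} [NormedAddCommGroup H] [InnerProductSpace ℂ H] [CompleteSpace H]
  {M : Type v} [NormedAddCommGroup M] [InnerProductSpace ℂ M] [CompleteSpace M]
  {M' : Type w} [NormedAddCommGroup M'] [InnerProductSpace ℂ M'] [CompleteSpace M']
  {B : Type*} [Ring B] [StarRing B] [Algebra ℂ B]
  {φ : B →ₗ[ℂ] (H →L[ℂ] H)} {π : B →⋆ₐ[ℂ] (M →L[ℂ] M)} {V : H →ₗᵢ[ℂ] M}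
  {π' : B →⋆ₐ[ℂ] (M' →L[ℂ] M')} {V' : H →ₗᵢ[ℂ] M'}

/-- The Gram matrix of the generating vectors depends on `φ` alone, which is the whole reason for
uniqueness. -/
theorem IsMinimalStinespring.inner_apply_apply (h : IsMinimalStinespring φ π V) (X Y : B) (a b : H) :
    inner ℂ (π X (V a)) (π Y (V b)) = inner ℂ a (φ (star X * Y) b) := by
  rw [h.dilation, ContinuousLinearMap.comp_apply, ContinuousLinearMap.adjoint_inner_right, map_mul,
    map_star]
  exact (inner_star_right (π X) (V a) (π Y (V b))).symm

theorem IsMinimalStinespring.span_range_eq_top (h : IsMinimalStinespring φ π V) :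
    (Submodule.span ℂ (Set.range fun p : B × H => π p.1 (V p.2))).topologicalClosure = ⊤ := by
  rw [← h.minimal]
  congr 2
  ext x
  simp [eq_comm]

/-- Minimal Stinespring dilations are unique up to unitary equivalence. -/
theorem IsMinimalStinespring.exists_unitary (h : IsMinimalStinespring φ π V)
    (h' : IsMinimalStinespring φ π' V') :
    ∃ U : M ≃ₗᵢ[ℂ] M', (∀ X x, U (π X x) = π' X (U x)) ∧ ∀ a, U (V a) = V' a := by
  obtain ⟨U, hU⟩ := exists_unitary_of_inner_eq (fun p : B × H => π p.1 (V p.2))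
    (fun p : B × H => π' p.1 (V' p.2)) h.span_range_eq_top h'.span_range_eq_top fun p q => by
      rw [h.inner_apply_apply, h'.inner_apply_apply]
  refine ⟨U, fun X x => ?_, fun a => by simpa using hU (1, a)⟩
  let E : Submodule ℂ M := (((U.toContinuousLinearEquiv : M →L[ℂ] M') ∘L π X) -
    (π' X ∘L (U.toContinuousLinearEquiv : M →L[ℂ] M'))).ker
  have hE : (Submodule.span ℂ (Set.range fun p : B × H => π p.1 (V p.2))).topologicalClosure ≤ E := by
    refine Submodule.topologicalClosure_minimal _ (Submodule.span_le.2 ?_)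
      (ContinuousLinearMap.isClosed_ker _)
    rintro _ ⟨p, rfl⟩
    have h1 := hU (X * p.1, p.2)
    have h2 := hU p
    simp only [map_mul, mul_apply_eq_comp] at h1 h2
    simp [E, h1, h2]
  have hx : x ∈ E := hE (h.span_range_eq_top ▸ Submodule.mem_top)
  simpa [E, sub_eq_zero] using hx

end Stinespring

/-! ### The maximal commuting piece as a standard commuting dilation -/

section StandardDilation

variable {n : ℕ} {A : Matrix (Fin n) (Fin n) ℂ} {H : Type u} [NormedAddCommGroup H]
  [InnerProductSpace ℂ H] [CompleteSpace H] {L : Type v} [NormedAddCommGroup L]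
  [InnerProductSpace ℂ L] [CompleteSpace L] {T : Fin n → H →L[ℂ] H} {R : Fin n → L →L[ℂ] L}
  {J : H →ₗᵢ[ℂ] L}

theorem IsMinimalCuntzKriegerDilation.isCuntzKriegerTuple
    (h : IsMinimalCuntzKriegerDilation A T R J) : IsCuntzKriegerTuple A R :=
  ⟨h.partialIsometry, h.orthogonalRanges, h.aRelations, h.cuntzKrieger⟩

theorem IsPoissonMap.unique {φ ψ : creationAlgebra A →ₗ[ℂ] (H →L[ℂ] H)} (hφ : IsPoissonMap A T φ)
    (hψ : IsPoissonMap A T ψ) : φ = ψ :=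
  LinearMap.ext fun X => ContinuousLinearMap.ext fun h => tendsto_nhds_unique (hφ X h) (hψ X h)

theorem IsDilation.mem_maximalCommutingSubspace (hJ : IsDilation T R J)
    (hT : ∀ i j, T i * T j = T j * T i) (h : H) : J h ∈ maximalCommutingSubspace R := by
  refine mem_maximalCommutingSubspace_of_comm fun γ i j => ?_
  rw [hJ.star_wordProd, hJ, hJ, hJ, hJ]
  have := DFunLike.congr_fun (congrArg star (hT j i)) (star (wordProd T γ) h)
  rw [star_mul, star_mul, mul_apply_eq_comp, mul_apply_eq_comp] at this
  rw [this]

/-- The embedding of the space of a commuting tuple into the maximal commuting subspace of a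
dilation. -/
def commutingEmbedding (hJ : IsDilation T R J) (hT : ∀ i j, T i * T j = T j * T i) :
    H →ₗᵢ[ℂ] maximalCommutingSubspace R where
  toLinearMap := J.toLinearMap.codRestrict _ (hJ.mem_maximalCommutingSubspace hT)
  norm_map' h := J.norm_map h

theorem coe_commutingEmbedding (hJ : IsDilation T R J) (hT : ∀ i j, T i * T j = T j * T i) (h : H) :
    (commutingEmbedding hJ hT h : L) = J h := rfl

theorem isDilation_commutingEmbedding (hJ : IsDilation T R J)
    (hT : ∀ i j, T i * T j = T j * T i) :
    IsDilation T (maximalCommutingPiece R) (commutingEmbedding hJ hT) := by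
  intro i h
  apply Subtype.ext
  rw [coe_star_maximalCommutingPiece, coe_commutingEmbedding, coe_commutingEmbedding]
  exact hJ i h

theorem mem_range_wordProd {N : Type*} [NormedAddCommGroup N] [InnerProductSpace ℂ N]
    [CompleteSpace N] {C : Fin n → N →L[ℂ] N} {π : creationAlgebra A →⋆ₐ[ℂ] (N →L[ℂ] N)}
    (hπ : ∀ i, π ⟨commCreation A i, commCreation_mem A i⟩ = C i) (α : List (Fin n)) :
    ∃ X, π X = wordProd C α := by
  induction α with
  | nil => exact ⟨1, by rw [map_one, wordProd_nil]⟩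
  | cons i α ih =>
    obtain ⟨X, hX⟩ := ih
    exact ⟨⟨commCreation A i, commCreation_mem A i⟩ * X, by rw [map_mul, hπ, hX, wordProd_cons]⟩

/-- The maximal commuting piece of a minimal Cuntz-Krieger dilation is a standard commuting
dilation. -/
theorem IsMinimalCuntzKriegerDilation.exists_isMinimalStinespring
    (hR : IsMinimalCuntzKriegerDilation A T R J) (hT : IsCommutingATuple A T) :
    ∃ (φ : creationAlgebra A →ₗ[ℂ] (H →L[ℂ] H)) (π : creationAlgebra A →⋆ₐ[ℂ]
        (maximalCommutingSubspace R →L[ℂ] maximalCommutingSubspace R)),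
      IsPoissonMap A T φ ∧
      IsMinimalStinespring φ π (commutingEmbedding hR.dilation hT.comm) ∧
      ∀ i, maximalCommutingPiece R i = π ⟨commCreation A i, commCreation_mem A i⟩ := by
  have hCK := hR.isCuntzKriegerTuple
  have hC := hCK.isCommutingATuple
  set V := commutingEmbedding hR.dilation hT.comm with hV
  have hVd : IsDilation T (maximalCommutingPiece R) V := isDilation_commutingEmbedding _ _
  obtain ⟨π, hπ1, hπ2⟩ := hCK.exists_representation_maximalCommutingPiece
  let φ : creationAlgebra A →ₗ[ℂ] (H →L[ℂ] H) :=
    { toFun := fun X => ContinuousLinearMap.adjoint V.toContinuousLinearMap ∘L π X ∘L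
        V.toContinuousLinearMap
      map_add' := fun X Y => by ext h; simp
      map_smul' := fun c X => by ext h; simp }
  refine ⟨φ, π, fun X h => ?_, ⟨fun X => rfl, ?_⟩, fun i => (hπ2 i).symm⟩
  · have h1 := (hπ1 X (V h)).tendsto_poissonTransform hC
    have h2 := ((ContinuousLinearMap.adjoint V.toContinuousLinearMap).continuous.tendsto _).comp h1
    refine h2.congr' (eventually_mem_Ico.mono fun r hr => ?_)
    refine ext_inner_left ℂ fun a => ?_
    rw [Function.comp_apply, ContinuousLinearMap.adjoint_inner_right]
    exact hVd.inner_poissonTransform hT hC hr.1 hr.2.le _ a h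
  · rw [Submodule.topologicalClosure_eq_top_iff, Submodule.eq_bot_iff]
    intro z hz
    -- As `z` lies in the maximal commuting subspace, `(R^α)* z = (C^α)* z`. So orthogonality to the
    -- vectors `C^α h`, which come from the representation, is orthogonality to all `R^α h`.
    have h1 : ∀ α h, inner ℂ (z : L) (wordProd R α (J h)) = 0 := by
      intro α h
      obtain ⟨X, hX⟩ := mem_range_wordProd hπ2 α
      have h2 := (Submodule.mem_orthogonal' _ z).1 hz _ (Submodule.subset_span ⟨X, h, rfl⟩)
      rw [hX, ← inner_star_left, Submodule.coe_inner, coe_star_wordProd_maximalCommutingPiece] at h2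
      rw [← inner_star_left]
      exact h2
    have h3 := hR.minimal
    rw [IsMinimalDilation, Submodule.topologicalClosure_eq_top_iff, Submodule.eq_bot_iff] at h3
    refine Subtype.ext (h3 z ?_)
    rw [Submodule.mem_orthogonal']
    intro u hu
    induction hu using Submodule.span_induction with
    | mem x hx => obtain ⟨α, h, rfl⟩ := hx; exact h1 α h
    | zero => exact inner_zero_right _
    | add x y _ _ hx hy => rw [inner_add_right, hx, hy, add_zero]
    | smul c x _ hx => rw [inner_smul_right, hx, mul_zero]

theorem IsMinimalCuntzKriegerDilation.exists_unitary
    (hR : IsMinimalCuntzKriegerDilation A T R J) (hT : IsCommutingATuple A T)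
    {M : Type w} [NormedAddCommGroup M] [InnerProductSpace ℂ M] [CompleteSpace M]
    {Wd : Fin n → M →L[ℂ] M} {V : H →ₗᵢ[ℂ] M} (hW : IsStandardCommutingADilation A T Wd V) :
    ∃ (hJ : ∀ h, J h ∈ maximalCommutingSubspace R) (U : maximalCommutingSubspace R ≃ₗᵢ[ℂ] M),
      (∀ i x, U (maximalCommutingPiece R i x) = Wd i (U x)) ∧ ∀ h, U ⟨J h, hJ h⟩ = V h := by
  obtain ⟨φ, π, hφ, hπ, hπ'⟩ := hR.exists_isMinimalStinespring hT
  obtain ⟨ψ, ρ, hψ, hρ, hρ'⟩ := hW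
  rw [hψ.unique hφ] at hρ
  obtain ⟨U, hU1, hU2⟩ := hπ.exists_unitary hρ
  refine ⟨hR.dilation.mem_maximalCommutingSubspace hT.comm, U, fun i x => ?_, hU2⟩
  rw [hπ', hρ']
  exact hU1 _ x

end StandardDilation

/-! ### Defect operators of contractions -/

section Defect

variable {E : Type u} [NormedAddCommGroup E] [InnerProductSpace ℂ E] [CompleteSpace E]
  {H : Type v} [NormedAddCommGroup H] [InnerProductSpace ℂ H] [CompleteSpace H]

/-- Every contraction has a defect operator. -/
theorem exists_defect (X : E →L[ℂ] H) (hX : ∀ x, ‖X x‖ ≤ ‖x‖) :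
    ∃ D : E →L[ℂ] E, ∀ x y, inner ℂ (X x) (X y) + inner ℂ (D x) (D y) = inner ℂ x y := by
  have h1 : ∀ x y, inner ℂ x ((1 - ContinuousLinearMap.adjoint X ∘L X) y) =
      inner ℂ x y - inner ℂ (X x) (X y) := by
    intro x y
    rw [sub_apply, inner_sub_right, one_apply_eq_self, ContinuousLinearMap.comp_apply,
      ContinuousLinearMap.adjoint_inner_right]
  have hpos : 0 ≤ 1 - ContinuousLinearMap.adjoint X ∘L X := by
    rw [ContinuousLinearMap.nonneg_iff_isPositive, ContinuousLinearMap.isPositive_iff_complex]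
    intro x
    have h2 : inner ℂ ((1 - ContinuousLinearMap.adjoint X ∘L X) x) x =
        ((‖x‖ ^ 2 - ‖X x‖ ^ 2 : ℝ) : ℂ) := by
      rw [← inner_conj_symm, h1]
      simp only [inner_self_eq_norm_sq_to_K]
      simp
    rw [h2]
    refine ⟨by rw [RCLike.re_to_complex, Complex.ofReal_re], ?_⟩
    rw [RCLike.re_to_complex, Complex.ofReal_re]
    exact sub_nonneg.2 (pow_le_pow_left₀ (norm_nonneg _) (hX x) 2)
  refine ⟨CFC.sqrt (1 - ContinuousLinearMap.adjoint X ∘L X), fun x y => ?_⟩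
  rw [← inner_star_right, (CFC.sqrt_nonneg _).isSelfAdjoint.star_eq, ← mul_apply_eq_comp,
    CFC.sqrt_mul_sqrt_self _ hpos, h1]
  ring

end Defect

/-! ### Dilation of row contractions to isometries with orthogonal ranges -/

section IsometricDilation

variable {n : ℕ} {H : Type u} [NormedAddCommGroup H] [InnerProductSpace ℂ H] [CompleteSpace H]

theorem norm_sum_apply_le {T : Fin n → H →L[ℂ] H} (hT : IsContractiveTuple T)
    (x : PiLp 2 fun _ : Fin n => H) : ‖∑ i, T i (x i)‖ ≤ ‖x‖ := by
  set z := ∑ i, T i (x i) with hz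
  have h1 : ‖z‖ * ‖z‖ ≤ ‖x‖ * ‖z‖ := by
    have h2 : inner ℂ z z = ∑ i, inner ℂ (star (T i) z) (x i) := by
      conv_lhs => enter [3]; rw [hz]
      rw [inner_sum]
      exact Finset.sum_congr rfl fun i _ => (inner_star_left _ _ _).symm
    have h3 : ‖z‖ * ‖z‖ = ‖∑ i, inner ℂ (star (T i) z) (x i)‖ := by
      rw [← h2, inner_self_eq_norm_sq_to_K, norm_pow, sq]
      simp
    rw [h3]
    refine (norm_sum_le _ _).trans ((Finset.sum_le_sum fun i _ =>
      (norm_inner_le_norm _ _).trans (le_of_eq (mul_comm _ _))).trans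
        ((Real.sum_mul_le_sqrt_mul_sqrt _ _ _).trans
          (mul_le_mul ?_ ?_ (Real.sqrt_nonneg _) (norm_nonneg _))))
    · exact Real.sqrt_le_iff.2 ⟨norm_nonneg _, (PiLp.norm_sq_eq_of_L2 _ x).symm.le⟩
    · exact Real.sqrt_le_iff.2 ⟨norm_nonneg _, sum_norm_star_sq_le hT z⟩
  rcases (norm_nonneg z).eq_or_lt with h0 | h0
  · rw [← h0]
    positivity
  · exact le_of_mul_le_mul_right h1 h0

/-- The defect operator of a row contraction, column by column. -/
theorem exists_column_defect {T : Fin n → H →L[ℂ] H} (hT : IsContractiveTuple T) :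
    ∃ D : Fin n → H →L[ℂ] PiLp 2 fun _ : Fin n => H, ∀ i j h k,
      inner ℂ (T i h) (T j k) + inner ℂ (D i h) (D j k) = if i = j then inner ℂ h k else 0 := by
  let row : (PiLp 2 fun _ : Fin n => H) →L[ℂ] H := ∑ i, T i ∘L PiLp.proj 2 (fun _ => H) i
  have hrow : ∀ x, row x = ∑ i, T i (x i) := fun x => by simp [row, sum_apply]
  obtain ⟨D, hD⟩ := exists_defect row fun x => by
    rw [hrow]
    exact norm_sum_apply_le hT x
  let ι : Fin n → H →L[ℂ] PiLp 2 fun _ : Fin n => H := fun i =>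
    ((PiLp.continuousLinearEquiv 2 ℂ fun _ : Fin n => H).symm :
      (Fin n → H) →L[ℂ] PiLp 2 fun _ : Fin n => H) ∘L ContinuousLinearMap.single ℂ (fun _ => H) i
  have hι : ∀ i h j, ι i h j = if j = i then h else 0 := fun i h j => by
    simp [ι]
  have hrι : ∀ i h, row (ι i h) = T i h := fun i h => by
    rw [hrow, Finset.sum_eq_single i]
    · rw [hι, if_pos rfl]
    · intro j _ hj
      rw [hι, if_neg hj, map_zero]
    · simp
  refine ⟨fun i => D ∘L ι i, fun i j h k => ?_⟩
  have := hD (ι i h) (ι j k)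
  rw [hrι, hrι] at this
  refine this.trans ?_
  rw [PiLp.inner_apply, Finset.sum_eq_single i]
  · rw [hι, hι, if_pos rfl]
    split_ifs
    · rfl
    · exact inner_zero_right _
  · intro l _ hl
    rw [hι, if_neg hl, inner_zero_left]
  · simp

/-- Row contractions have dilations consisting of isometries with orthogonal ranges. -/
theorem exists_isometric_dilation {T : Fin n → H →L[ℂ] H} (hT : IsContractiveTuple T) :
    ∃ (K : Type u) (_ : NormedAddCommGroup K) (_ : InnerProductSpace ℂ K) (_ : CompleteSpace K)
      (V : Fin n → K →L[ℂ] K) (J : H →ₗᵢ[ℂ] K),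
      IsDilation T V J ∧ ∀ i j x, star (V i) (V j x) = if i = j then x else 0 := by
  obtain ⟨D, hD⟩ := exists_column_defect hT
  let E := PiLp 2 fun _ : Fin n => H
  let F := HilbertTensor (FullFock n) E
  let K := WithLp 2 (H × F)
  let S : Fin n → F →L[ℂ] F := fun i => ampliation E (leftCreation i)
  have hS : ∀ i j (f g : F), inner ℂ (S i f) (S j g) = if i = j then inner ℂ f g else 0 := by
    intro i j f g
    have h1 : ContinuousLinearMap.adjoint (leftCreation i) ∘L leftCreation j =
        if i = j then (1 : FullFock n →L[ℂ] FullFock n) else 0 := by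
      refine ContinuousLinearMap.ext fun v => ext_coord fun α => ?_
      rw [ContinuousLinearMap.comp_apply, coord_adjoint_leftCreation, coord_cons_leftCreation]
      by_cases hij : i = j
      · rw [if_pos hij, if_pos hij.symm, one_apply_eq_self]
      · rw [if_neg hij, if_neg (Ne.symm hij), zero_apply, map_zero]
    rw [inner_ampliation_left, ← ampliation_comp_apply, h1]
    by_cases hij : i = j
    · rw [if_pos hij, if_pos hij, ampliation_one, one_apply_eq_self]
    · have h0 : ampliation E (0 : FullFock n →L[ℂ] FullFock n) = 0 := by
        have := ampliation_smul (H := E) 0 (1 : FullFock n →L[ℂ] FullFock n)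
        rwa [zero_smul, zero_smul] at this
      rw [if_neg hij, if_neg hij, h0, zero_apply, inner_zero_right]
  let e : E →ₗᵢ[ℂ] F := basisTensor []
  have heS : ∀ i d f, inner ℂ (S i f) (e d) = 0 := by
    intro i d f
    rw [inner_ampliation_left, show e d = simpleTensor (fockBasis []) d from rfl,
      ampliation_simpleTensor, adjoint_leftCreation_nil]
    have : simpleTensor (0 : FullFock n) d = 0 := by
      have := simpleTensor_smul_left 0 (0 : FullFock n) d
      rwa [zero_smul, zero_smul] at this
    rw [this, inner_zero_right]
  have heS' : ∀ i d f, inner ℂ (e d) (S i f) = 0 := fun i d f =>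
    inner_eq_zero_symm.1 (heS i d f)
  -- On `H ⊕ (Γ ⊗ E)` the operator is `(h, f) ↦ (T_i h, Ω ⊗ D_i h + (L_i ⊗ I) f)`, with `Ω` the
  -- vacuum. The columns `D_i` complete the Gram matrix of the `T_i` to the identity, and the vacuum
  -- is orthogonal to the ranges of the `L_i`. The first component ignores `f`, so `V_i*` extends
  -- `T_i*`.
  let V : Fin n → K →L[ℂ] K := fun i =>
    ((WithLp.prodContinuousLinearEquiv 2 ℂ H F).symm : H × F →L[ℂ] K) ∘L
      (T i ∘L WithLp.fstL 2 ℂ H F).prod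
        (e.toContinuousLinearMap ∘L D i ∘L WithLp.fstL 2 ℂ H F + S i ∘L WithLp.sndL 2 ℂ H F)
  have hV1 : ∀ i x, (V i x).fst = T i x.fst := fun i x => rfl
  have hV2 : ∀ i x, (V i x).snd = e (D i x.fst) + S i x.snd := fun i x => rfl
  have hinner : ∀ x y : K, inner ℂ x y = inner ℂ x.fst y.fst + inner ℂ x.snd y.snd :=
    fun x y => rfl
  have hV : ∀ i j x y, inner ℂ (V i x) (V j y) = if i = j then inner ℂ x y else 0 := by
    intro i j x y
    rw [hinner, hV1, hV1, hV2, hV2, inner_add_left, inner_add_right, inner_add_right, heS, heS', hS,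
      e.inner_map_map, add_zero, zero_add, ← add_assoc, hD]
    split_ifs
    · exact (hinner x y).symm
    · exact add_zero _
  let J : H →ₗᵢ[ℂ] K :=
    { toLinearMap := (WithLp.linearEquiv 2 ℂ (H × F)).symm.toLinearMap ∘ₗ LinearMap.inl ℂ H F
      norm_map' := fun x => WithLp.norm_toLp_fst 2 H F x }
  have hJ1 : ∀ h, (J h).fst = h := fun h => rfl
  have hJ2 : ∀ h, (J h).snd = 0 := fun h => rfl
  refine ⟨K, inferInstance, inferInstance, inferInstance, V, J, fun i h => ?_, fun i j x => ?_⟩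
  · refine ext_inner_right ℂ fun y => ?_
    rw [inner_star_left, hinner, hinner, hJ1, hJ2, hJ1, hJ2, inner_zero_left, inner_zero_left,
      hV1, inner_star_left]
  · refine ext_inner_left ℂ fun y => ?_
    rw [inner_star_right, hV]
    split_ifs
    · rfl
    · exact (inner_zero_right _).symm

end IsometricDilation

/-! ### Existence of minimal Cuntz–Krieger dilations -/

section Existence

variable {n : ℕ} {A : Matrix (Fin n) (Fin n) ℂ} {H : Type u} [NormedAddCommGroup H]
  [InnerProductSpace ℂ H] [CompleteSpace H] {T : Fin n → H →L[ℂ] H}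

section APiece

variable {K : Type v} [NormedAddCommGroup K] [InnerProductSpace ℂ K] [CompleteSpace K]
  {V : Fin n → K →L[ℂ] K} {J : H →ₗᵢ[ℂ] K}

/-- The vectors on which the adjoints of all products along words that are not `A`-words vanish. -/
def aSubspace (A : Matrix (Fin n) (Fin n) ℂ) (V : Fin n → K →L[ℂ] K) : Submodule ℂ K :=
  ⨅ γ : {γ : List (Fin n) // ¬ IsAWord A γ}, (star (wordProd V γ.1)).ker

theorem mem_aSubspace {x : K} :
    x ∈ aSubspace A V ↔ ∀ γ, ¬ IsAWord A γ → star (wordProd V γ) x = 0 := by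
  simp [aSubspace, Submodule.mem_iInf]

theorem isClosed_aSubspace : IsClosed (aSubspace A V : Set K) := by
  rw [aSubspace, Submodule.coe_iInf]
  exact isClosed_iInter fun γ => ContinuousLinearMap.isClosed_ker _

instance : CompleteSpace (aSubspace A V) := isClosed_aSubspace.completeSpace_coe

theorem star_mem_aSubspace {x : K} (hx : x ∈ aSubspace A V) (i : Fin n) :
    star (V i) x ∈ aSubspace A V := by
  rw [mem_aSubspace] at hx ⊢
  intro γ hγ
  rw [← star_wordProd_cons_apply]
  exact hx (i :: γ) fun h => hγ h.of_cons

theorem star_star_apply_eq_zero {x : K} (hx : x ∈ aSubspace A V) {i j : Fin n} (h : A i j ≠ 1) :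
    star (V j) (star (V i) x) = 0 := by
  have := mem_aSubspace.1 hx [i, j] fun h' => h (List.isChain_cons_cons.1 h').1
  simpa only [star_wordProd_cons_apply, wordProd_nil, star_one, one_apply_eq_self] using this

theorem IsDilation.mem_aSubspace (hJ : IsDilation T V J) (hT : SatisfiesARelations A T) (h : H) :
    J h ∈ aSubspace A V := by
  rw [CKDilation.mem_aSubspace]
  intro γ hγ
  rw [hJ.star_wordProd, hT.wordProd_eq_zero hγ, star_zero, zero_apply, map_zero]

/-- The compression of a tuple of isometries to the subspace `aSubspace`. -/
def aPiece (A : Matrix (Fin n) (Fin n) ℂ) (V : Fin n → K →L[ℂ] K) (i : Fin n) :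
    aSubspace A V →L[ℂ] aSubspace A V :=
  compression (aSubspace A V) (V i)

theorem coe_star_aPiece (i : Fin n) (x : aSubspace A V) :
    (star (aPiece A V i) x : K) = star (V i) x :=
  coe_star_compression (fun _ hx => star_mem_aSubspace hx i) x

theorem star_apply_sub_sum
    (hV : ∀ i j x, star (V i) (V j x) = if i = j then x else 0) (k i : Fin n) (x : K) :
    star (V k) (x - ∑ j, (1 - A i j) • V j (star (V j) x)) = A i k • star (V k) x := by
  rw [map_sub, map_sum, Finset.sum_eq_single k]
  · rw [map_smul, hV, if_pos rfl, sub_smul, one_smul, sub_sub_cancel]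
  · intro j _ hj
    rw [map_smul, hV, if_neg hj.symm, smul_zero]
  · simp

/-- Compressing a dilation to the subspace `aSubspace` gives a dilation. -/
theorem IsDilation.exists_aPiece (hJ : IsDilation T V J)
    (hT : SatisfiesARelations A T) :
    ∃ J' : H →ₗᵢ[ℂ] aSubspace A V, IsDilation T (aPiece A V) J' := by
  refine ⟨{ toLinearMap := J.toLinearMap.codRestrict _ (hJ.mem_aSubspace hT)
            norm_map' := fun h => J.norm_map h }, fun i h => Subtype.ext ?_⟩
  rw [coe_star_aPiece]
  exact hJ i h

section Isometric

variable (hA : ∀ i j, A i j = 0 ∨ A i j = 1)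
  (hV : ∀ i j x, star (V i) (V j x) = if i = j then x else 0)
include hA hV

/-- The correction removes from `x` the components beginning with a letter that may not follow `i`.
What remains can be preceded by `i`: if `a_{il} = 1` and `i l γ` is not an `A`-word, neither is `l
γ`. -/
theorem apply_sub_sum_mem_aSubspace {x : K} (hx : x ∈ aSubspace A V) (i : Fin n) :
    V i (x - ∑ j, (1 - A i j) • V j (star (V j) x)) ∈ aSubspace A V := by
  rw [mem_aSubspace]
  intro γ hγ
  cases γ with
  | nil => exact absurd List.isChain_nil hγ
  | cons k γ =>
    rw [star_wordProd_cons_apply, hV]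
    by_cases hki : k = i
    · subst hki
      rw [if_pos rfl]
      cases γ with
      | nil => exact absurd (List.isChain_singleton k) hγ
      | cons l γ =>
        rw [star_wordProd_cons_apply, star_apply_sub_sum hV]
        rcases hA k l with h | h
        · rw [h, zero_smul, map_zero]
        · rw [h, one_smul, ← star_wordProd_cons_apply]
          exact mem_aSubspace.1 hx _ fun h' => hγ (List.isChain_cons_cons.2 ⟨h, h'⟩)
    · rw [if_neg hki, map_zero]

/-- The removed terms `V_i V_j V_j* x` with `a_{ij} = 0` are orthogonal to the subspace, because
`V_j* V_i*` vanishes on it; the rest already lies in it. -/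
theorem coe_aPiece (i : Fin n) (x : aSubspace A V) :
    (aPiece A V i x : K) = V i ((x : K) - ∑ j, (1 - A i j) • V j (star (V j) x)) := by
  suffices aPiece A V i x = ⟨_, apply_sub_sum_mem_aSubspace hA hV x.2 i⟩ by rw [this]
  refine ext_inner_left ℂ fun y => ?_
  rw [aPiece, inner_compression_right, Submodule.coe_inner]
  change _ = inner ℂ (y : K) (V i ((x : K) - ∑ j, (1 - A i j) • V j (star (V j) x)))
  rw [map_sub, inner_sub_right, eq_comm, sub_eq_self, map_sum, inner_sum]
  refine Finset.sum_eq_zero fun j _ => ?_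
  rw [map_smul, inner_smul_right, ← inner_star_left, ← inner_star_left]
  rcases hA i j with h | h
  · rw [star_star_apply_eq_zero y.2 (by rw [h]; exact zero_ne_one), inner_zero_left, mul_zero]
  · rw [h, sub_self, zero_mul]

/-- No correction is needed after `V_i*`, whose values on the subspace are killed by `V_j*` whenever
`a_{ij} = 0`. -/
theorem coe_aPiece_star (i : Fin n) (x : aSubspace A V) :
    (aPiece A V i (star (aPiece A V i) x) : K) = V i (star (V i) x) := by
  rw [coe_aPiece hA hV, coe_star_aPiece, Finset.sum_eq_zero, sub_zero]
  intro j _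
  rcases hA i j with h | h
  · rw [star_star_apply_eq_zero x.2 (by rw [h]; exact zero_ne_one), map_zero, smul_zero]
  · rw [h, sub_self, zero_smul]

theorem isCuntzKriegerTuple_aPiece : IsCuntzKriegerTuple A (aPiece A V) where
  partialIsometry i := by
    ext x
    rw [mul_apply_eq_comp, mul_apply_eq_comp, coe_aPiece_star hA hV, coe_aPiece hA hV, hV,
      if_pos rfl]
  orthogonalRanges i j hij := by
    ext x
    rw [mul_apply_eq_comp, coe_star_aPiece, coe_aPiece hA hV, hV, if_neg hij]
    rfl
  aRelations := satisfiesARelations_of_mul_eq_zero fun i j hij => by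
    apply star_injective
    rw [star_mul, star_zero]
    ext x
    rw [mul_apply_eq_comp, coe_star_aPiece, coe_star_aPiece, star_star_apply_eq_zero x.2 hij]
    rfl
  cuntzKrieger i := by
    ext x
    rw [mul_apply_eq_comp, coe_star_aPiece, coe_aPiece hA hV, hV, if_pos rfl, sub_apply, sum_apply,
      Submodule.coe_sub, Submodule.coe_sum, one_apply_eq_self]
    congr 1
    refine Finset.sum_congr rfl fun j _ => ?_
    rw [smul_apply, Submodule.coe_smul, mul_apply_eq_comp, coe_aPiece_star hA hV]

end Isometric

end APiece

/-! ### Restriction to the generated subspace -/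

section Span

variable {H : Type u} [NormedAddCommGroup H] [InnerProductSpace ℂ H]
  {L : Type v} [NormedAddCommGroup L] [InnerProductSpace ℂ L]
  {R : Fin n → L →L[ℂ] L} {J : H →ₗᵢ[ℂ] L}

/-- The span of the vectors `R^α h`. -/
def dilationSpan (R : Fin n → L →L[ℂ] L) (J : H →ₗᵢ[ℂ] L) : Submodule ℂ L :=
  Submodule.span ℂ {x : L | ∃ (α : List (Fin n)) (h : H), x = wordProd R α (J h)}

theorem wordProd_mem_dilationSpan (α : List (Fin n)) (h : H) :
    wordProd R α (J h) ∈ dilationSpan R J :=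
  Submodule.subset_span ⟨α, h, rfl⟩

theorem apply_mem_of_forall_wordProd {X : L →L[ℂ] L}
    (hX : ∀ α h, X (wordProd R α (J h)) ∈ dilationSpan R J) {x : L} (hx : x ∈ dilationSpan R J) :
    X x ∈ dilationSpan R J := by
  have : dilationSpan R J ≤ (dilationSpan R J).comap X.toLinearMap := by
    refine Submodule.span_le.2 ?_
    rintro _ ⟨α, h, rfl⟩
    exact hX α h
  exact this hx

theorem apply_mem_dilationSpan (i : Fin n) {x : L} (hx : x ∈ dilationSpan R J) :
    R i x ∈ dilationSpan R J :=
  apply_mem_of_forall_wordProd (fun α h => by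
    have := wordProd_mem_dilationSpan (R := R) (J := J) (i :: α) h
    rwa [wordProd_cons, mul_apply_eq_comp] at this) hx

theorem apply_mem_topologicalClosure {N : Submodule ℂ L} {X : L →L[ℂ] L} (hX : ∀ x ∈ N, X x ∈ N)
    {x : L} (hx : x ∈ N.topologicalClosure) : X x ∈ N.topologicalClosure := by
  have : N.topologicalClosure ≤ N.topologicalClosure.comap X.toLinearMap :=
    Submodule.topologicalClosure_minimal _
      (fun y hy => Submodule.le_topologicalClosure N (hX y hy))
      ((Submodule.isClosed_topologicalClosure N).preimage X.continuous)
  exact this hx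

end Span

section Minimal

variable {L : Type v} [NormedAddCommGroup L] [InnerProductSpace ℂ L] [CompleteSpace L]
  {R : Fin n → L →L[ℂ] L} {J : H →ₗᵢ[ℂ] L}

theorem coe_compression {N : Submodule ℂ L} [CompleteSpace N] {X : L →L[ℂ] L}
    (h : ∀ x ∈ N, X x ∈ N) (x : N) : (compression N X x : L) = X x := by
  suffices compression N X x = ⟨X x, h x x.2⟩ by rw [this]
  exact ext_inner_left ℂ fun y => inner_compression_right N X y x

/-- Induct on the word: `R_i* R_k R^β h` vanishes for `k ≠ i`, and for `k = i` the Cuntz–Krieger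
relation rewrites it through `R^β h` and the `R_j R_j* R^β h`. Hence the span reduces the tuple. -/
theorem IsCuntzKriegerTuple.star_apply_mem_dilationSpan (hR : IsCuntzKriegerTuple A R)
    (hJ : IsDilation T R J) (i : Fin n) {x : L} (hx : x ∈ dilationSpan R J) :
    star (R i) x ∈ dilationSpan R J := by
  refine apply_mem_of_forall_wordProd (fun α h => ?_) hx
  induction α generalizing i with
  | nil =>
    rw [wordProd_nil, one_apply_eq_self, hJ]
    have := wordProd_mem_dilationSpan (R := R) (J := J) [] (star (T i) h)
    rwa [wordProd_nil, one_apply_eq_self] at this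
  | cons k β ih =>
    rw [wordProd_cons, mul_apply_eq_comp]
    by_cases hik : i = k
    · subst hik
      have h1 := DFunLike.congr_fun (hR.cuntzKrieger i) (wordProd R β (J h))
      rw [mul_apply_eq_comp, sub_apply, one_apply_eq_self, sum_apply] at h1
      rw [h1]
      refine Submodule.sub_mem _ (wordProd_mem_dilationSpan β h) (Submodule.sum_mem _ fun j _ => ?_)
      rw [smul_apply, mul_apply_eq_comp]
      exact Submodule.smul_mem _ _ (apply_mem_dilationSpan j (ih j))
    · rw [hR.star_apply_apply_of_ne hik]
      exact Submodule.zero_mem _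

/-- Every Cuntz-Krieger dilation restricts to a minimal one. -/
theorem IsCuntzKriegerTuple.exists_minimal (hR : IsCuntzKriegerTuple A R) (hJ : IsDilation T R J) :
    ∃ (N : Submodule ℂ L) (_ : CompleteSpace N) (R' : Fin n → N →L[ℂ] N) (J' : H →ₗᵢ[ℂ] N),
      IsMinimalCuntzKriegerDilation A T R' J' := by
  let N : Submodule ℂ L := (dilationSpan R J).topologicalClosure
  have hN : CompleteSpace N := (Submodule.isClosed_topologicalClosure _).completeSpace_coe
  have h1 : ∀ i, ∀ x ∈ N, R i x ∈ N := fun i x hx =>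
    apply_mem_topologicalClosure (fun y hy => apply_mem_dilationSpan i hy) hx
  have h2 : ∀ i, ∀ x ∈ N, star (R i) x ∈ N := fun i x hx =>
    apply_mem_topologicalClosure (fun y hy => hR.star_apply_mem_dilationSpan hJ i hy) hx
  let R' : Fin n → N →L[ℂ] N := fun i => compression N (R i)
  have c1 : ∀ i (x : N), (R' i x : L) = R i x := fun i x => coe_compression (h1 i) x
  have c2 : ∀ i (x : N), (star (R' i) x : L) = star (R i) x := fun i x =>
    coe_star_compression (h2 i) x
  have hJN : ∀ h, J h ∈ N := fun h => by
    have := wordProd_mem_dilationSpan (R := R) (J := J) [] h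
    rw [wordProd_nil, one_apply_eq_self] at this
    exact Submodule.le_topologicalClosure _ this
  let J' : H →ₗᵢ[ℂ] N :=
    { toLinearMap := J.toLinearMap.codRestrict N hJN
      norm_map' := fun h => J.norm_map h }
  have c3 : ∀ h, (J' h : L) = J h := fun h => rfl
  have c4 : ∀ α (x : N), (wordProd R' α x : L) = wordProd R α x := by
    intro α x
    induction α with
    | nil => rw [wordProd_nil, wordProd_nil, one_apply_eq_self, one_apply_eq_self]
    | cons i α ih =>
      rw [wordProd_cons, wordProd_cons, mul_apply_eq_comp, mul_apply_eq_comp, c1, ih]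
  refine ⟨N, hN, R', J', ⟨fun i h => ?_, fun i => ?_, fun i j hij => ?_, fun i j => ?_,
    fun i => ?_, ?_⟩⟩
  · apply Subtype.ext
    rw [c2, c3, c3]
    exact hJ i h
  · ext x
    simp only [mul_apply_eq_comp, c1, c2]
    exact DFunLike.congr_fun (hR.partialIsometry i) (x : L)
  · ext x
    simp only [mul_apply_eq_comp, c1, c2]
    exact DFunLike.congr_fun (hR.orthogonalRanges i j hij) (x : L)
  · ext x
    simp only [smul_apply, mul_apply_eq_comp, c1, Submodule.coe_smul]
    exact DFunLike.congr_fun (hR.aRelations i j) (x : L)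
  · ext x
    simp only [smul_apply, mul_apply_eq_comp, c1, c2, Submodule.coe_smul, sub_apply, sum_apply,
      Submodule.coe_sub, Submodule.coe_sum, one_apply_eq_self]
    have := DFunLike.congr_fun (hR.cuntzKrieger i) (x : L)
    simpa only [smul_apply, mul_apply_eq_comp, sub_apply, sum_apply, one_apply_eq_self] using this
  · rw [IsMinimalDilation, Submodule.topologicalClosure_eq_top_iff, Submodule.eq_bot_iff]
    intro z hz
    have h3 : ∀ x ∈ dilationSpan R J, inner ℂ (z : L) x = 0 := by
      intro x hx
      induction hx using Submodule.span_induction with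
      | mem x hx =>
        obtain ⟨α, h, rfl⟩ := hx
        have := (Submodule.mem_orthogonal' _ z).1 hz _ (Submodule.subset_span ⟨α, h, rfl⟩)
        rwa [Submodule.coe_inner, c4, c3] at this
      | zero => exact inner_zero_right _
      | add x y _ _ hx hy => rw [inner_add_right, hx, hy, add_zero]
      | smul c x _ hx => rw [inner_smul_right, hx, mul_zero]
    have h4 : (z : L) ∈ (dilationSpan R J).topologicalClosureᗮ := by
      rw [Submodule.orthogonal_closure, Submodule.mem_orthogonal']
      exact h3
    have h5 := (Submodule.mem_orthogonal' _ _).1 h4 z z.2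
    exact Subtype.ext (inner_self_eq_zero.1 h5)

end Minimal

/-- Minimal Cuntz-Krieger dilations exist. -/
theorem exists_isMinimalCuntzKriegerDilation (hA : ∀ i j, A i j = 0 ∨ A i j = 1)
    (hcontr : IsContractiveTuple T) (hrel : SatisfiesARelations A T) :
    ∃ (L : Type u) (_ : NormedAddCommGroup L) (_ : InnerProductSpace ℂ L) (_ : CompleteSpace L)
      (R : Fin n → L →L[ℂ] L) (J : H →ₗᵢ[ℂ] L), IsMinimalCuntzKriegerDilation A T R J := by
  obtain ⟨K, _, _, _, V, J, hJ, hV⟩ := exists_isometric_dilation hcontr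
  obtain ⟨J', hJ'⟩ := hJ.exists_aPiece hrel
  obtain ⟨N, hN, R, J'', h⟩ := (isCuntzKriegerTuple_aPiece hA hV).exists_minimal hJ'
  exact ⟨N, inferInstance, inferInstance, hN, R, J'', h⟩

end Existence

end CKDilation

end

theorem lemma22 {n : ℕ} (A : Matrix (Fin n) (Fin n) ℂ)
    (hA : ∀ i j, A i j = 0 ∨ A i j = 1)
    {H : Type u} [NormedAddCommGroup H] [InnerProductSpace ℂ H] [CompleteSpace H]
    (T : Fin n → H →L[ℂ] H)
    (hcontr : CKDilation.IsContractiveTuple T)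
    (hcomm : ∀ i j, T i * T j = T j * T i)
    (hrel : CKDilation.SatisfiesARelations A T) :
    (∃ (L : Type u) (_ : NormedAddCommGroup L) (_ : InnerProductSpace ℂ L) (_ : CompleteSpace L)
      (R : Fin n → L →L[ℂ] L) (J : H →ₗᵢ[ℂ] L),
      CKDilation.IsMinimalCuntzKriegerDilation A T R J) ∧
    (∃ (M : Type u) (_ : NormedAddCommGroup M) (_ : InnerProductSpace ℂ M) (_ : CompleteSpace M)
      (Wd : Fin n → M →L[ℂ] M) (V : H →ₗᵢ[ℂ] M),
      CKDilation.IsStandardCommutingADilation A T Wd V) ∧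
    ∀ (L : Type v) [NormedAddCommGroup L] [InnerProductSpace ℂ L] [CompleteSpace L]
      (R : Fin n → L →L[ℂ] L) (J : H →ₗᵢ[ℂ] L),
      CKDilation.IsMinimalCuntzKriegerDilation A T R J →
      ∀ (M : Type w) [NormedAddCommGroup M] [InnerProductSpace ℂ M] [CompleteSpace M]
        (Wd : Fin n → M →L[ℂ] M) (V : H →ₗᵢ[ℂ] M),
        CKDilation.IsStandardCommutingADilation A T Wd V →
        ∃ (hJ : ∀ h, J h ∈ CKDilation.maximalCommutingSubspace R)
          (U : CKDilation.maximalCommutingSubspace R ≃ₗᵢ[ℂ] M),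
          (∀ i x, U (CKDilation.maximalCommutingPiece R i x) = Wd i (U x)) ∧
          ∀ h, U ⟨J h, hJ h⟩ = V h := by
  have hT : CKDilation.IsCommutingATuple A T := ⟨hcontr, hcomm, hrel⟩
  obtain ⟨L, _, _, _, R, J, hR⟩ := CKDilation.exists_isMinimalCuntzKriegerDilation hA hcontr hrel
  refine ⟨⟨L, _, _, _, R, J, hR⟩, ?_, fun L _ _ _ R J hR M _ _ _ Wd V hW =>
    hR.exists_unitary hT hW⟩
  -- The maximal commuting piece of the dilation just obtained serves as the standard commuting
  -- dilation.
  exact ⟨CKDilation.maximalCommutingSubspace R, inferInstance, inferInstance, inferInstance,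
    CKDilation.maximalCommutingPiece R, CKDilation.commutingEmbedding hR.dilation hT.comm,
    hR.exists_isMinimalStinespring hT⟩
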